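/- Let $M$ be a compact smooth manifold (Hausdorff, without boundary) and let $A\to M$ be a smooth real vector bundle of finite rank with a Lie algebroid structure, with anchor $\rho:A\to TM$ and bracket $[\cdot,\cdot]$ on $\Gamma(A)$. An integrable almost complex structure on $A$ is a smooth bundle map $j:A\to A$ over $\mathrm{id}_M$ with $j^2=-\mathrm{id}$ and $$[ja,jb]-[a,b]-j\big([ja,b]+[a,jb]\big)=0\qquad\text{for all }a,b\in\Gamma(A).$$ Let $A^{1,0}$ and $A^{0,1}$ denote the $+i$- and $-i$-eigenbundles of $j$ in $A\otimes\mathbb C$, let $\mathrm{pr}^{1,0}:A\otimes\mathbb C\to A^{1,0}$ be the projection along $A^{0,1}$, and extend the bracket $\mathbb C$-bilinearly. For $w\in\Gamma(A^{1,0})$ let $\bar\partial w$ be the $A^{1,0}$-valued form on $A^{0,1}$ given by $(\bar\partial w)(X)=\mathrm{pr}^{1,0}[X,w]$ for $X\in\Gamma(A^{0,1})$; this is the degree-$0$ Lie algebroid differential of $A^{0,1}$ with values in the module $A^{1,0}$. Let $(j_t)_{t\in[0,1]}$ be a smooth family of integrable almost complex structures on $A$, with associated bundles $A^{1,0}_t,A^{0,1}_t$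 and operators $\bar\partial_t$, and let $\dot j_t$ be its time derivative, extended $\mathbb C$-linearly to $A\otimes\mathbb C$. Suppose that there is a smooth family of sections $z_t\in\Gamma(A^{0,1}_t)$, $t\in[0,1]$, such that for all $t\in[0,1]$ $$\bar\partial_t\,\overline{z_t}=-2\,\dot j_t,\qquad\text{i.e. } (\bar\partial_t\overline{z_t})(X)=-2\,\dot j_t(X)\ \text{ for all } X\in\Gamma(A^{0,1}_t).$$ Then $j_0$ and $j_1$ are isomorphic: there is a Lie algebroid automorphism $\phi$ of $A$ (a vector bundle automorphism, covering a diffeomorphism of $M$, that is compatible with the anchor and the bracket) such that $j_1=\phi^{-1}\circ j_0\circ\phi$. -/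

import Mathlib

open Set Bundle
open scoped Manifold ContDiff TensorProduct

noncomputable section

namespace Algebroid

section BundleMaps

variable {E : Type*} [NormedAddCommGroup E] [NormedSpace ℝ E]
  {H : Type*} [TopologicalSpace H] (I : ModelWithCorners ℝ E H)
  {M : Type*} [TopologicalSpace M] [ChartedSpace H M]
  (F₁ : Type*) [NormedAddCommGroup F₁] [NormedSpace ℝ F₁]
  (A : M → Type*) [∀ x, AddCommGroup (A x)] [∀ x, Module ℝ (A x)]
  [TopologicalSpace (TotalSpace F₁ A)] [∀ x, TopologicalSpace (A x)] [FiberBundle F₁ A]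
  (F₂ : Type*) [NormedAddCommGroup F₂] [NormedSpace ℝ F₂]
  (B : M → Type*) [∀ x, AddCommGroup (B x)] [∀ x, Module ℝ (B x)]
  [TopologicalSpace (TotalSpace F₂ B)] [∀ x, TopologicalSpace (B x)] [FiberBundle F₂ B]

/-- A smooth vector bundle map `A → B` over the identity of `M`. -/
structure BundleMap where
  /-- the linear map between the fibres over `x` -/
  toFun : ∀ x, A x →L[ℝ] B x
  /-- the map of total spaces is smooth -/
  smooth : ContMDiff (I.prod 𝓘(ℝ, F₁)) (I.prod 𝓘(ℝ, F₂)) ∞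
    (fun p : TotalSpace F₁ A => (⟨p.1, toFun p.1 p.2⟩ : TotalSpace F₂ B))

end BundleMaps

variable {E : Type*} [NormedAddCommGroup E] [NormedSpace ℝ E]
  {H : Type*} [TopologicalSpace H] (I : ModelWithCorners ℝ E H)
  {M : Type*} [TopologicalSpace M] [ChartedSpace H M]
  (F : Type*) [NormedAddCommGroup F] [NormedSpace ℝ F]
  (A : M → Type*) [∀ x, AddCommGroup (A x)] [∀ x, Module ℝ (A x)]
  [TopologicalSpace (TotalSpace F A)] [∀ x, TopologicalSpace (A x)] [FiberBundle F A]
  [VectorBundle ℝ F A]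

/-- The real vector space `Γ(A)` of smooth sections of `A`. -/
abbrev Sections := ContMDiffSection I F ∞ A

/-- The complex vector space `Γ(A ⊗ ℂ)` of smooth sections of the complexification of `A`,
that is, formal combinations `a + i b` with `a, b ∈ Γ(A)`, realised as `ℂ ⊗ Γ(A)`. -/
abbrev ComplexSections := ℂ ⊗[ℝ] Sections I F A

variable {I F A}

/-- The section `f b` for a smooth function `f` and a smooth section `b`. -/
def smulSection (f : C^∞⟮I, M; ℝ⟯) (b : Sections I F A) : Sections I F A :=
  ⟨(f : M → ℝ) • (b : ∀ x, A x), f.contMDiff.smul_section b.contMDiff⟩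

/-- Evaluation `Γ(A) → A x` at the point `x`. -/
def evalAt (x : M) : Sections I F A →ₗ[ℝ] A x where
  toFun a := a x
  map_add' _ _ := rfl
  map_smul' _ _ := rfl

/-- The endomorphism of `Γ(A)` induced by a bundle endomorphism of `A`. -/
def BundleMap.onSections (j : BundleMap I F A F A) :
    Sections I F A →ₗ[ℝ] Sections I F A where
  toFun a := ⟨fun x => j.toFun x (a x), j.smooth.comp a.contMDiff⟩
  map_add' a b := by ext x; exact map_add (j.toFun x) (a x) (b x)
  map_smul' c a := by ext x; exact map_smul (j.toFun x) c (a x)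

/-- The `ℂ`-linear extension to `Γ(A ⊗ ℂ)` of a bundle endomorphism of `A`. -/
def BundleMap.onComplexSections (j : BundleMap I F A F A) :
    ComplexSections I F A →ₗ[ℂ] ComplexSections I F A :=
  j.onSections.baseChange ℂ

/-- Complex conjugation `a + i b ↦ a - i b` on `Γ(A ⊗ ℂ)`. -/
def conj : ComplexSections I F A →ₗ[ℝ] ComplexSections I F A :=
  LinearMap.rTensor (Sections I F A) Complex.conjAe.toLinearMap

/-- `Γ(A^{1,0})`: the `+i`-eigenspace of `j` on `Γ(A ⊗ ℂ)`. -/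
def sections10 (j : BundleMap I F A F A) : Submodule ℂ (ComplexSections I F A) :=
  Module.End.eigenspace j.onComplexSections Complex.I

/-- `Γ(A^{0,1})`: the `-i`-eigenspace of `j` on `Γ(A ⊗ ℂ)`. -/
def sections01 (j : BundleMap I F A F A) : Submodule ℂ (ComplexSections I F A) :=
  Module.End.eigenspace j.onComplexSections (-Complex.I)

theorem onComplexSections_conj (j : BundleMap I F A F A) (z : ComplexSections I F A) :
    j.onComplexSections (conj z) = conj (j.onComplexSections z) := by
  induction z using TensorProduct.induction_on with
  | zero => simp
  | tmul c a => simp [conj, BundleMap.onComplexSections]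
  | add y z hy hz => simp only [map_add, hy, hz]

theorem conj_smul (c : ℂ) (z : ComplexSections I F A) :
    conj (c • z) = (starRingEnd ℂ c) • conj z := by
  induction z using TensorProduct.induction_on with
  | zero => simp
  | tmul d a => simp [conj, TensorProduct.smul_tmul']
  | add y z hy hz => simp only [smul_add, map_add, hy, hz]

/-- Conjugation maps `Γ(A^{0,1})` to `Γ(A^{1,0})`. -/
theorem conj_mem_sections10 {j : BundleMap I F A F A} {z : ComplexSections I F A}
    (hz : z ∈ sections01 j) : conj z ∈ sections10 j := by
  rw [sections01, Module.End.mem_eigenspace_iff] at hz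
  rw [sections10, Module.End.mem_eigenspace_iff, onComplexSections_conj, hz, conj_smul]
  simp

/-- For `j² = -1`, the projection `(1 - i j) / 2` of `A ⊗ ℂ = A^{1,0} ⊕ A^{0,1}` onto `A^{1,0}`
along `A^{0,1}`, on sections. -/
def pr10 (j : BundleMap I F A F A) : ComplexSections I F A →ₗ[ℂ] ComplexSections I F A :=
  (1 / 2 : ℂ) • (LinearMap.id - Complex.I • j.onComplexSections)

/-- The path `t ↦ a t`, `t ∈ [0,1]`, of sections of `A` is smooth (jointly in `t` and the point). -/
def IsSmoothPath (a : ℝ → Sections I F A) : Prop :=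
  ContMDiffOn (𝓘(ℝ, ℝ).prod I) (I.prod 𝓘(ℝ, F)) ∞
    (fun p : ℝ × M => (⟨p.2, a p.1 p.2⟩ : TotalSpace F A)) (Icc (0 : ℝ) 1 ×ˢ univ)

/-- The path `t ↦ z t`, `t ∈ [0,1]`, of sections of `A ⊗ ℂ` is smooth: its real and imaginary
parts are. -/
def IsSmoothComplexPath (z : ℝ → ComplexSections I F A) : Prop :=
  ∃ a b : ℝ → Sections I F A, IsSmoothPath a ∧ IsSmoothPath b ∧
    ∀ t ∈ Icc (0 : ℝ) 1, z t = (1 : ℂ) ⊗ₜ[ℝ] a t + Complex.I ⊗ₜ[ℝ] b t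

/-- The path `t ↦ j t`, `t ∈ [0,1]`, of bundle endomorphisms of `A` is smooth. -/
def IsSmoothEndPath (j : ℝ → BundleMap I F A F A) : Prop :=
  ContMDiffOn (𝓘(ℝ, ℝ).prod (I.prod 𝓘(ℝ, F))) (I.prod 𝓘(ℝ, F)) ∞
    (fun p : ℝ × TotalSpace F A => (⟨p.2.1, (j p.1).toFun p.2.1 p.2.2⟩ : TotalSpace F A))
    (Icc (0 : ℝ) 1 ×ˢ univ)

/-- The time derivative at `t` (one-sided at `0` and `1`) of a path of endomorphisms of the
fibre `A x`; the derivative is taken after identifying `A x` with the model fibre `F`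
by a linear isomorphism, on the choice of which it does not depend. -/
def timeDeriv (j : ℝ → BundleMap I F A F A) (t : ℝ) (x : M) : A x →L[ℝ] A x :=
  (trivializationAt F A x).symmL ℝ x ∘L
    derivWithin (fun s => (trivializationAt F A x).continuousLinearMapAt ℝ x ∘L
      (j s).toFun x ∘L (trivializationAt F A x).symmL ℝ x) (Icc (0 : ℝ) 1) t ∘L
    (trivializationAt F A x).continuousLinearMapAt ℝ x

/-- The derivative `v f` of a function `f` on `M` along a tangent vector `v`. -/
def dirDeriv (f : M → ℝ) (x : M) (v : TangentSpace I x) : ℝ :=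
  mfderiv I 𝓘(ℝ, ℝ) f x v

variable (I F A) in
/-- A Lie algebroid structure on the vector bundle `A → M`. -/
structure LieAlgebroid [IsManifold I ∞ M] where
  /-- the anchor `A → TM` -/
  anchor : BundleMap I F A E (TangentSpace I : M → Type _)
  /-- the bracket on `Γ(A)` -/
  bracket : Sections I F A →ₗ[ℝ] Sections I F A →ₗ[ℝ] Sections I F A
  bracket_self : ∀ a, bracket a a = 0
  jacobi : ∀ a b c,
    bracket (bracket a b) c + bracket (bracket b c) a + bracket (bracket c a) b = 0
  anchor_bracket : ∀ a b x, anchor.toFun x (bracket a b x) =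
    VectorField.mlieBracket I (fun y => anchor.toFun y (a y)) (fun y => anchor.toFun y (b y)) x
  leibniz : ∀ (a b : Sections I F A) (f : C^∞⟮I, M; ℝ⟯) (x : M),
    bracket a (smulSection f b) x =
      f x • bracket a b x + dirDeriv f x (anchor.toFun x (a x)) • b x

namespace LieAlgebroid

variable [IsManifold I ∞ M] (L : LieAlgebroid I F A)

/-- The `ℂ`-bilinear extension of the bracket to `Γ(A ⊗ ℂ)`. -/
def complexBracket : ComplexSections I F A →ₗ[ℂ] ComplexSections I F A →ₗ[ℂ]
    ComplexSections I F A :=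
  LinearMap.BilinMap.baseChange ℂ L.bracket

/-- An integrable almost complex structure on a Lie algebroid: `j² = -1`, and the Nijenhuis
tensor of `j` vanishes. -/
structure IsIntegrableComplexStructure (j : BundleMap I F A F A) : Prop where
  sq : ∀ x (v : A x), j.toFun x (j.toFun x v) = -v
  nijenhuis : ∀ a b : Sections I F A,
    L.bracket (j.onSections a) (j.onSections b) - L.bracket a b
      - j.onSections (L.bracket (j.onSections a) b + L.bracket a (j.onSections b)) = 0

/-- The differential `∂̄ : Γ(A^{1,0}) = C⁰(A^{0,1}, A^{1,0}) → C¹(A^{0,1}, A^{1,0})` of the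
Lie algebroid `A^{0,1}` with values in the module `A^{1,0}`, in degree `0`: for
`w ∈ Γ(A^{1,0})` and `X ∈ Γ(A^{0,1})`, `(∂̄ w)(X) = X ▷ w = pr^{1,0} [X, w]`. -/
def dbar (j : BundleMap I F A F A) (w X : ComplexSections I F A) : ComplexSections I F A :=
  pr10 j (L.complexBracket X w)

/-- An automorphism of a Lie algebroid: a diffeomorphism of the total space of `A`, linear on
fibres, covering a diffeomorphism of `M`, compatible with the anchor and the bracket. -/
structure Automorphism where
  /-- the diffeomorphism of the base -/
  base : M ≃ₘ^∞⟮I, I⟯ M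
  /-- the linear map between fibres -/
  fiber : ∀ x, A x →L[ℝ] A (base x)
  /-- the diffeomorphism of the total space -/
  total : TotalSpace F A ≃ₘ^∞⟮I.prod 𝓘(ℝ, F), I.prod 𝓘(ℝ, F)⟯ TotalSpace F A
  total_apply : ∀ x (v : A x), total ⟨x, v⟩ = ⟨base x, fiber x v⟩
  map_anchor : ∀ x (v : A x),
    L.anchor.toFun (base x) (fiber x v) = mfderiv I I base x (L.anchor.toFun x v)
  /-- if `a'` and `b'` are the push-forwards of `a` and `b`, then `[a', b']` is the push-forward
  of `[a, b]` -/
  map_bracket : ∀ a a' b b' : Sections I F A,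
    (∀ x, a' (base x) = fiber x (a x)) → (∀ x, b' (base x) = fiber x (b x)) →
      ∀ x, L.bracket a' b' (base x) = fiber x (L.bracket a b x)

end LieAlgebroid

end Algebroid

end

open Algebroid

/-! This is a Moser argument. Write `z_t = u_t + i v_t` with `u_t`, `v_t` real; type `(0,1)` forces
`v_t = j_t u_t`. Evaluate `∂̄_t z̄_t = -2 j̇_t` on `X = b + i j_t b` and take real parts. The
vanishing of the Nijenhuis tensor on the pair `(b, u_t)` removes the term `j_t [j_t b, u_t]`, and
what remains is `[v_t, j_t b] - j_t [v_t, b] = 2 j̇_t b` (`lieDerivative_of_dbar`). So `j̇_t` is the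
Lie derivative of `j_t` along `a_t = v_t / 2`. The derivation `[a_t, ·]` integrates to a flow of Lie
algebroid automorphisms, because `M` is compact, and this flow carries `j_0` to `j_1`.

The flow is built by hand. Lipschitz smooth vector fields on Banach spaces have smooth flows
(`contDiff_flow`: contraction principle plus implicit function theorem). A compact manifold is
embedded in a vector space, and fields on it are extended and cut off there
(`exists_timeDependentFlow`); linear equations with parameters in `M` are treated likewise
(`exists_linearFlow`). Finitely many global sections present `A` as the image of a smooth family `P`
of projections of a trivial bundle (`Generators`), so a flow on `A` becomes the flow of `-ρ(a_t)` on
`M` together with a matrix equation.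

The resulting `Transport` has one essential property: the transport of a family `e_t` has as time
derivative the transport of `e'_t - [a_t, e_t]`. Hence families with `e' = [a, e]` are carried back
to their initial values, and every section is such an initial value. These families are closed under
brackets by the Jacobi identity, and under `j_t` when `j̇ = L_a j`. This makes the time-one map
compatible with the bracket and makes it intertwine `j_1` with `j_0`. Compatibility with the anchor
then follows from the Leibniz rule.

Time is reparametrised by a smooth step function, so that data given on `[0,1]` become smooth on the
whole line, with a generating section that vanishes outside `[0,1]`. -/

noncomputable section

set_option linter.unusedSectionVars false

namespace SmoothFlow

open Topology NNReal MeasureTheory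

set_option linter.unusedSectionVars false

/-! ### Composition operators on spaces of continuous paths -/

section Nemytskii

universe u

variable {K : Type*} [TopologicalSpace K] [CompactSpace K]

/-- Pointwise application of a bilinear map to continuous families. -/
def pointwiseApply (K : Type*) [TopologicalSpace K] [CompactSpace K]
    {L Z W : Type*} [NormedAddCommGroup L] [NormedSpace ℝ L] [NormedAddCommGroup Z]
    [NormedSpace ℝ Z] [NormedAddCommGroup W] [NormedSpace ℝ W] (B : L →L[ℝ] Z →L[ℝ] W) :
    C(K, L) →L[ℝ] C(K, Z) →L[ℝ] C(K, W) :=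
  LinearMap.mkContinuous₂
    (LinearMap.mk₂ ℝ (fun (A : C(K, L)) (h : C(K, Z)) =>
        (⟨fun s => B (A s) (h s), by fun_prop⟩ : C(K, W)))
      (fun _ _ _ => by ext; simp) (fun _ _ _ => by ext; simp)
      (fun _ _ _ => by ext; simp) (fun _ _ _ => by ext; simp)) ‖B‖
    (fun A h => by
      refine (ContinuousMap.norm_le _ (by positivity)).2 fun s => ?_
      refine (B.le_opNorm₂ _ _).trans ?_
      gcongr
      · exact A.norm_coe_le_norm s
      · exact h.norm_coe_le_norm s)

/-- The map `γ ↦ f' ∘ γ` is continuous for the sup norm, so `f'` varies by at most `ε` near the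
compact image of `γ`, uniformly in `s`; the mean value inequality on the ball about `γ s` then
bounds the remainder at every `s` at once. -/
theorem hasFDerivAt_comp_left {L Z W : Type*} [NormedAddCommGroup L] [NormedSpace ℝ L]
    [NormedAddCommGroup Z] [NormedSpace ℝ Z] [NormedAddCommGroup W] [NormedSpace ℝ W]
    (B : L →L[ℝ] Z →L[ℝ] W) (hB : ∀ l, ‖B l‖ ≤ ‖l‖) (f : C(Z, W)) (f' : C(Z, L))
    (hf : ∀ z, HasFDerivAt f (B (f' z)) z) (γ : C(K, Z)) :
    HasFDerivAt (fun γ : C(K, Z) => f.comp γ) (pointwiseApply K B (f'.comp γ)) γ := by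
  rw [hasFDerivAt_iff_isLittleO_nhds_zero, Asymptotics.isLittleO_iff]
  intro ε hε
  have hc : Continuous fun γ : C(K, Z) => f'.comp γ := ContinuousMap.continuous_postcomp f'
  obtain ⟨δ, hδ, H⟩ := Metric.continuousAt_iff.1 hc.continuousAt ε hε
  filter_upwards [Metric.ball_mem_nhds (0 : C(K, Z)) hδ] with h hh
  rw [mem_ball_zero_iff] at hh
  refine (ContinuousMap.norm_le _ (by positivity)).2 fun s => ?_
  have key : ∀ z ∈ Metric.closedBall (γ s) ‖h s‖, ‖B (f' z) - B (f' (γ s))‖ ≤ ε := by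
    intro z hz
    -- Translating the whole path by `z - γ s` gives a path through `z` at `s` that is still within
    -- `δ` of `γ`; this turns sup-norm continuity into a bound at the point `z`.
    let c : C(K, Z) := γ + ContinuousMap.const K (z - γ s)
    have hc1 : dist c γ < δ := by
      rw [dist_eq_norm]
      refine lt_of_le_of_lt ?_ hh
      refine (ContinuousMap.norm_le _ (norm_nonneg _)).2 fun r => ?_
      have : (c - γ) r = z - γ s := by simp [c]
      rw [this, ← dist_eq_norm]
      exact (Metric.mem_closedBall.1 hz).trans (h.norm_coe_le_norm s)
    have h2 := H hc1
    have h3 := ContinuousMap.dist_apply_le_dist (f := f'.comp c) (g := f'.comp γ) s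
    rw [dist_eq_norm] at h3
    have h4 : (f'.comp c) s = f' z := by simp [c]
    rw [h4] at h3
    rw [← map_sub]
    exact ((hB _).trans h3).trans h2.le
  have := (convex_closedBall (γ s) ‖h s‖).norm_image_sub_le_of_norm_hasFDerivWithin_le'
    (f := f) (f' := fun z => B (f' z)) (φ := B (f' (γ s))) (C := ε) (x := γ s) (y := γ s + h s)
    (fun x _ => (hf x).hasFDerivWithinAt) key (by simp) (by simp)
  have e : (γ s + h s) - γ s = h s := by abel
  rw [e] at this
  refine le_trans (le_of_eq ?_) (this.trans (mul_le_mul_of_nonneg_left (h.norm_coe_le_norm s) hε.le))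
  rfl

/-- Induction on the order of differentiability: the derivative is again a composition operator,
with `fderiv ℝ f` in place of `f`, followed by a bounded linear map. The target changes from `W` to
`Z →L[ℝ] W`, which is why `W` is generalised and shares the universe of `Z`. -/
theorem contDiff_comp_left {Z W : Type u} [NormedAddCommGroup Z] [NormedSpace ℝ Z]
    [NormedAddCommGroup W] [NormedSpace ℝ W] (f : C(Z, W)) (hf : ContDiff ℝ ∞ f) :
    ContDiff ℝ ∞ (fun γ : C(K, Z) => f.comp γ) := by
  rw [contDiff_infty]
  intro n
  induction n generalizing W with
  | zero =>
    rw [Nat.cast_zero, contDiff_zero]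
    exact ContinuousMap.continuous_postcomp f
  | succ n ih =>
    have hf1 : ContDiff ℝ ∞ (fderiv ℝ f) := hf.fderiv_right (by simp)
    have ih1 := ih ⟨fderiv ℝ f, hf1.continuous⟩ hf1
    have key := hasFDerivAt_comp_left (K := K) (ContinuousLinearMap.id ℝ (Z →L[ℝ] W))
      (fun _ => le_rfl) f ⟨fderiv ℝ f, hf1.continuous⟩
      (fun z => (hf.differentiable (by simp) z).hasFDerivAt)
    push_cast
    rw [contDiff_succ_iff_fderiv]
    refine ⟨fun γ => (key γ).differentiableAt, by simp, ?_⟩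
    rw [funext fun γ => (key γ).fderiv]
    exact (pointwiseApply K (ContinuousLinearMap.id ℝ (Z →L[ℝ] W))).contDiff.comp ih1

end Nemytskii

/-! ### Integration of paths on `[-1, 1]` -/

section Volterra

variable {Z : Type*} [NormedAddCommGroup Z] [NormedSpace ℝ Z]

/-- The time interval `[-1, 1]`. -/
abbrev TimeInterval := Icc (-1 : ℝ) 1

theorem neg_one_le_one : (-1 : ℝ) ≤ 1 := by norm_num

/-- Extension of a path on `[-1, 1]` to the real line, constant outside of the interval. -/
def extendPath (γ : C(TimeInterval, Z)) : ℝ → Z := IccExtend neg_one_le_one γ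

theorem continuous_extendPath (γ : C(TimeInterval, Z)) : Continuous (extendPath γ) :=
  γ.continuous.Icc_extend'

theorem extendPath_of_mem (γ : C(TimeInterval, Z)) {s : ℝ} (hs : s ∈ TimeInterval) :
    extendPath γ s = γ ⟨s, hs⟩ := IccExtend_of_mem _ _ hs

theorem norm_extendPath_le (γ : C(TimeInterval, Z)) (s : ℝ) : ‖extendPath γ s‖ ≤ ‖γ‖ :=
  γ.norm_coe_le_norm _

/-- Integration from `0`, as a continuous linear operator on paths. -/
def integrate (Z : Type*) [NormedAddCommGroup Z] [NormedSpace ℝ Z] :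
    C(TimeInterval, Z) →L[ℝ] C(TimeInterval, Z) :=
  LinearMap.mkContinuous
    { toFun := fun γ => ⟨fun s => ∫ r in (0 : ℝ)..s, extendPath γ r,
        (intervalIntegral.continuous_primitive
          (fun a b => (continuous_extendPath γ).intervalIntegrable a b) 0).comp
            continuous_subtype_val⟩
      map_add' := fun γ δ => by
        ext s
        exact intervalIntegral.integral_add ((continuous_extendPath γ).intervalIntegrable _ _)
          ((continuous_extendPath δ).intervalIntegrable _ _)
      map_smul' := fun c γ => by
        ext s
        exact intervalIntegral.integral_smul c _ } 1
    (fun γ => by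
      rw [one_mul]
      refine (ContinuousMap.norm_le _ (norm_nonneg _)).2 fun s => ?_
      have := intervalIntegral.norm_integral_le_of_norm_le_const (a := 0) (b := (s : ℝ))
        (f := extendPath γ) (C := ‖γ‖) (fun r _ => norm_extendPath_le γ r)
      refine this.trans ?_
      have hs : |(s : ℝ) - 0| ≤ 1 := by
        rw [sub_zero, abs_le]; exact s.2
      nlinarith [norm_nonneg γ])

theorem norm_integrate_le (γ : C(TimeInterval, Z)) : ‖integrate Z γ‖ ≤ ‖γ‖ := by
  have := (integrate Z).le_of_opNorm_le (LinearMap.mkContinuous_norm_le _ zero_le_one _) γ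
  rwa [one_mul] at this

end Volterra

end SmoothFlow

/-! ### Smooth flows of Lipschitz vector fields on Banach spaces -/

namespace SmoothFlow

open Topology NNReal MeasureTheory

universe u

/-- Fixed points of a smooth family of contractions depend smoothly on the parameter. -/
theorem contDiffAt_fixedPoint {P C : Type*} [NormedAddCommGroup P] [NormedSpace ℝ P]
    [CompleteSpace P] [NormedAddCommGroup C] [NormedSpace ℝ C] [CompleteSpace C]
    {T : P × C → C} (hT : ContDiff ℝ ∞ T) {Γ : P → C} {p₀ : P} {c : ℝ≥0} (hc : c < 1)
    (hlip : LipschitzWith c fun γ => T (p₀, γ)) (hfix : T (p₀, Γ p₀) = Γ p₀)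
    (huniq : ∀ᶠ p in 𝓝 p₀, ∀ γ, T (p, γ) = γ → γ = Γ p) :
    ContDiffAt ℝ ∞ Γ p₀ := by
  -- Fixed points are zeros of `γ - T (p, γ)`. Its partial derivative in `γ` is `1 - A` with `‖A‖ <
  -- 1`, invertible by the Neumann series, so the implicit function theorem applies; its solution is
  -- a fixed point, hence equals `Γ` near `p₀` by uniqueness.
  set F : P × C → C := fun q => q.2 - T q with hF
  have hFs : ContDiff ℝ ∞ F := contDiff_snd.sub hT
  set A : C →L[ℝ] C := fderiv ℝ (fun γ => T (p₀, γ)) (Γ p₀) with hA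
  have hAn : ‖A‖ < 1 := (norm_fderiv_le_of_lipschitz ℝ hlip).trans_lt (by exact_mod_cast hc)
  have hTd : DifferentiableAt ℝ (fun γ => T (p₀, γ)) (Γ p₀) :=
    ((hT.comp (contDiff_prodMk_right p₀)).differentiable (by simp)) _
  have hder : fderiv ℝ F (p₀, Γ p₀) ∘L .inr ℝ P C = 1 - A := by
    have h1 : HasFDerivAt (fun γ => F (p₀, γ))
        (fderiv ℝ F (p₀, Γ p₀) ∘L .inr ℝ P C) (Γ p₀) :=
      (hFs.differentiable (by simp) (p₀, Γ p₀)).hasFDerivAt.comp (Γ p₀)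
        (hasFDerivAt_prodMk_right p₀ (Γ p₀))
    exact h1.unique ((hasFDerivAt_id (Γ p₀)).sub hTd.hasFDerivAt)
  have hinv : (fderiv ℝ F (p₀, Γ p₀) ∘L .inr ℝ P C).IsInvertible := by
    rw [hder]
    exact ⟨ContinuousLinearEquiv.ofUnit (Units.oneSub A hAn), rfl⟩
  have hFa : ContDiffAt ℝ ∞ F (p₀, Γ p₀) := hFs.contDiffAt
  have h2 := hFa.contDiffAt_implicitFunction (by simp) hinv
  have h3 := hFa.eventually_apply_implicitFunction (by simp) hinv
  refine h2.congr_of_eventuallyEq ?_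
  filter_upwards [h3, huniq] with p hp hpu
  refine (hpu _ ?_).symm
  have h0 : F (p₀, Γ p₀) = 0 := by simp only [hF, hfix, sub_self]
  rw [h0] at hp
  exact (sub_eq_zero.1 hp).symm

variable {Z : Type u} [NormedAddCommGroup Z] [NormedSpace ℝ Z] {f : Z → Z} {K : ℝ≥0}

/-- The Picard operator of the vector field `τ f`, with initial value `z` at time `0`, on paths
defined on `[-1, 1]`. -/
def picardMap (f : C(Z, Z)) (q : (ℝ × Z) × C(TimeInterval, Z)) : C(TimeInterval, Z) :=
  ContinuousMap.const _ q.1.2 + q.1.1 • integrate Z (f.comp q.2)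

theorem contDiff_picardMap (f : C(Z, Z)) (hf : ContDiff ℝ ∞ f) :
    ContDiff ℝ ∞ (picardMap f) := by
  have h1 : ContDiff ℝ ∞ fun z : Z => (ContinuousMap.const TimeInterval z : C(TimeInterval, Z)) :=
    (LinearMap.mkContinuous
      ({ toFun := ContinuousMap.const TimeInterval
         map_add' := fun _ _ => rfl
         map_smul' := fun _ _ => rfl } : Z →ₗ[ℝ] C(TimeInterval, Z)) 1
      fun z => by
        rw [one_mul]
        exact (ContinuousMap.norm_le _ (norm_nonneg _)).2 fun _ => le_rfl).contDiff
  exact (h1.comp (contDiff_snd.comp contDiff_fst)).add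
    ((contDiff_fst.comp contDiff_fst).smul
      ((integrate Z).contDiff.comp ((contDiff_comp_left f hf).comp contDiff_snd)))

theorem lipschitzWith_picardMap (f : C(Z, Z)) (hf : LipschitzWith K f) (p : ℝ × Z) :
    LipschitzWith (‖p.1‖₊ * K) fun γ => picardMap f (p, γ) := by
  refine LipschitzWith.of_dist_le_mul fun γ δ => ?_
  have e : picardMap f (p, γ) - picardMap f (p, δ)
      = p.1 • integrate Z (f.comp γ - f.comp δ) := by
    simp only [picardMap, map_sub, smul_sub]
    abel
  rw [dist_eq_norm, e, norm_smul, NNReal.coe_mul, coe_nnnorm, mul_assoc]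
  refine mul_le_mul_of_nonneg_left ((norm_integrate_le _).trans ?_) (norm_nonneg _)
  refine (ContinuousMap.norm_le _ (by positivity)).2 fun s => ?_
  rw [dist_eq_norm]
  refine (hf.norm_sub_le (γ s) (δ s)).trans ?_
  exact mul_le_mul_of_nonneg_left ((γ - δ).norm_coe_le_norm s) K.coe_nonneg

theorem picardMap_apply (f : C(Z, Z)) (p : ℝ × Z) (γ : C(TimeInterval, Z)) (s : TimeInterval) :
    picardMap f (p, γ) s = p.2 + p.1 • ∫ r in (0 : ℝ)..s, f (extendPath γ r) := rfl

variable [CompleteSpace Z]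

theorem existsUnique_picardMap (f : C(Z, Z)) (hf : LipschitzWith K f) (p : ℝ × Z)
    (hp : ‖p.1‖₊ * K < 1) : ∃! γ, picardMap f (p, γ) = γ := by
  have hc : ContractingWith (‖p.1‖₊ * K) fun γ => picardMap f (p, γ) :=
    ⟨hp, lipschitzWith_picardMap f hf p⟩
  exact ⟨hc.fixedPoint, hc.fixedPoint_isFixedPt, fun γ hγ => hc.fixedPoint_unique hγ⟩

/-- A path solving the integral equation is an integral curve of `τ f`. -/
theorem hasDerivAt_extendPath (f : C(Z, Z)) {p : ℝ × Z} {γ : C(TimeInterval, Z)}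
    (h : picardMap f (p, γ) = γ) {s : ℝ} (hs : s ∈ Ioo (-1 : ℝ) 1) :
    HasDerivAt (extendPath γ) (p.1 • f (extendPath γ s)) s := by
  have hcont : Continuous fun r => f (extendPath γ r) :=
    f.continuous.comp (continuous_extendPath γ)
  have h1 : HasDerivAt (fun s => p.2 + p.1 • ∫ r in (0 : ℝ)..s, f (extendPath γ r))
      (p.1 • f (extendPath γ s)) s :=
    ((hcont.integral_hasStrictDerivAt 0 s).hasDerivAt.const_smul p.1).const_add p.2
  refine h1.congr_of_eventuallyEq ?_
  filter_upwards [Ioo_mem_nhds hs.1 hs.2] with r hr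
  have hr' : r ∈ TimeInterval := ⟨hr.1.le, hr.2.le⟩
  rw [extendPath_of_mem γ hr']
  exact (congr_arg (fun δ : C(TimeInterval, Z) => δ ⟨r, hr'⟩) h).symm

omit [CompleteSpace Z] in
theorem extendPath_zero (f : C(Z, Z)) {p : ℝ × Z} {γ : C(TimeInterval, Z)}
    (h : picardMap f (p, γ) = γ) : extendPath γ 0 = p.2 := by
  have h0 : (0 : ℝ) ∈ TimeInterval := by constructor <;> norm_num
  rw [extendPath_of_mem γ h0, ← h, picardMap_apply]
  simp

/-- A Lipschitz smooth vector field on a Banach space has global integral curves. -/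
theorem exists_global_integralCurve (hf : ContDiff ℝ ∞ f) (hK : LipschitzWith K f) (z : Z) :
    ∃ γ : ℝ → Z, γ 0 = z ∧ ∀ t, HasDerivAt γ (f (γ t)) t := by
  set fc : C(Z, Z) := ⟨f, hf.continuous⟩
  have hv : ContMDiff 𝓘(ℝ, Z) 𝓘(ℝ, Z).tangent 1
      (fun x => (⟨x, f x⟩ : TangentBundle 𝓘(ℝ, Z) Z)) :=
    contMDiff_vectorSpace_iff_contDiff.2 (hf.of_le (by simp))
  -- With time scale `1 / (K + 1)` the Picard operator has contraction constant `K / (K + 1) < 1`.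
  -- The existence time does not depend on the initial point, so local curves extend to all times.
  have hε : (0 : ℝ) < 1 / (K + 1) := by positivity
  obtain ⟨γ, h0, hγ⟩ := exists_isMIntegralCurve_of_isMIntegralCurveOn
    (I := 𝓘(ℝ, Z)) (v := f) hv hε (fun x => by
      have hlt : ‖(1 / (K + 1) : ℝ)‖₊ * K < 1 := by
        rw [← NNReal.coe_lt_coe, NNReal.coe_mul, coe_nnnorm, Real.norm_of_nonneg hε.le]
        rw [div_mul_eq_mul_div, one_mul, NNReal.coe_one, div_lt_one (by positivity)]
        linarith
      obtain ⟨δ, hδ, -⟩ := existsUnique_picardMap fc hK (1 / (K + 1), x) hlt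
      refine ⟨fun t => extendPath δ (t * (K + 1)), ?_, ?_⟩
      · simp only [zero_mul]
        exact extendPath_zero fc hδ
      · intro t ht
        have hK1 : (0 : ℝ) < K + 1 := by positivity
        have ht' : t * (K + 1) ∈ Ioo (-1 : ℝ) 1 := by
          constructor
          · have := mul_lt_mul_of_pos_right ht.1 hK1
            rwa [neg_mul, one_div, inv_mul_cancel₀ hK1.ne'] at this
          · have := mul_lt_mul_of_pos_right ht.2 hK1
            rwa [one_div, inv_mul_cancel₀ hK1.ne'] at this
        have h1 := (hasDerivAt_extendPath fc hδ ht').scomp t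
          ((hasDerivAt_id t).mul_const ((K : ℝ) + 1))
        rw [one_mul, smul_smul, mul_one_div_cancel hK1.ne', one_smul] at h1
        exact (hasMFDerivAt_iff_hasFDerivAt.2 h1.hasFDerivAt).hasMFDerivWithinAt) z
  refine ⟨γ, h0, fun t => ?_⟩
  have h : HasFDerivAt γ ((1 : ℝ →L[ℝ] ℝ).smulRight (f (γ t)) : ℝ →L[ℝ] Z) t :=
    hasMFDerivAt_iff_hasFDerivAt.1 (hγ t)
  have h1 := h.hasDerivAt
  rwa [ContinuousLinearMap.smulRight_apply, one_apply_eq_self, one_smul] at h1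

/-- The flow of a Lipschitz smooth vector field on a Banach space. -/
def flow (hf : ContDiff ℝ ∞ f) (hK : LipschitzWith K f) (t : ℝ) (z : Z) : Z :=
  (exists_global_integralCurve hf hK z).choose t

theorem integralCurve_unique {Z : Type*} [NormedAddCommGroup Z] [NormedSpace ℝ Z] {f : Z → Z}
    {K : ℝ≥0} (hK : LipschitzWith K f) {γ δ : ℝ → Z} (hγ : ∀ t, HasDerivAt γ (f (γ t)) t)
    (hδ : ∀ t, HasDerivAt δ (f (δ t)) t) {t₀ : ℝ} (h : γ t₀ = δ t₀) : γ = δ :=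
  ODE_solution_unique_univ (v := fun _ => f) (s := fun _ => univ)
    (fun _ => hK.lipschitzOnWith) (fun t => ⟨hγ t, trivial⟩) (fun t => ⟨hδ t, trivial⟩) h

variable (hf : ContDiff ℝ ∞ f) (hK : LipschitzWith K f)

theorem flow_zero (z : Z) : flow hf hK 0 z = z :=
  (exists_global_integralCurve hf hK z).choose_spec.1

theorem hasDerivAt_flow (z : Z) (t : ℝ) :
    HasDerivAt (fun t => flow hf hK t z) (f (flow hf hK t z)) t :=
  (exists_global_integralCurve hf hK z).choose_spec.2 t

theorem flow_add (s t : ℝ) (z : Z) :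
    flow hf hK (s + t) z = flow hf hK s (flow hf hK t z) := by
  refine congr_fun (integralCurve_unique hK (γ := fun s => flow hf hK (s + t) z)
    (δ := fun s => flow hf hK s (flow hf hK t z)) (t₀ := 0)
    (fun s => (hasDerivAt_flow hf hK z (s + t)).comp_add_const s t)
    (fun s => hasDerivAt_flow hf hK _ s) ?_) s
  simp only [zero_add, flow_zero]

/-- The rescaled path `s ↦ flow (t s) z` on `[-1, 1]` is the fixed point of the Picard operator with
parameter `(t, z)`, so it depends smoothly on `(t, z)` as an element of the path space. The flow is
its value at `s = 1`. -/
theorem contDiffOn_flow_small :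
    ContDiffOn ℝ ∞ (fun p : ℝ × Z => flow hf hK p.1 p.2) {p | ‖p.1‖₊ * K < 1} := by
  set fc : C(Z, Z) := ⟨f, hf.continuous⟩
  have hflowc : ∀ z, Continuous fun t => flow hf hK t z := fun z =>
    continuous_iff_continuousAt.2 fun t => (hasDerivAt_flow hf hK z t).continuousAt
  set Γ : ℝ × Z → C(TimeInterval, Z) := fun p =>
    ⟨fun s => flow hf hK (p.1 * s) p.2,
      (hflowc p.2).comp (continuous_const.mul continuous_subtype_val)⟩ with hΓ
  have hfix : ∀ p, picardMap fc (p, Γ p) = Γ p := by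
    intro p
    ext s
    rw [picardMap_apply]
    have hd : ∀ r : ℝ, HasDerivAt (fun r => flow hf hK (p.1 * r) p.2)
        (p.1 • f (flow hf hK (p.1 * r) p.2)) r := fun r => by
      have := (hasDerivAt_flow hf hK p.2 (p.1 * r)).scomp r ((hasDerivAt_id r).const_mul p.1)
      rw [mul_one] at this
      exact this
    have hcont : Continuous fun r : ℝ => p.1 • f (flow hf hK (p.1 * r) p.2) :=
      (hf.continuous.comp ((hflowc p.2).comp (continuous_const.mul continuous_id))).const_smul p.1
    have hint := intervalIntegral.integral_eq_sub_of_hasDerivAt (a := 0) (b := (s : ℝ))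
      (fun r _ => hd r) (hcont.intervalIntegrable _ _)
    have heq : ∫ r in (0 : ℝ)..s, fc (extendPath (Γ p) r)
        = ∫ r in (0 : ℝ)..s, f (flow hf hK (p.1 * r) p.2) := by
      refine intervalIntegral.integral_congr fun r hr => ?_
      have hr' : r ∈ TimeInterval := by
        have h0 : (0 : ℝ) ∈ TimeInterval := by constructor <;> norm_num
        exact (uIcc_subset_Icc h0 s.2) hr
      change f (extendPath (Γ p) r) = _
      rw [extendPath_of_mem (Γ p) hr']
      rfl
    rw [heq, ← intervalIntegral.integral_smul, hint, mul_zero, flow_zero]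
    simp [hΓ]
  have hopen : IsOpen {p : ℝ × Z | ‖p.1‖₊ * K < 1} :=
    isOpen_lt (by fun_prop) continuous_const
  have h1 : (1 : ℝ) ∈ TimeInterval := by constructor <;> norm_num
  intro p hp
  have hΓs : ContDiffAt ℝ ∞ Γ p := by
    refine contDiffAt_fixedPoint (contDiff_picardMap fc hf) hp
      (lipschitzWith_picardMap fc hK p) (hfix p) ?_
    filter_upwards [hopen.mem_nhds hp] with q hq γ hγ
    exact (existsUnique_picardMap fc hK q hq).unique hγ (hfix q)
  have hev := (ContinuousMap.evalCLM ℝ (⟨1, h1⟩ : TimeInterval) (M := Z)).contDiff.contDiffAt.comp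
    p hΓs
  refine (hev.congr_of_eventuallyEq ?_).contDiffWithinAt
  filter_upwards with q
  simp [hΓ]

/-- The group law writes the flow for time `n t` as an `n`-fold iterate of the flow for the short
time `t`. -/
theorem contDiffOn_flow_nat_mul (n : ℕ) :
    ContDiffOn ℝ ∞ (fun p : ℝ × Z => flow hf hK (n * p.1) p.2) {p | ‖p.1‖₊ * K < 1} := by
  induction n with
  | zero =>
    simp only [Nat.cast_zero, zero_mul, flow_zero]
    exact contDiffOn_snd
  | succ n ih =>
    have h := (contDiffOn_flow_small hf hK).comp (contDiffOn_fst.prodMk ih)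
      (fun p hp => by simpa using hp)
    refine h.congr fun p _ => ?_
    simp only [Function.comp, ← flow_add]
    push_cast
    ring_nf

/-- The flow of a Lipschitz smooth vector field is jointly smooth in time and the initial value. -/
theorem contDiff_flow : ContDiff ℝ ∞ fun p : ℝ × Z => flow hf hK p.1 p.2 := by
  rw [contDiff_iff_contDiffAt]
  intro p
  obtain ⟨n, hn⟩ := exists_nat_gt (|p.1| * K)
  have hn0 : (0 : ℝ) < n := lt_of_le_of_lt (by positivity) hn
  have hopen : IsOpen {p : ℝ × Z | ‖p.1‖₊ * K < 1} :=
    isOpen_lt (by fun_prop) continuous_const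
  have hmem : (p.1 / n, p.2) ∈ {p : ℝ × Z | ‖p.1‖₊ * K < 1} := by
    rw [mem_ofPred_eq, ← NNReal.coe_lt_coe, NNReal.coe_mul, coe_nnnorm, norm_div,
      Real.norm_natCast, div_mul_eq_mul_div, NNReal.coe_one, div_lt_one hn0]
    exact hn
  have h1 := (contDiffOn_flow_nat_mul hf hK n).contDiffAt (hopen.mem_nhds hmem)
  have h2 : ContDiffAt ℝ ∞ (fun q : ℝ × Z => (q.1 / (n : ℝ), q.2)) p :=
    (contDiffAt_fst.div_const _).prodMk contDiffAt_snd
  refine (ContDiffAt.comp p h1 h2).congr_of_eventuallyEq ?_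
  filter_upwards with q
  simp only [Function.comp]
  rw [mul_div_cancel₀ _ hn0.ne']

end SmoothFlow

/-! ### Embedding a compact manifold in a vector space and extending functions -/

namespace SmoothFlow

open Topology Filter

section Embedding

variable {E : Type*} [NormedAddCommGroup E] [NormedSpace ℝ E] [FiniteDimensional ℝ E]
  {M : Type*} [TopologicalSpace M] [ChartedSpace E M] [IsManifold 𝓘(ℝ, E) ∞ M]
  [T2Space M] {ι : Type*} [Fintype ι]
  {W : Type*} [NormedAddCommGroup W] [NormedSpace ℝ W]

/-- A smooth cutoff function on the real line, vanishing on `(-∞, 1/4]` and equal to `1` at `1`. -/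
def cutoff (c : ℝ) : ℝ := Real.smoothTransition (4 * c - 1)

theorem contDiff_cutoff : ContDiff ℝ ∞ cutoff :=
  Real.smoothTransition.contDiff.comp ((contDiff_const.mul contDiff_id).sub contDiff_const)

theorem cutoff_eq_zero {c : ℝ} (h : c ≤ 1 / 4) : cutoff c = 0 :=
  Real.smoothTransition.zero_of_nonpos (by linarith)

theorem cutoff_one : cutoff 1 = 1 := Real.smoothTransition.one_of_one_le (by norm_num)

theorem cutoff_nonneg (c : ℝ) : 0 ≤ cutoff c := Real.smoothTransition.nonneg _

/-- A smooth function cut off by a bump function, in coordinates, as a function on the model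
space. -/
def localRep {c : M} (φ : SmoothBumpFunction 𝓘(ℝ, E) c) (g : ℝ × M → W) (q : ℝ × E) : W :=
  φ.toContDiffBump q.2 • g (q.1, (extChartAt 𝓘(ℝ, E) c).symm q.2)

omit [T2Space M] in
theorem contDiff_localRep {c : M} (φ : SmoothBumpFunction 𝓘(ℝ, E) c) {g : ℝ × M → W}
    (hg : ContMDiff (𝓘(ℝ, ℝ).prod 𝓘(ℝ, E)) 𝓘(ℝ, W) ∞ g) : ContDiff ℝ ∞ (localRep φ g) := by
  rw [contDiff_iff_contDiffAt]
  rintro ⟨t, u⟩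
  by_cases hu : u ∈ Metric.closedBall (extChartAt 𝓘(ℝ, E) c c) φ.rOut
  · have ht : u ∈ (extChartAt 𝓘(ℝ, E) c).target := φ.closedBall_subset ⟨hu, by simp⟩
    have h1 : ContMDiffAt 𝓘(ℝ, E) 𝓘(ℝ, E) ∞ (extChartAt 𝓘(ℝ, E) c).symm u :=
      (contMDiffOn_extChartAt_symm c).contMDiffAt ((isOpen_extChartAt_target c).mem_nhds ht)
    have h2 : ContMDiffAt (𝓘(ℝ, ℝ).prod 𝓘(ℝ, E)) (𝓘(ℝ, ℝ).prod 𝓘(ℝ, E)) ∞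
        (fun q : ℝ × E => (q.1, (extChartAt 𝓘(ℝ, E) c).symm q.2)) (t, u) :=
      contMDiffAt_fst.prodMk (ContMDiffAt.comp (t, u) h1 contMDiffAt_snd)
    have h3 : ContMDiffAt (𝓘(ℝ, ℝ).prod 𝓘(ℝ, E)) 𝓘(ℝ, W) ∞
        (fun q : ℝ × E => g (q.1, (extChartAt 𝓘(ℝ, E) c).symm q.2)) (t, u) :=
      ContMDiffAt.comp (t, u) hg.contMDiffAt h2
    rw [← modelWithCornersSelf_prod, chartedSpaceSelf_prod] at h3
    exact (φ.toContDiffBump.contDiffAt.comp (t, u) contDiffAt_snd).smul h3.contDiffAt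
  · have : ∀ᶠ q : ℝ × E in 𝓝 (t, u), localRep φ g q = 0 := by
      have hopen : IsOpen {q : ℝ × E | q.2 ∉ Metric.closedBall (extChartAt 𝓘(ℝ, E) c c) φ.rOut} :=
        Metric.isClosed_closedBall.isOpen_compl.preimage continuous_snd
      filter_upwards [hopen.mem_nhds hu] with q hq
      rw [localRep, φ.toContDiffBump.zero_of_le_dist, zero_smul]
      exact (not_le.1 hq).le
    exact contDiffAt_const.congr_of_eventuallyEq this

omit [T2Space M] [IsManifold 𝓘(ℝ, E) ∞ M] in
theorem localRep_extChartAt {c : M} (φ : SmoothBumpFunction 𝓘(ℝ, E) c) (g : ℝ × M → W) (t : ℝ)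
    {x : M} (hx : φ x ≠ 0) : localRep φ g (t, extChartAt 𝓘(ℝ, E) c x) = φ x • g (t, x) := by
  have hs : x ∈ (chartAt E c).source := φ.support_subset_source hx
  rw [localRep, (extChartAt 𝓘(ℝ, E) c).left_inv (by rwa [extChartAt_source]),
    φ.eqOn_source hs]
  rfl

/-- Homogeneous version of `localRep`, with a scale factor as an additional variable. -/
def scaledRep {c : M} (φ : SmoothBumpFunction 𝓘(ℝ, E) c) (g : ℝ × M → W) (t : ℝ) (v : E × ℝ) : W :=
  cutoff v.2 • localRep φ g (t, v.2⁻¹ • v.1)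

omit [T2Space M] in
theorem contDiff_scaledRep {c : M} (φ : SmoothBumpFunction 𝓘(ℝ, E) c) {g : ℝ × M → W}
    (hg : ContMDiff (𝓘(ℝ, ℝ).prod 𝓘(ℝ, E)) 𝓘(ℝ, W) ∞ g) :
    ContDiff ℝ ∞ fun q : ℝ × (E × ℝ) => scaledRep φ g q.1 q.2 := by
  rw [contDiff_iff_contDiffAt]
  rintro ⟨t, u, c'⟩
  by_cases hc : c' < 1 / 4
  · have : ∀ᶠ q : ℝ × (E × ℝ) in 𝓝 (t, u, c'), scaledRep φ g q.1 q.2 = 0 := by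
      have hopen : IsOpen {q : ℝ × (E × ℝ) | q.2.2 < 1 / 4} :=
        isOpen_lt (by fun_prop) continuous_const
      filter_upwards [hopen.mem_nhds hc] with q hq
      rw [scaledRep, cutoff_eq_zero (le_of_lt hq), zero_smul]
    exact contDiffAt_const.congr_of_eventuallyEq this
  · have hc0 : c' ≠ 0 := by rintro rfl; norm_num at hc
    have h2 : ContDiffAt ℝ ∞ (fun q : ℝ × (E × ℝ) => q.2.2) (t, u, c') :=
      contDiffAt_snd.comp (t, u, c') contDiffAt_snd
    have h1 : ContDiffAt ℝ ∞ (fun q : ℝ × (E × ℝ) => q.2.1) (t, u, c') :=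
      contDiffAt_fst.comp (t, u, c') contDiffAt_snd
    exact (contDiff_cutoff.contDiffAt.comp (t, u, c') h2).smul
      ((contDiff_localRep φ hg).contDiffAt.comp (t, u, c')
        (contDiffAt_fst.prodMk ((h2.inv hc0).smul h1)))

/-- The embedding of a compact manifold into a vector space given by a covering by bump
functions. -/
def embedding (f : SmoothBumpCovering ι 𝓘(ℝ, E) M) (x : M) (i : ι) : E × ℝ :=
  (f i x • extChartAt 𝓘(ℝ, E) (f.c i) x, f i x)

theorem contMDiff_embedding (f : SmoothBumpCovering ι 𝓘(ℝ, E) M) :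
    ContMDiff 𝓘(ℝ, E) 𝓘(ℝ, ι → E × ℝ) ∞ (embedding f) :=
  contMDiff_pi_space.2 fun i =>
    ((f i).contMDiff_smul contMDiffOn_extChartAt).prodMk_space (f i).contMDiff

omit [T2Space M] [IsManifold 𝓘(ℝ, E) ∞ M] [Fintype ι] in
theorem injective_embedding (f : SmoothBumpCovering ι 𝓘(ℝ, E) M) :
    Function.Injective (embedding f) := by
  intro x y h
  obtain ⟨h₁, h₂⟩ := Prod.mk_inj.1 (congr_fun h (f.ind x (mem_univ x)))
  rw [f.apply_ind x (mem_univ x)] at h₂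
  rw [← h₂, f.apply_ind x (mem_univ x), one_smul, one_smul] at h₁
  exact (extChartAt 𝓘(ℝ, E) (f.c _)).injOn (f.mem_extChartAt_ind_source x (mem_univ x))
    (f.mem_extChartAt_source_of_eq_one h₂.symm) h₁

/-- Smooth families of functions on a compact manifold extend along the embedding of the manifold
into a vector space. -/
theorem exists_extension (f : SmoothBumpCovering ι 𝓘(ℝ, E) M) {g : ℝ × M → W}
    (hg : ContMDiff (𝓘(ℝ, ℝ).prod 𝓘(ℝ, E)) 𝓘(ℝ, W) ∞ g) :
    ∃ G : ℝ × (ι → E × ℝ) → W, ContDiff ℝ ∞ G ∧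
      ∀ t x, G (t, embedding f x) = g (t, x) := by
  -- On the embedded manifold, the `i`-th local extension of a function returns it with weight
  -- `cutoff (f i x) * f i x`. The total weight `D` is positive since some `f i x = 1`, so dividing
  -- by `D` beforehand makes the extensions add up to `g`.
  set D : M → ℝ := fun x => ∑ i, cutoff (f i x) * f i x with hD
  have hDs : ContMDiff 𝓘(ℝ, E) 𝓘(ℝ, ℝ) ∞ D :=
    contMDiff_finsetSum fun i _ =>
      (contDiff_cutoff.contMDiff.comp (f i).contMDiff).mul (f i).contMDiff
  have hpos : ∀ x, 0 < D x := fun x => by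
    have h1 : f (f.ind x (mem_univ x)) x = 1 := f.apply_ind x (mem_univ x)
    refine Finset.sum_pos' (fun i _ => mul_nonneg (cutoff_nonneg _) (f i).nonneg)
      ⟨f.ind x (mem_univ x), Finset.mem_univ _, ?_⟩
    rw [h1, cutoff_one]
    norm_num
  set g' : ℝ × M → W := fun p => (D p.2)⁻¹ • g p with hg'
  have hg's : ContMDiff (𝓘(ℝ, ℝ).prod 𝓘(ℝ, E)) 𝓘(ℝ, W) ∞ g' :=
    ContMDiff.smul ((hDs.comp contMDiff_snd).inv₀ fun p => (hpos p.2).ne') hg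
  refine ⟨fun q => ∑ i, scaledRep (f i) g' q.1 (q.2 i), ?_, ?_⟩
  · refine ContDiff.sum fun i _ => ?_
    have : ContDiff ℝ ∞ fun q : ℝ × (ι → E × ℝ) => (q.1, q.2 i) :=
      contDiff_fst.prodMk ((contDiff_apply ℝ (E × ℝ) i).comp contDiff_snd)
    exact (contDiff_scaledRep (f i) hg's).comp this
  · intro t x
    have : ∀ i, scaledRep (f i) g' t (embedding f x i)
        = (cutoff (f i x) * f i x) • g' (t, x) := by
      intro i
      change cutoff (f i x) • localRep (f i) g'
        (t, (f i x)⁻¹ • (f i x • extChartAt 𝓘(ℝ, E) (f.c i) x)) = _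
      by_cases h0 : f i x = 0
      · rw [h0, cutoff_eq_zero (by norm_num), zero_smul, zero_mul, zero_smul]
      · rw [inv_smul_smul₀ h0, localRep_extChartAt (f i) g' t h0, smul_smul]
    simp only [this, ← Finset.sum_smul]
    change D x • (D x)⁻¹ • g (t, x) = g (t, x)
    rw [smul_inv_smul₀ (hpos x).ne']

theorem isClosedEmbedding_embedding [CompactSpace M]
    (f : SmoothBumpCovering ι 𝓘(ℝ, E) M) : IsClosedEmbedding (embedding f) :=
  (contMDiff_embedding f).continuous.isClosedEmbedding (injective_embedding f)

/-- A map into a compact manifold is smooth if its composition with the embedding of the manifold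
into a vector space is. -/
theorem contMDiff_of_embedding_comp [CompactSpace M] (f : SmoothBumpCovering ι 𝓘(ℝ, E) M)
    {E' : Type*} [NormedAddCommGroup E'] [NormedSpace ℝ E'] {H' : Type*} [TopologicalSpace H']
    {I' : ModelWithCorners ℝ E' H'} {N : Type*} [TopologicalSpace N] [ChartedSpace H' N]
    {β : N → M} (h : ContMDiff I' 𝓘(ℝ, ι → E × ℝ) ∞ fun n => embedding f (β n)) :
    ContMDiff I' 𝓘(ℝ, E) ∞ β := by
  have hβ : Continuous β :=
    (isClosedEmbedding_embedding f).isInducing.continuous_iff.2 h.continuous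
  intro n
  set i := f.ind (β n) (mem_univ _) with hi
  have hsrc : β n ∈ (chartAt E (f.c i)).source := f.mem_chartAt_ind_source (β n) (mem_univ _)
  rw [contMDiffAt_iff_target_of_mem_source hsrc]
  refine ⟨hβ.continuousAt, ?_⟩
  -- Near `n` the bump function with index `i` equals `1`, so the first entry of this component of
  -- the embedding is the chart itself.
  have h1 : ContMDiffAt I' 𝓘(ℝ, E) ∞ (fun n => (embedding f (β n) i).1) n := by
    have hl : ContDiff ℝ ∞ fun v : ι → E × ℝ => (v i).1 :=
      contDiff_fst.comp (contDiff_apply ℝ (E × ℝ) i)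
    exact hl.contMDiff.contMDiffAt.comp n (h n)
  refine h1.congr_of_eventuallyEq ?_
  filter_upwards [hβ.continuousAt.eventually (f.eventuallyEq_one (β n) (mem_univ _))] with m hm
  change _ = f i (β m) • extChartAt 𝓘(ℝ, E) (f.c i) (β m)
  have hm' : f i (β m) = 1 := hm
  rw [hm', one_smul]
  rfl

end Embedding

end SmoothFlow

/-! ### Flows of time-dependent vector fields on a compact manifold -/

namespace SmoothFlow

open Topology Filter NNReal

/-- Smooth functions on finite-dimensional spaces can be cut off outside of bounded sets. -/
theorem exists_cutoff {Q W : Type*} [NormedAddCommGroup Q] [NormedSpace ℝ Q]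
    [FiniteDimensional ℝ Q] [NormedAddCommGroup W] [NormedSpace ℝ W] {g : Q → W}
    (hg : ContDiff ℝ ∞ g) {s : Set Q} (hs : Bornology.IsBounded s) :
    ∃ g' : Q → W, ContDiff ℝ ∞ g' ∧ HasCompactSupport g' ∧ (∀ q ∈ s, g' q = g q) ∧
      ∀ q, g q = 0 → g' q = 0 := by
  obtain ⟨R, hR0, hR⟩ := hs.subset_closedBall_lt 0 0
  let φ : ContDiffBump (0 : Q) := ⟨R, R + 1, hR0, by linarith⟩
  refine ⟨fun q => φ q • g q, φ.contDiff.smul hg, φ.hasCompactSupport.smul_right, ?_, ?_⟩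
  · intro q hq
    change φ q • g q = g q
    rw [φ.one_of_mem_closedBall (hR hq), one_smul]
  · intro q hq
    change φ q • g q = 0
    rw [hq, smul_zero]

theorem hasDerivAt_comp_curve {E' : Type*} [NormedAddCommGroup E'] [NormedSpace ℝ E']
    {H' : Type*} [TopologicalSpace H'] {I' : ModelWithCorners ℝ E' H'} {N : Type*}
    [TopologicalSpace N] [ChartedSpace H' N] {W : Type*} [NormedAddCommGroup W] [NormedSpace ℝ W]
    {γ : ℝ → N} {t : ℝ} {v : TangentSpace I' (γ t)}
    (hγ : HasMFDerivAt 𝓘(ℝ, ℝ) I' γ t ((1 : ℝ →L[ℝ] ℝ).smulRight v)) {g : N → W}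
    (hg : MDifferentiableAt I' 𝓘(ℝ, W) g (γ t)) :
    HasDerivAt (fun t => g (γ t)) (mfderiv I' 𝓘(ℝ, W) g (γ t) v) t := by
  have h1 := hg.hasMFDerivAt.comp t hγ
  let L : ℝ →L[ℝ] W := (mfderiv I' 𝓘(ℝ, W) g (γ t)).comp ((1 : ℝ →L[ℝ] ℝ).smulRight v)
  have h2 : HasFDerivAt (fun t => g (γ t)) L t := hasMFDerivAt_iff_hasFDerivAt.1 h1
  have h3 := h2.hasDerivAt
  have e : L 1 = mfderiv I' 𝓘(ℝ, W) g (γ t) v := by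
    change mfderiv I' 𝓘(ℝ, W) g (γ t) ((1 : ℝ) • v) = _
    rw [one_smul]
  rwa [e] at h3

section ManifoldFlow

universe u

variable {E : Type u} [NormedAddCommGroup E] [NormedSpace ℝ E] [FiniteDimensional ℝ E]
  {M : Type*} [TopologicalSpace M] [ChartedSpace E M] [IsManifold 𝓘(ℝ, E) ∞ M]

/-- A time-dependent vector field on `M`, as a vector field on `ℝ × M`. -/
def suspension (X : ℝ → (x : M) → TangentSpace 𝓘(ℝ, E) x) (p : ℝ × M) :
    TangentSpace (𝓘(ℝ, ℝ).prod 𝓘(ℝ, E)) p :=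
  ((1 : ℝ), X p.1 p.2)

/-- Smoothness of a time-dependent vector field. -/
def IsSmoothField (X : ℝ → (x : M) → TangentSpace 𝓘(ℝ, E) x) : Prop :=
  ContMDiff (𝓘(ℝ, ℝ).prod 𝓘(ℝ, E)) 𝓘(ℝ, E).tangent ∞
    (fun p : ℝ × M => (⟨p.2, X p.1 p.2⟩ : TangentBundle 𝓘(ℝ, E) M))

omit [FiniteDimensional ℝ E] in
theorem IsSmoothField.suspension {X : ℝ → (x : M) → TangentSpace 𝓘(ℝ, E) x}
    (hX : IsSmoothField X) :
    ContMDiff (𝓘(ℝ, ℝ).prod 𝓘(ℝ, E)) (𝓘(ℝ, ℝ).prod 𝓘(ℝ, E)).tangent ∞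
      (fun p : ℝ × M => (⟨p, suspension X p⟩ :
        TangentBundle (𝓘(ℝ, ℝ).prod 𝓘(ℝ, E)) (ℝ × M))) := by
  have h1 : ContMDiff (𝓘(ℝ, ℝ).prod 𝓘(ℝ, E)) 𝓘(ℝ, ℝ).tangent ∞
      (fun p : ℝ × M => (⟨p.1, (1 : ℝ)⟩ : TangentBundle 𝓘(ℝ, ℝ) ℝ)) := by
    have : ContMDiff 𝓘(ℝ, ℝ) 𝓘(ℝ, ℝ).tangent ∞
        (fun t : ℝ => (⟨t, (1 : ℝ)⟩ : TangentBundle 𝓘(ℝ, ℝ) ℝ)) :=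
      contMDiff_vectorSpace_iff_contDiff.2 contDiff_const
    exact this.comp contMDiff_fst
  exact (contMDiff_equivTangentBundleProd_symm (I := 𝓘(ℝ, ℝ)) (M := ℝ) (I' := 𝓘(ℝ, E))
    (M' := M) (n := ∞)).comp (h1.prodMk hX)

omit [FiniteDimensional ℝ E] in
/-- The derivative of a smooth function along a smooth time-dependent vector field is smooth. -/
theorem IsSmoothField.contMDiff_mfderiv {X : ℝ → (x : M) → TangentSpace 𝓘(ℝ, E) x}
    (hX : IsSmoothField X) {W : Type*} [NormedAddCommGroup W] [NormedSpace ℝ W] {g : M → W}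
    (hg : ContMDiff 𝓘(ℝ, E) 𝓘(ℝ, W) ∞ g) :
    ContMDiff (𝓘(ℝ, ℝ).prod 𝓘(ℝ, E)) 𝓘(ℝ, W) ∞
      (fun p : ℝ × M => (mfderiv 𝓘(ℝ, E) 𝓘(ℝ, W) g p.2 (X p.1 p.2) : W)) := by
  have h1 : ContMDiff 𝓘(ℝ, E).tangent 𝓘(ℝ, W).tangent ∞ (tangentMap 𝓘(ℝ, E) 𝓘(ℝ, W) g) :=
    hg.contMDiff_tangentMap (by simp)
  exact (contMDiff_snd_tangentBundle_modelSpace W 𝓘(ℝ, W)).comp (h1.comp hX)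

/-- Flow of a smooth time-dependent vector field on a compact manifold; `ψ t s x` is the position
at time `s + t` of the integral curve starting from `x` at time `s`. -/
theorem exists_timeDependentFlow [T2Space M] [CompactSpace M] {X : ℝ → (x : M) → TangentSpace 𝓘(ℝ, E) x}
    (hX : IsSmoothField X) (hX0 : ∀ t ∉ Icc (0 : ℝ) 1, ∀ x, X t x = 0) :
    ∃ ψ : ℝ → ℝ → M → M,
      ContMDiff (𝓘(ℝ, ℝ).prod (𝓘(ℝ, ℝ).prod 𝓘(ℝ, E))) 𝓘(ℝ, E) ∞
        (fun p : ℝ × (ℝ × M) => ψ p.1 p.2.1 p.2.2) ∧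
      (∀ s x, ψ 0 s x = x) ∧
      (∀ t t' s x, ψ t (s + t') (ψ t' s x) = ψ (t + t') s x) ∧
      ∀ t s x, HasMFDerivAt 𝓘(ℝ, ℝ) (𝓘(ℝ, ℝ).prod 𝓘(ℝ, E)) (fun t => (s + t, ψ t s x)) t
        ((1 : ℝ →L[ℝ] ℝ).smulRight (suspension X (s + t, ψ t s x))) := by
  obtain ⟨ι, f, -⟩ := SmoothBumpCovering.exists_isSubordinate 𝓘(ℝ, E) (s := (univ : Set M))
    isClosed_univ (U := fun _ => univ) (fun _ _ => univ_mem)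
  have : Fintype ι := f.fintype
  set e := embedding f with he
  have hes : ContMDiff 𝓘(ℝ, E) 𝓘(ℝ, ι → E × ℝ) ∞ e := contMDiff_embedding f
  have hei : Function.Injective e := injective_embedding f
  -- The pushed-forward field `de(X)` is extended to the ambient space and cut off, which makes it
  -- Lipschitz. The cutoff changes nothing over `[0,1]`, and it preserves zeros, so the extension
  -- still restricts to `de(X)` at all times.
  obtain ⟨Y₀, hY₀s, hY₀⟩ := exists_extension f (hX.contMDiff_mfderiv hes)
  obtain ⟨Y, hYs, hYc, hYeq, hY0⟩ := exists_cutoff hY₀s (s := Icc (0 : ℝ) 1 ×ˢ range e)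
    (isCompact_Icc.prod (isCompact_range hes.continuous)).isBounded
  have hY : ∀ t x, Y (t, e x) = mfderiv 𝓘(ℝ, E) 𝓘(ℝ, ι → E × ℝ) e x (X t x) := by
    intro t x
    by_cases ht : t ∈ Icc (0 : ℝ) 1
    · exact (hYeq _ ⟨ht, mem_range_self x⟩).trans (hY₀ t x)
    · have h0 : (mfderiv 𝓘(ℝ, E) 𝓘(ℝ, ι → E × ℝ) e x (X t x) : ι → E × ℝ) = 0 := by
        rw [hX0 t ht x]
        exact map_zero (mfderiv 𝓘(ℝ, E) 𝓘(ℝ, ι → E × ℝ) e x)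
      exact (hY0 _ ((hY₀ t x).trans h0)).trans h0.symm
  obtain ⟨C, hC⟩ := hYs.lipschitzWith_of_hasCompactSupport hYc (by simp)
  set F : ℝ × (ι → E × ℝ) → ℝ × (ι → E × ℝ) := fun q => (1, Y q) with hF
  have hFs : ContDiff ℝ ∞ F := contDiff_const.prodMk hYs
  have hFK : LipschitzWith (max 0 C) F := (LipschitzWith.const (1 : ℝ)).prodMk hC
  set Φ := flow hFs hFK with hΦ
  have hΦd : ∀ q t, HasDerivAt (fun t => Φ t q) (F (Φ t q)) t := hasDerivAt_flow hFs hFK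
  have hfst : ∀ q t, (Φ t q).1 = q.1 + t := by
    intro q t
    have hd : ∀ t, HasDerivAt (fun t => (Φ t q).1 - t) 0 t := fun t => by
      have h1 : HasDerivAt (fun t => (Φ t q).1) 1 t := (hΦd q t).fst
      exact (h1.sub (hasDerivAt_id t)).congr_deriv (sub_self 1)
    have h2 := is_const_of_deriv_eq_zero (fun t => (hd t).differentiableAt)
      (fun t => (hd t).deriv) t 0
    simp only [sub_zero] at h2
    rw [hΦ, flow_zero] at h2
    linarith
  -- If an ambient trajectory meets the image of `M`, then near that time it is the image of a local
  -- integral curve in `M`, by uniqueness of solutions in the ambient space.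
  have hlocal : ∀ q t x, Φ t q = (q.1 + t, e x) → ∃ σ : ℝ → M, σ t = x ∧ ∀ᶠ r in 𝓝 t,
      Φ r q = (q.1 + r, e (σ r)) ∧
      HasMFDerivAt 𝓘(ℝ, ℝ) (𝓘(ℝ, ℝ).prod 𝓘(ℝ, E)) (fun r => (q.1 + r, σ r)) r
        ((1 : ℝ →L[ℝ] ℝ).smulRight (suspension X (q.1 + r, σ r))) := by
    intro q t x hx
    obtain ⟨γ, hγ0, hγ⟩ := exists_isMIntegralCurveAt_of_contMDiffAt_boundaryless
      (I := 𝓘(ℝ, ℝ).prod 𝓘(ℝ, E)) (M := ℝ × M) (t₀ := t) (v := suspension X)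
      (x₀ := (q.1 + t, x)) ((hX.suspension).contMDiffAt.of_le (by simp))
    have hder : ∀ᶠ r in 𝓝 t, HasDerivAt (fun r => ((γ r).1, e (γ r).2))
        (F ((γ r).1, e (γ r).2)) r := by
      filter_upwards [hγ] with r hr
      have h1 : HasDerivAt (fun r => (γ r).1) 1 r := by
        have := hasDerivAt_comp_curve hr (g := Prod.fst) mdifferentiableAt_fst
        rw [mfderiv_fst] at this
        exact this
      have h2 : HasDerivAt (fun r => e (γ r).2) (Y ((γ r).1, e (γ r).2)) r := by
        have hm : MDifferentiableAt 𝓘(ℝ, E) 𝓘(ℝ, ι → E × ℝ) e (γ r).2 :=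
          hes.mdifferentiableAt (by simp)
        have := hasDerivAt_comp_curve hr (g := fun p : ℝ × M => e p.2)
          (hm.comp _ mdifferentiableAt_snd)
        have hc : mfderiv (𝓘(ℝ, ℝ).prod 𝓘(ℝ, E)) 𝓘(ℝ, ι → E × ℝ) (fun p : ℝ × M => e p.2) (γ r)
            (suspension X (γ r)) = Y ((γ r).1, e (γ r).2) := by
          rw [hY]
          change mfderiv (𝓘(ℝ, ℝ).prod 𝓘(ℝ, E)) 𝓘(ℝ, ι → E × ℝ) (e ∘ Prod.snd) (γ r) _ = _
          rw [mfderiv_comp (γ r) hm mdifferentiableAt_snd, mfderiv_snd]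
          rfl
        rwa [hc] at this
      exact h1.prodMk h2
    have heq : (fun r => Φ r q) =ᶠ[𝓝 t] fun r => ((γ r).1, e (γ r).2) :=
      ODE_solution_unique_of_eventually (v := fun _ => F) (s := fun _ => univ)
        (Eventually.of_forall fun _ => hFK.lipschitzOnWith)
        (Eventually.of_forall fun r => ⟨hΦd q r, trivial⟩)
        (hder.mono fun r hr => ⟨hr, trivial⟩) (by simp only [hγ0, hx])
    have hγ1 : (fun r => γ r) =ᶠ[𝓝 t] fun r => (q.1 + r, (γ r).2) := by
      filter_upwards [heq] with r hr
      have := congr_arg Prod.fst hr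
      simp only [hfst] at this
      rw [this]
    refine ⟨fun r => (γ r).2, congr_arg Prod.snd hγ0, ?_⟩
    filter_upwards [heq, hγ1, hγ1.eventually_nhds, hγ] with r h1 h2 h3 h4
    refine ⟨?_, ?_⟩
    · rw [h1, h2]
    · have h3' : (fun r => (q.1 + r, (γ r).2)) =ᶠ[𝓝 r] γ := EventuallyEq.symm h3
      have := HasMFDerivAt.congr_of_eventuallyEq h4 h3'
      rw [h2] at this
      exact this
  -- The set of times at which the trajectory lies in the image of `M` is closed by compactness,
  -- open by `hlocal`, and contains `0`.
  have hinv : ∀ s x t, ∃ x', Φ t (s, e x) = (s + t, e x') := by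
    intro s x
    have hcont : Continuous fun t => Φ t (s, e x) :=
      continuous_iff_continuousAt.2 fun t => (hΦd _ t).continuousAt
    set S : Set ℝ := {t | ∃ x', Φ t (s, e x) = (s + t, e x')} with hS
    have hclosed : IsClosed S := by
      have : S = (fun t => (Φ t (s, e x)).2) ⁻¹' range e := by
        ext t
        constructor
        · rintro ⟨x', hx'⟩
          exact ⟨x', (congr_arg Prod.snd hx').symm⟩
        · rintro ⟨x', hx'⟩
          exact ⟨x', Prod.ext (hfst _ _) hx'.symm⟩
      rw [this]
      exact (isCompact_range hes.continuous).isClosed.preimage hcont.snd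
    have hopen : IsOpen S := by
      rw [isOpen_iff_mem_nhds]
      rintro t ⟨x', hx'⟩
      obtain ⟨σ, -, hσ⟩ := hlocal _ _ _ hx'
      filter_upwards [hσ] with r hr
      exact ⟨_, hr.1⟩
    have huniv : S = univ := IsClopen.eq_univ ⟨hclosed, hopen⟩
      ⟨0, x, by rw [hΦ, flow_zero, add_zero]⟩
    exact fun t => huniv.ge (mem_univ t)
  choose ψ hψ using hinv
  refine ⟨fun t s x => ψ s x t, ?_, ?_, ?_, ?_⟩
  · apply contMDiff_of_embedding_comp f
    have h1 : ContMDiff (𝓘(ℝ, ℝ).prod (𝓘(ℝ, ℝ).prod 𝓘(ℝ, E))) 𝓘(ℝ, ℝ × (ℝ × (ι → E × ℝ))) ∞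
        (fun p : ℝ × (ℝ × M) => (p.1, (p.2.1, e p.2.2))) :=
      contMDiff_fst.prodMk_space ((contMDiff_fst.comp contMDiff_snd).prodMk_space
        (hes.comp (contMDiff_snd.comp contMDiff_snd)))
    have h2 := (contDiff_snd.comp (contDiff_flow hFs hFK)).contMDiff.comp h1
    refine h2.congr fun p => ?_
    exact (congr_arg Prod.snd (hψ p.2.1 p.2.2 p.1)).symm
  · intro s x
    apply hei
    have := hψ s x 0
    rw [hΦ, flow_zero, Prod.mk_inj] at this
    exact this.2.symm
  · intro t t' s x
    apply hei
    have h1 := hψ (s + t') (ψ s x t') t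
    rw [← hψ s x t', hΦ, ← flow_add, ← hΦ, hψ s x (t + t'), Prod.mk_inj] at h1
    exact h1.2.symm
  · intro t s x
    obtain ⟨σ, h1, h2⟩ := hlocal _ _ _ (hψ s x t)
    have h3 : (fun r => (s + r, ψ s x r)) =ᶠ[𝓝 t] fun r => (s + r, σ r) := by
      filter_upwards [h2] with r hr
      have := (hψ s x r).symm.trans hr.1
      rw [Prod.mk_inj] at this
      rw [hei this.2]
    have h4 := h2.self_of_nhds.2.congr_of_eventuallyEq h3
    change HasMFDerivAt 𝓘(ℝ, ℝ) (𝓘(ℝ, ℝ).prod 𝓘(ℝ, E)) (fun r => (s + r, ψ s x r)) t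
      ((1 : ℝ →L[ℝ] ℝ).smulRight (suspension X (s + t, ψ s x t)))
    rw [← h1]
    exact h4

end ManifoldFlow

end SmoothFlow

/-! ### Linear differential equations with parameters in a compact manifold -/

namespace SmoothFlow

open Topology Filter NNReal

/-- Left multiplication by `b` is injective because `a` is a left inverse, hence surjective in
finite dimension; this gives a right inverse of `b`, which must be `a`. -/
theorem mul_eq_one_comm_of_finiteDimensional {𝔸 : Type*} [Ring 𝔸] [Algebra ℝ 𝔸]
    [FiniteDimensional ℝ 𝔸] {a b : 𝔸} (h : a * b = 1) : b * a = 1 := by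
  have hinj : Function.Injective (LinearMap.mulLeft ℝ b) := by
    intro x y hxy
    have : a * (b * x) = a * (b * y) := congr_arg (a * ·) hxy
    rwa [← mul_assoc, ← mul_assoc, h, one_mul, one_mul] at this
  obtain ⟨c, hc⟩ := LinearMap.surjective_of_injective hinj 1
  have hc' : b * c = 1 := hc
  have : a = c := by
    calc a = a * (b * c) := by rw [hc', mul_one]
      _ = c := by rw [← mul_assoc, h, one_mul]
  rw [this, hc']

/-- A function whose derivative vanishes outside of `[0, 1]` and is bounded by a multiple of the
function satisfies an exponential bound on the whole real line. -/
theorem norm_le_of_norm_deriv_le {G : Type*} [NormedAddCommGroup G] [NormedSpace ℝ G]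
    {w w' : ℝ → G} {C : ℝ} (hC : 0 ≤ C) (hw : ∀ t, HasDerivAt w (w' t) t)
    (hbound : ∀ t, ‖w' t‖ ≤ C * ‖w t‖) (h0 : ∀ t ∉ Icc (0 : ℝ) 1, w' t = 0) (t : ℝ) :
    ‖w t‖ ≤ ‖w 0‖ * Real.exp C := by
  have hcont : Continuous w := continuous_iff_continuousAt.2 fun t => (hw t).continuousAt
  have h1 : 1 ≤ Real.exp C := Real.one_le_exp hC
  have hI : ∀ t ∈ Icc (0 : ℝ) 1, ‖w t‖ ≤ ‖w 0‖ * Real.exp C := by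
    intro t ht
    have := norm_le_gronwallBound_of_norm_deriv_right_le (δ := ‖w 0‖) (K := C) (ε := 0)
      hcont.continuousOn (fun t _ => (hw t).hasDerivWithinAt) le_rfl
      (fun t _ => by simpa using hbound t) t ht
    rw [gronwallBound_ε0, sub_zero] at this
    refine this.trans (mul_le_mul_of_nonneg_left (Real.exp_le_exp.2 ?_) (norm_nonneg _))
    nlinarith [ht.2]
  rcases lt_or_ge t 0 with ht | ht
  · have := norm_image_sub_le_of_norm_deriv_le_segment' (f := w) (a := t) (b := 0) (C := 0)
      (fun s _ => (hw s).hasDerivWithinAt)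
      (fun s hs => by rw [h0 s (fun h => absurd hs.2 (not_lt.2 h.1)), norm_zero])
      0 ⟨ht.le, le_rfl⟩
    rw [zero_mul] at this
    have e : w 0 = w t := sub_eq_zero.1 (norm_le_zero_iff.1 this)
    rw [← e]
    nlinarith [norm_nonneg (w 0)]
  · rcases le_or_gt t 1 with ht1 | ht1
    · exact hI t ⟨ht, ht1⟩
    · have hder : ∀ s ∈ Ioo 1 t, HasDerivAt w 0 s := fun s hs => by
        have := hw s
        rwa [h0 s (fun h => absurd hs.1 (not_lt.2 h.2))] at this
      have e : w t = w 1 := by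
        have hconst : ∀ s ∈ Ioo 1 t, ∀ r ∈ Ioo 1 t, w s = w r := fun s hs r hr => by
          have := Convex.norm_image_sub_le_of_norm_hasDerivWithin_le (f := w) (C := 0)
            (f' := fun _ => 0) (fun s hs => (hder s hs).hasDerivWithinAt) (by simp)
            (convex_Ioo 1 t) hr hs
          rw [zero_mul] at this
          exact sub_eq_zero.1 (norm_le_zero_iff.1 this)
        have hm : (1 + t) / 2 ∈ Ioo 1 t := ⟨by linarith, by linarith⟩
        have hall : ∀ s ∈ closure (Ioo 1 t), w s = w ((1 + t) / 2) := by
          intro s hs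
          exact closure_minimal (t := {s | w s = w ((1 + t) / 2)})
            (fun s hs => hconst s hs _ hm) (isClosed_eq hcont continuous_const) hs
        rw [closure_Ioo ht1.ne] at hall
        exact ((hall t ⟨ht1.le, le_rfl⟩).trans (hall 1 ⟨le_rfl, ht1.le⟩).symm)
      rw [e]
      exact hI 1 ⟨zero_le_one, le_rfl⟩

section LinearFlow

variable {E : Type*} [NormedAddCommGroup E] [NormedSpace ℝ E] [FiniteDimensional ℝ E]
  {M : Type*} [TopologicalSpace M] [ChartedSpace E M] [IsManifold 𝓘(ℝ, E) ∞ M]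
  [T2Space M] [CompactSpace M]

/-- Solutions of linear differential equations with coefficients depending smoothly on a point of
a compact manifold are smooth. -/
theorem exists_linearFlow {𝔸 : Type*} [NormedRing 𝔸] [NormedAlgebra ℝ 𝔸] [FiniteDimensional ℝ 𝔸]
    {A : ℝ × M → 𝔸} (hA : ContMDiff (𝓘(ℝ, ℝ).prod 𝓘(ℝ, E)) 𝓘(ℝ, 𝔸) ∞ A)
    (hA0 : ∀ t ∉ Icc (0 : ℝ) 1, ∀ x, A (t, x) = 0) :
    ∃ U R : ℝ × M → 𝔸, ContMDiff (𝓘(ℝ, ℝ).prod 𝓘(ℝ, E)) 𝓘(ℝ, 𝔸) ∞ U ∧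
      ContMDiff (𝓘(ℝ, ℝ).prod 𝓘(ℝ, E)) 𝓘(ℝ, 𝔸) ∞ R ∧
      (∀ x, U (0, x) = 1) ∧
      (∀ t x, HasDerivAt (fun t => U (t, x)) (U (t, x) * A (t, x)) t) ∧
      (∀ t x, HasDerivAt (fun t => R (t, x)) (-(A (t, x) * R (t, x))) t) ∧
      (∀ p, U p * R p = 1) ∧ ∀ p, R p * U p = 1 := by
  have : CompleteSpace 𝔸 := FiniteDimensional.complete ℝ 𝔸
  obtain ⟨ι, f, -⟩ := SmoothBumpCovering.exists_isSubordinate 𝓘(ℝ, E) (s := (univ : Set M))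
    isClosed_univ (U := fun _ => univ) (fun _ _ => univ_mem)
  have : Fintype ι := f.fintype
  set e := embedding f with he
  have hes : ContMDiff 𝓘(ℝ, E) 𝓘(ℝ, ι → E × ℝ) ∞ e := contMDiff_embedding f
  obtain ⟨A₀, hA₀s, hA₀⟩ := exists_extension f hA
  obtain ⟨A', hAs, hAc, hAeq, hAz⟩ := exists_cutoff hA₀s (s := Icc (0 : ℝ) 1 ×ˢ range e)
    (isCompact_Icc.prod (isCompact_range hes.continuous)).isBounded
  have hA' : ∀ t x, A' (t, e x) = A (t, x) := by
    intro t x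
    by_cases ht : t ∈ Icc (0 : ℝ) 1
    · exact (hAeq _ ⟨ht, mem_range_self x⟩).trans (hA₀ t x)
    · exact (hAz _ ((hA₀ t x).trans (hA0 t ht x))).trans (hA0 t ht x).symm
  obtain ⟨C, hC⟩ := hAc.exists_bound_of_continuous hAs.continuous
  have hC0 : 0 ≤ C := (norm_nonneg _).trans (hC 0)
  -- The field `(U A', -A' R)` is bilinear in coefficients and unknowns, hence not globally
  -- Lipschitz, so the unknowns are cut off as well. The inner radius exceeds the a priori bound
  -- `‖(1, 1)‖ exp C`, so the cutoff is never felt by the solutions starting at `(1, 1)`.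
  let κ : ContDiffBump (0 : 𝔸 × 𝔸) := ⟨‖((1 : 𝔸), (1 : 𝔸))‖ * Real.exp C + 1,
    ‖((1 : 𝔸), (1 : 𝔸))‖ * Real.exp C + 2, by positivity, by linarith⟩
  set N : (ℝ × (ι → E × ℝ)) × (𝔸 × 𝔸) → 𝔸 × 𝔸 := fun z =>
    κ z.2 • (z.2.1 * A' z.1, -(A' z.1 * z.2.2)) with hN
  have hAz1 : ContDiff ℝ ∞ fun z : (ℝ × (ι → E × ℝ)) × (𝔸 × 𝔸) => A' z.1 :=
    hAs.comp contDiff_fst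
  have hNs : ContDiff ℝ ∞ N :=
    (κ.contDiff.comp contDiff_snd).smul
      (((contDiff_fst.comp contDiff_snd).mul hAz1).prodMk
        (hAz1.mul (contDiff_snd.comp contDiff_snd)).neg)
  have hNc : HasCompactSupport N := by
    refine HasCompactSupport.intro (hAc.isCompact.prod κ.hasCompactSupport.isCompact) ?_
    rintro ⟨q, w⟩ hz
    by_cases hq : q ∈ tsupport A'
    · have hw : w ∉ tsupport κ := fun hw => hz ⟨hq, hw⟩
      change κ w • (w.1 * A' q, -(A' q * w.2)) = 0
      rw [image_eq_zero_of_notMem_tsupport hw, zero_smul]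
    · change κ w • (w.1 * A' q, -(A' q * w.2)) = 0
      rw [image_eq_zero_of_notMem_tsupport hq, mul_zero, zero_mul, neg_zero, Prod.mk_zero_zero,
        smul_zero]
  have hNb : ∀ q w, ‖N (q, w)‖ ≤ C * ‖w‖ := by
    intro q w
    change ‖κ w • (w.1 * A' q, -(A' q * w.2))‖ ≤ _
    rw [norm_smul, Real.norm_of_nonneg κ.nonneg]
    have h1 : ‖(w.1 * A' q, -(A' q * w.2))‖ ≤ C * ‖w‖ := by
      refine norm_prod_le_iff.2 ⟨?_, ?_⟩
      · refine (norm_mul_le _ _).trans ?_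
        rw [mul_comm]
        exact mul_le_mul (hC q) (norm_fst_le w) (norm_nonneg _) hC0
      · rw [norm_neg]
        refine (norm_mul_le _ _).trans ?_
        exact mul_le_mul (hC q) (norm_snd_le w) (norm_nonneg _) hC0
    exact (mul_le_of_le_one_left (norm_nonneg _) κ.le_one).trans h1
  obtain ⟨L, hL⟩ := hNs.lipschitzWith_of_hasCompactSupport hNc (by simp)
  set F : (ℝ × (ι → E × ℝ)) × (𝔸 × 𝔸) → (ℝ × (ι → E × ℝ)) × (𝔸 × 𝔸) :=
    fun z => ((1, 0), N z) with hF
  have hFs : ContDiff ℝ ∞ F := contDiff_const.prodMk hNs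
  have hFK : LipschitzWith (max 0 L) F :=
    (LipschitzWith.const ((1 : ℝ), (0 : ι → E × ℝ))).prodMk hL
  set Φ := flow hFs hFK with hΦ
  have hΦd : ∀ z t, HasDerivAt (fun t => Φ t z) (F (Φ t z)) t := hasDerivAt_flow hFs hFK
  set z₀ : M → (ℝ × (ι → E × ℝ)) × (𝔸 × 𝔸) := fun x => ((0, e x), (1, 1)) with hz₀
  have hbase : ∀ x t, (Φ t (z₀ x)).1 = (t, e x) := by
    intro x t
    have hd : ∀ t, HasDerivAt (fun t => (Φ t (z₀ x)).1 - (t, e x)) 0 t := fun t => by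
      have h1 : HasDerivAt (fun t => (Φ t (z₀ x)).1) ((1 : ℝ), (0 : ι → E × ℝ)) t :=
        (hΦd (z₀ x) t).fst
      exact (h1.sub ((hasDerivAt_id t).prodMk (hasDerivAt_const t (e x)))).congr_deriv
        (sub_self _)
    have h2 := is_const_of_deriv_eq_zero (fun t => (hd t).differentiableAt)
      (fun t => (hd t).deriv) t 0
    simp only [hΦ, flow_zero] at h2
    rw [hz₀, sub_self, sub_eq_zero] at h2
    exact h2
  set w : M → ℝ → 𝔸 × 𝔸 := fun x t => (Φ t (z₀ x)).2 with hw
  have hwN : ∀ x t, HasDerivAt (w x) (N ((t, e x), w x t)) t := fun x t => by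
    have h1 : HasDerivAt (w x) (N (Φ t (z₀ x))) t := (hΦd (z₀ x) t).snd
    rw [← hbase x t]
    exact h1
  have hw0 : ∀ x, w x 0 = (1, 1) := fun x => by simp only [hw, hΦ, flow_zero, hz₀]
  -- The truncated field still satisfies the linear bound `hNb`, so the exponential estimate is
  -- available before the truncation is known to be inactive.
  have hwb : ∀ x t, ‖w x t‖ ≤ ‖((1 : 𝔸), (1 : 𝔸))‖ * Real.exp C := by
    intro x t
    rw [← hw0 x]
    refine norm_le_of_norm_deriv_le hC0 (hwN x) (fun t => hNb _ _) (fun t ht => ?_) t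
    change κ (w x t) • ((w x t).1 * A' (t, e x), -(A' (t, e x) * (w x t).2)) = 0
    rw [hA', hA0 t ht x, mul_zero, zero_mul, neg_zero, Prod.mk_zero_zero, smul_zero]
  have hwd : ∀ x t, HasDerivAt (w x) ((w x t).1 * A (t, x), -(A (t, x) * (w x t).2)) t := by
    intro x t
    refine (hwN x t).congr_deriv ?_
    change κ (w x t) • ((w x t).1 * A' (t, e x), -(A' (t, e x) * (w x t).2)) = _
    have hmem : w x t ∈ Metric.closedBall (0 : 𝔸 × 𝔸) κ.rIn := by
      rw [mem_closedBall_zero_iff]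
      exact (hwb x t).trans (by change _ ≤ _ + (1 : ℝ); linarith)
    rw [κ.one_of_mem_closedBall hmem, one_smul, hA']
  have hws : ContMDiff (𝓘(ℝ, ℝ).prod 𝓘(ℝ, E)) 𝓘(ℝ, 𝔸 × 𝔸) ∞ (fun p : ℝ × M => w p.2 p.1) := by
    have h1 : ContMDiff (𝓘(ℝ, ℝ).prod 𝓘(ℝ, E))
        𝓘(ℝ, ℝ × ((ℝ × (ι → E × ℝ)) × (𝔸 × 𝔸))) ∞ (fun p : ℝ × M => (p.1, z₀ p.2)) :=
      contMDiff_fst.prodMk_space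
        ((contMDiff_const.prodMk_space (hes.comp contMDiff_snd)).prodMk_space contMDiff_const)
    exact (contDiff_snd.comp (contDiff_flow hFs hFK)).contMDiff.comp h1
  have hUd : ∀ t x, HasDerivAt (fun t => (w x t).1) ((w x t).1 * A (t, x)) t :=
    fun t x => (hwd x t).fst
  have hRd : ∀ t x, HasDerivAt (fun t => (w x t).2) (-(A (t, x) * (w x t).2)) t :=
    fun t x => (hwd x t).snd
  have hUR : ∀ p : ℝ × M, (w p.2 p.1).1 * (w p.2 p.1).2 = 1 := by
    rintro ⟨t, x⟩
    have hd : ∀ t, HasDerivAt (fun t => (w x t).1 * (w x t).2) 0 t := fun t => by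
      refine ((hUd t x).mul (hRd t x)).congr_deriv ?_
      rw [mul_neg, mul_assoc, add_neg_cancel]
    have h2 := is_const_of_deriv_eq_zero (fun t => (hd t).differentiableAt)
      (fun t => (hd t).deriv) t 0
    simp only [hw0, mul_one] at h2
    exact h2
  refine ⟨fun p => (w p.2 p.1).1, fun p => (w p.2 p.1).2,
    contDiff_fst.contMDiff.comp hws, contDiff_snd.contMDiff.comp hws,
    fun x => congr_arg Prod.fst (hw0 x), hUd, hRd, hUR,
    fun p => mul_eq_one_comm_of_finiteDimensional (hUR p)⟩

theorem exists_matrixFlow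
    {W : Type*} [NormedAddCommGroup W] [NormedSpace ℝ W] [FiniteDimensional ℝ W]
    {A : ℝ × M → W →L[ℝ] W} (hA : ContMDiff (𝓘(ℝ, ℝ).prod 𝓘(ℝ, E)) 𝓘(ℝ, W →L[ℝ] W) ∞ A)
    (hA0 : ∀ t ∉ Icc (0 : ℝ) 1, ∀ x, A (t, x) = 0) :
    ∃ U R : ℝ × M → W →L[ℝ] W,
      ContMDiff (𝓘(ℝ, ℝ).prod 𝓘(ℝ, E)) 𝓘(ℝ, W →L[ℝ] W) ∞ U ∧
      ContMDiff (𝓘(ℝ, ℝ).prod 𝓘(ℝ, E)) 𝓘(ℝ, W →L[ℝ] W) ∞ R ∧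
      (∀ x, U (0, x) = 1) ∧
      (∀ t x, HasDerivAt (fun t => U (t, x)) (U (t, x) * A (t, x)) t) ∧
      (∀ t x, HasDerivAt (fun t => R (t, x)) (-(A (t, x) * R (t, x))) t) ∧
      (∀ p, U p * R p = 1) ∧ ∀ p, R p * U p = 1 :=
  exists_linearFlow (𝔸 := W →L[ℝ] W) hA hA0

end LinearFlow

end SmoothFlow

/-! ### Time and space derivatives of smooth families of functions -/

namespace SmoothFlow

open Topology Filter NNReal

section SecondDerivatives

variable {E : Type*} [NormedAddCommGroup E] [NormedSpace ℝ E]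

theorem hasDerivAt_slice_left {W : Type*} [NormedAddCommGroup W] [NormedSpace ℝ W]
    {F : ℝ × E → W} {t : ℝ} {u : E} (hF : DifferentiableAt ℝ F (t, u)) :
    HasDerivAt (fun s => F (s, u)) (fderiv ℝ F (t, u) (1, 0)) t :=
  hF.hasFDerivAt.comp_hasDerivAt t ((hasDerivAt_id t).prodMk (hasDerivAt_const t u))

theorem hasFDerivAt_slice_right {W : Type*} [NormedAddCommGroup W] [NormedSpace ℝ W]
    {F : ℝ × E → W} {t : ℝ} {u : E} (hF : DifferentiableAt ℝ F (t, u)) :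
    HasFDerivAt (fun u => F (t, u)) (fderiv ℝ F (t, u) ∘L .inr ℝ ℝ E) u :=
  hF.hasFDerivAt.comp u (hasFDerivAt_prodMk_right t u)

/-- The time derivative of a spatial derivative is the spatial derivative of the time
derivative. -/
theorem hasDerivAt_fderiv_slice {W : Type*} [NormedAddCommGroup W] [NormedSpace ℝ W]
    {F : ℝ × E → W} {t : ℝ} {u : E}
    (hF : ContDiffAt ℝ 2 F (t, u)) (v : E) :
    HasDerivAt (fun s => fderiv ℝ (fun u => F (s, u)) u v)
      (fderiv ℝ (fun u => deriv (fun s => F (s, u)) t) u v) t := by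
  have hev : ∀ᶠ p in 𝓝 (t, u), DifferentiableAt ℝ F p :=
    (hF.eventually (by simp)).mono fun p hp => hp.differentiableAt (by simp)
  have hF1 : DifferentiableAt ℝ (fderiv ℝ F) (t, u) :=
    (hF.fderiv_right (m := 1) (by norm_num)).differentiableAt (by simp)
  have hsymm : IsSymmSndFDerivAt ℝ F (t, u) := hF.isSymmSndFDerivAt (by simp)
  have h1 : HasDerivAt (fun s => fderiv ℝ F (s, u) (0, v))
      (fderiv ℝ (fderiv ℝ F) (t, u) (1, 0) (0, v)) t :=
    (hasDerivAt_slice_left hF1).clm_apply (hasDerivAt_const t ((0 : ℝ), v)) |>.congr_deriv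
      (by simp)
  have h2 : HasFDerivAt (fun u => fderiv ℝ F (t, u) (1, 0))
      ((fderiv ℝ (fderiv ℝ F) (t, u) ∘L .inr ℝ ℝ E).flip (1, 0)) u := by
    have := (hasFDerivAt_slice_right hF1).clm_apply
      (hasFDerivAt_const ((1 : ℝ), (0 : E)) u)
    simpa using this
  have e1 : (fun s => fderiv ℝ (fun u => F (s, u)) u v) =ᶠ[𝓝 t]
      fun s => fderiv ℝ F (s, u) (0, v) := by
    have : Tendsto (fun s : ℝ => (s, u)) (𝓝 t) (𝓝 (t, u)) :=
      (Continuous.prodMk_left u).continuousAt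
    filter_upwards [this.eventually hev] with s hs
    rw [(hasFDerivAt_slice_right hs).fderiv]
    rfl
  have e2 : (fun u => deriv (fun s => F (s, u)) t) =ᶠ[𝓝 u]
      fun u => fderiv ℝ F (t, u) (1, 0) := by
    have : Tendsto (fun u : E => (t, u)) (𝓝 u) (𝓝 (t, u)) :=
      (Continuous.prodMk_right t).continuousAt
    filter_upwards [this.eventually hev] with u hu
    exact (hasDerivAt_slice_left hu).deriv
  rw [e2.fderiv_eq, h2.fderiv]
  refine (h1.congr_of_eventuallyEq e1).congr_deriv ?_
  exact hsymm.eq (1, 0) (0, v)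

end SecondDerivatives

section TimeFamilies

variable {E : Type*} [NormedAddCommGroup E] [NormedSpace ℝ E]
  {M : Type*} [TopologicalSpace M] [ChartedSpace E M] [IsManifold 𝓘(ℝ, E) ∞ M]
  {W : Type*} [NormedAddCommGroup W] [NormedSpace ℝ W]

/-- The derivative of a vector-valued function along a tangent vector. -/
def dirDer (g : M → W) (x : M) (v : TangentSpace 𝓘(ℝ, E) x) : W :=
  mfderiv 𝓘(ℝ, E) 𝓘(ℝ, W) g x v

omit [IsManifold 𝓘(ℝ, E) ∞ M] in
theorem dirDer_neg (g : M → W) (x : M) (v : TangentSpace 𝓘(ℝ, E) x) :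
    dirDer g x (-v) = -dirDer g x v := map_neg (mfderiv 𝓘(ℝ, E) 𝓘(ℝ, W) g x) v

omit [IsManifold 𝓘(ℝ, E) ∞ M] in
theorem dirDer_zero (g : M → W) (x : M) : dirDer g x (0 : TangentSpace 𝓘(ℝ, E) x) = 0 :=
  map_zero (mfderiv 𝓘(ℝ, E) 𝓘(ℝ, W) g x)

omit [IsManifold 𝓘(ℝ, E) ∞ M] in
theorem dirDer_sum_smul {κ : Type*} (s : Finset κ) (g : M → W) (x : M) (c : κ → ℝ)
    (v : κ → TangentSpace 𝓘(ℝ, E) x) :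
    dirDer g x (∑ k ∈ s, c k • v k) = ∑ k ∈ s, c k • dirDer g x (v k) := by
  let ℓ : TangentSpace 𝓘(ℝ, E) x →L[ℝ] W := mfderiv 𝓘(ℝ, E) 𝓘(ℝ, W) g x
  change ℓ (∑ k ∈ s, c k • v k) = ∑ k ∈ s, c k • ℓ (v k)
  rw [map_sum]
  exact Finset.sum_congr rfl fun k _ => map_smul ℓ _ _

/-- The time derivative of a family of functions. -/
def timeDer (f : ℝ × M → W) (p : ℝ × M) : W := deriv (fun s => f (s, p.2)) p.1

omit [IsManifold 𝓘(ℝ, E) ∞ M] in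
theorem mfderiv_suspended {f : ℝ × M → W}
    (hf : ContMDiff (𝓘(ℝ, ℝ).prod 𝓘(ℝ, E)) 𝓘(ℝ, W) ∞ f) (p : ℝ × M) (c : ℝ)
    (v : TangentSpace 𝓘(ℝ, E) p.2) :
    (mfderiv (𝓘(ℝ, ℝ).prod 𝓘(ℝ, E)) 𝓘(ℝ, W) f p
      ((c, v) : TangentSpace (𝓘(ℝ, ℝ).prod 𝓘(ℝ, E)) p) : W) =
      c • timeDer f p + dirDer (fun y => f (p.1, y)) p.2 v := by
  have h := mfderiv_prod_eq_add_apply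
    (v := ((c, v) : TangentSpace (𝓘(ℝ, ℝ).prod 𝓘(ℝ, E)) p))
    (hf.mdifferentiableAt (x := p) (by simp))
  refine h.trans (congr_arg (· + dirDer (fun y => f (p.1, y)) p.2 v) ?_)
  change (mfderiv 𝓘(ℝ, ℝ) 𝓘(ℝ, W) (fun s => f (s, p.2)) p.1 : ℝ →L[ℝ] W) c = _
  rw [mfderiv_eq_fderiv]
  have e (L : ℝ →L[ℝ] W) : L c = c • L 1 := by rw [← map_smul, smul_eq_mul, mul_one]
  exact (e _).trans (congr_arg (c • ·) fderiv_apply_one_eq_deriv)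

/-- This is the fibre component of the tangent map of `f` along the smooth field `(c, Y)` on `ℝ ×
M`. The choices `c = 1`, `Y = 0` and `c = 0` give the smoothness of the time and space derivatives
separately. -/
theorem contMDiff_mfderiv_along {f : ℝ × M → W}
    (hf : ContMDiff (𝓘(ℝ, ℝ).prod 𝓘(ℝ, E)) 𝓘(ℝ, W) ∞ f) (c : ℝ)
    {Y : (x : M) → TangentSpace 𝓘(ℝ, E) x}
    (hY : ContMDiff 𝓘(ℝ, E) 𝓘(ℝ, E).tangent ∞
      (fun x => (⟨x, Y x⟩ : TangentBundle 𝓘(ℝ, E) M))) :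
    ContMDiff (𝓘(ℝ, ℝ).prod 𝓘(ℝ, E)) 𝓘(ℝ, W) ∞ fun p : ℝ × M =>
      c • timeDer f p + dirDer (fun y => f (p.1, y)) p.2 (Y p.2) := by
  have h0 : ContMDiff (𝓘(ℝ, ℝ).prod 𝓘(ℝ, E)) 𝓘(ℝ, ℝ).tangent ∞
      (fun p : ℝ × M => (⟨p.1, c⟩ : TangentBundle 𝓘(ℝ, ℝ) ℝ)) := by
    have : ContMDiff 𝓘(ℝ, ℝ) 𝓘(ℝ, ℝ).tangent ∞
        (fun t : ℝ => (⟨t, c⟩ : TangentBundle 𝓘(ℝ, ℝ) ℝ)) :=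
      contMDiff_vectorSpace_iff_contDiff.2 contDiff_const
    exact this.comp contMDiff_fst
  have h1 : ContMDiff (𝓘(ℝ, ℝ).prod 𝓘(ℝ, E)) (𝓘(ℝ, ℝ).prod 𝓘(ℝ, E)).tangent ∞
      (fun p : ℝ × M => (⟨p, (c, Y p.2)⟩ :
        TangentBundle (𝓘(ℝ, ℝ).prod 𝓘(ℝ, E)) (ℝ × M))) :=
    (contMDiff_equivTangentBundleProd_symm (I := 𝓘(ℝ, ℝ)) (M := ℝ) (I' := 𝓘(ℝ, E))
      (M' := M) (n := ∞)).comp (h0.prodMk (hY.comp contMDiff_snd))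
  have h2 : ContMDiff (𝓘(ℝ, ℝ).prod 𝓘(ℝ, E)).tangent 𝓘(ℝ, W).tangent ∞
      (tangentMap (𝓘(ℝ, ℝ).prod 𝓘(ℝ, E)) 𝓘(ℝ, W) f) := hf.contMDiff_tangentMap (by simp)
  refine ((contMDiff_snd_tangentBundle_modelSpace W 𝓘(ℝ, W)).comp (h2.comp h1)).congr
    fun p => ?_
  exact (mfderiv_suspended hf p c (Y p.2)).symm

theorem contMDiff_timeDer {f : ℝ × M → W}
    (hf : ContMDiff (𝓘(ℝ, ℝ).prod 𝓘(ℝ, E)) 𝓘(ℝ, W) ∞ f) :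
    ContMDiff (𝓘(ℝ, ℝ).prod 𝓘(ℝ, E)) 𝓘(ℝ, W) ∞ (timeDer f) := by
  have hz : ContMDiff 𝓘(ℝ, E) 𝓘(ℝ, E).tangent ∞
      (fun x => (⟨x, 0⟩ : TangentBundle 𝓘(ℝ, E) M)) :=
    contMDiff_zeroSection ℝ (TangentSpace 𝓘(ℝ, E))
  refine (contMDiff_mfderiv_along hf 1 hz).congr fun p => ?_
  rw [one_smul]
  exact (add_eq_left.2 (map_zero _)).symm

theorem contMDiff_spaceDer {f : ℝ × M → W}
    (hf : ContMDiff (𝓘(ℝ, ℝ).prod 𝓘(ℝ, E)) 𝓘(ℝ, W) ∞ f)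
    {Y : (x : M) → TangentSpace 𝓘(ℝ, E) x}
    (hY : ContMDiff 𝓘(ℝ, E) 𝓘(ℝ, E).tangent ∞
      (fun x => (⟨x, Y x⟩ : TangentBundle 𝓘(ℝ, E) M))) :
    ContMDiff (𝓘(ℝ, ℝ).prod 𝓘(ℝ, E)) 𝓘(ℝ, W) ∞ fun p : ℝ × M =>
      dirDer (fun y => f (p.1, y)) p.2 (Y p.2) := by
  refine (contMDiff_mfderiv_along hf 0 hY).congr fun p => ?_
  rw [zero_smul, zero_add]

omit [IsManifold 𝓘(ℝ, E) ∞ M] in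
theorem hasDerivAt_timeDer {f : ℝ × M → W}
    (hf : ContMDiff (𝓘(ℝ, ℝ).prod 𝓘(ℝ, E)) 𝓘(ℝ, W) ∞ f) (t : ℝ) (x : M) :
    HasDerivAt (fun t => f (t, x)) (timeDer f (t, x)) t := by
  have h1 : ContMDiff 𝓘(ℝ, ℝ) 𝓘(ℝ, W) ∞ fun t => f (t, x) :=
    hf.comp (contMDiff_id.prodMk contMDiff_const)
  exact (h1.contDiff.differentiable (by simp) t).hasDerivAt

omit [IsManifold 𝓘(ℝ, E) ∞ M] in
/-- Derivative of a family of functions along an integral curve of a time-dependent vector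
field. -/
theorem hasDerivAt_along_curve {f : ℝ × M → W}
    (hf : ContMDiff (𝓘(ℝ, ℝ).prod 𝓘(ℝ, E)) 𝓘(ℝ, W) ∞ f)
    {X : ℝ → (x : M) → TangentSpace 𝓘(ℝ, E) x} {β : ℝ → M} {t : ℝ}
    (hβ : HasMFDerivAt 𝓘(ℝ, ℝ) (𝓘(ℝ, ℝ).prod 𝓘(ℝ, E)) (fun t => (t, β t)) t
      ((1 : ℝ →L[ℝ] ℝ).smulRight (suspension X (t, β t)))) :
    HasDerivAt (fun t => f (t, β t)) (timeDer f (t, β t) +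
      dirDer (fun y => f (t, y)) (β t) (X t (β t))) t := by
  have h1 := hasDerivAt_comp_curve hβ (g := f) (hf.mdifferentiableAt (by simp))
  refine h1.congr_deriv ?_
  refine (mfderiv_suspended hf (t, β t) 1 (X t (β t))).trans ?_
  rw [one_smul]

omit [IsManifold 𝓘(ℝ, E) ∞ M] in
theorem dirDer_eq_fderiv {g : M → W} {x : M} (hg : MDifferentiableAt 𝓘(ℝ, E) 𝓘(ℝ, W) g x)
    (v : TangentSpace 𝓘(ℝ, E) x) :
    dirDer g x v = fderiv ℝ (fun u => g ((extChartAt 𝓘(ℝ, E) x).symm u))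
      (extChartAt 𝓘(ℝ, E) x x) v := by
  rw [dirDer, hg.mfderiv]
  simp only [writtenInExtChartAt, mfld_simps, fderivWithin_univ]
  rfl

omit [IsManifold 𝓘(ℝ, E) ∞ M] in
theorem differentiableAt_comp_extChartAt_symm {g : M → W} {x : M}
    (hg : MDifferentiableAt 𝓘(ℝ, E) 𝓘(ℝ, W) g x) :
    DifferentiableAt ℝ (fun u => g ((extChartAt 𝓘(ℝ, E) x).symm u))
      (extChartAt 𝓘(ℝ, E) x x) := by
  have h := hg.differentiableWithinAt_writtenInExtChartAt
  simp only [writtenInExtChartAt, mfld_simps, differentiableWithinAt_univ] at h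
  exact h

/-- The time derivative commutes with the derivative along a tangent vector. -/
theorem hasDerivAt_spaceDer {f : ℝ × M → W}
    (hf : ContMDiff (𝓘(ℝ, ℝ).prod 𝓘(ℝ, E)) 𝓘(ℝ, W) ∞ f) (t : ℝ) (x : M)
    (v : TangentSpace 𝓘(ℝ, E) x) :
    HasDerivAt (fun t => dirDer (fun y => f (t, y)) x v)
      (dirDer (fun y => timeDer f (t, y)) x v) t := by
  set φ := extChartAt 𝓘(ℝ, E) x with hφ
  set F : ℝ × E → W := fun q => f (q.1, φ.symm q.2) with hFdef
  have key : ∀ g : M → W, ContMDiff 𝓘(ℝ, E) 𝓘(ℝ, W) ∞ g →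
      dirDer g x v = fderiv ℝ (fun u => g (φ.symm u)) (φ x) v := fun g hg =>
    dirDer_eq_fderiv (hg.mdifferentiableAt (x := x) (by simp)) v
  have hft : ∀ g : ℝ × M → W, ContMDiff (𝓘(ℝ, ℝ).prod 𝓘(ℝ, E)) 𝓘(ℝ, W) ∞ g → ∀ t,
      ContMDiff 𝓘(ℝ, E) 𝓘(ℝ, W) ∞ fun y => g (t, y) := fun g hg t =>
    hg.comp (contMDiff_const.prodMk contMDiff_id)
  have hFs : ContDiffAt ℝ ∞ F (t, φ x) := by
    have h1 : ContMDiffAt 𝓘(ℝ, E) 𝓘(ℝ, E) ∞ φ.symm (φ x) :=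
      (contMDiffOn_extChartAt_symm x).contMDiffAt (extChartAt_target_mem_nhds x)
    have h2 : ContMDiffAt (𝓘(ℝ, ℝ).prod 𝓘(ℝ, E)) (𝓘(ℝ, ℝ).prod 𝓘(ℝ, E)) ∞
        (fun q : ℝ × E => (q.1, φ.symm q.2)) (t, φ x) :=
      contMDiffAt_fst.prodMk (ContMDiffAt.comp (t, φ x) h1 contMDiffAt_snd)
    have h3 : ContMDiffAt (𝓘(ℝ, ℝ).prod 𝓘(ℝ, E)) 𝓘(ℝ, W) ∞ F (t, φ x) :=
      ContMDiffAt.comp (t, φ x) hf.contMDiffAt h2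
    rw [← modelWithCornersSelf_prod, chartedSpaceSelf_prod] at h3
    exact h3.contDiffAt
  have h := hasDerivAt_fderiv_slice (hFs.of_le (WithTop.coe_le_coe.2 (le_top : (2 : ℕ∞) ≤ ⊤))) v
  have e1 : (fun t => dirDer (fun y => f (t, y)) x v) =
      fun s => fderiv ℝ (fun u => F (s, u)) (φ x) v :=
    funext fun s => key _ (hft f hf s)
  rw [e1, key _ (hft _ (contMDiff_timeDer hf) t)]
  exact h

end TimeFamilies

end SmoothFlow

/-! ### Generating sections and the bracket in coefficients -/

namespace SmoothFlow

open Topology Filter NNReal Algebroid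

section DerivativeRules

variable {E : Type*} [NormedAddCommGroup E] [NormedSpace ℝ E]
  {M : Type*} [TopologicalSpace M] [ChartedSpace E M]
  {W : Type*} [NormedAddCommGroup W] [NormedSpace ℝ W]
  {W' : Type*} [NormedAddCommGroup W'] [NormedSpace ℝ W']

theorem dirDer_bilinear {W'' : Type*} [NormedAddCommGroup W''] [NormedSpace ℝ W'']
    (B : W →L[ℝ] W' →L[ℝ] W'') {f : M → W} {g : M → W'} {x : M}
    (hf : MDifferentiableAt 𝓘(ℝ, E) 𝓘(ℝ, W) f x) (hg : MDifferentiableAt 𝓘(ℝ, E) 𝓘(ℝ, W') g x)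
    (v : TangentSpace 𝓘(ℝ, E) x) :
    dirDer (fun y => B (f y) (g y)) x v = B (f x) (dirDer g x v) + B (dirDer f x v) (g x) := by
  have hf' := differentiableAt_comp_extChartAt_symm hf
  have hg' := differentiableAt_comp_extChartAt_symm hg
  have hB : MDifferentiableAt 𝓘(ℝ, E) 𝓘(ℝ, W'') (fun y => B (f y) (g y)) x := by
    have h : DifferentiableAt ℝ (fun p : W × W' => B p.1 p.2) (f x, g x) :=
      B.isBoundedBilinearMap.differentiableAt _
    exact MDifferentiableAt.comp x (h.mdifferentiableAt) (hf.prodMk_space hg)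
  rw [dirDer_eq_fderiv hB, dirDer_eq_fderiv hf, dirDer_eq_fderiv hg,
    (B.hasFDerivAt_of_bilinear hf'.hasFDerivAt hg'.hasFDerivAt).fderiv]
  simp only [extChartAt_to_inv]
  rfl

theorem dirDer_clm_apply {f : M → W →L[ℝ] W'} {g : M → W} {x : M}
    (hf : MDifferentiableAt 𝓘(ℝ, E) 𝓘(ℝ, W →L[ℝ] W') f x)
    (hg : MDifferentiableAt 𝓘(ℝ, E) 𝓘(ℝ, W) g x) (v : TangentSpace 𝓘(ℝ, E) x) :
    dirDer (fun y => f y (g y)) x v = f x (dirDer g x v) + (dirDer f x v) (g x) :=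
  dirDer_bilinear (ContinuousLinearMap.id ℝ (W →L[ℝ] W')) hf hg v

theorem dirDer_clm_comp (ℓ : W →L[ℝ] W') {g : M → W} {x : M}
    (hg : MDifferentiableAt 𝓘(ℝ, E) 𝓘(ℝ, W) g x) (v : TangentSpace 𝓘(ℝ, E) x) :
    dirDer (fun y => ℓ (g y)) x v = ℓ (dirDer g x v) := by
  have h : MDifferentiableAt 𝓘(ℝ, E) 𝓘(ℝ, W') (fun y => ℓ (g y)) x :=
    MDifferentiableAt.comp x (ℓ.differentiableAt.mdifferentiableAt) hg
  rw [dirDer_eq_fderiv h, dirDer_eq_fderiv hg]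
  exact DFunLike.congr_fun
    ((ℓ.hasFDerivAt.comp _ (differentiableAt_comp_extChartAt_symm hg).hasFDerivAt).fderiv) v

end DerivativeRules

variable {E : Type*} [NormedAddCommGroup E] [NormedSpace ℝ E]
  {M : Type*} [TopologicalSpace M] [ChartedSpace E M]
  {F : Type*} [NormedAddCommGroup F] [NormedSpace ℝ F]
  {A : M → Type*} [∀ x, AddCommGroup (A x)] [∀ x, Module ℝ (A x)]
  [TopologicalSpace (TotalSpace F A)] [∀ x, TopologicalSpace (A x)] [FiberBundle F A]
  [VectorBundle ℝ F A]

@[simp] theorem smulSection_apply (f : C^∞⟮𝓘(ℝ, E), M; ℝ⟯) (b : Sections 𝓘(ℝ, E) F A) (x : M) :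
    smulSection f b x = f x • b x := rfl

theorem sections_sum_apply {κ : Type*} (s : Finset κ) (f : κ → Sections 𝓘(ℝ, E) F A) (x : M) :
    (∑ k ∈ s, f k) x = ∑ k ∈ s, f k x := map_sum (evalAt x) f s

variable (E F A) in
/-- Finitely many sections generating `A`, with a smooth choice of coefficients; this presents
`A` as a direct summand of the trivial bundle with fibre `κ → ℝ`. -/
structure Generators (κ : Type*) [Fintype κ] where
  /-- the generating sections -/
  sec : κ → Sections 𝓘(ℝ, E) F A
  /-- the coefficients of a vector -/
  coord : ∀ x, A x →ₗ[ℝ] κ → ℝ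
  contMDiff_coord : ContMDiff (𝓘(ℝ, E).prod 𝓘(ℝ, F)) 𝓘(ℝ, κ → ℝ) ∞
    (fun p : TotalSpace F A => coord p.1 p.2)
  sum_coord_smul : ∀ x v, ∑ k, coord x v k • sec k x = v

/-- The generators are local frames multiplied by bump functions `f i` supported in trivialising
open sets. The coefficients carry a further factor `f i / D` with `D = ∑ (f i)²`, so the weights `(f
i)² / D` add up to `1`. -/
theorem Generators.exists_fin [FiniteDimensional ℝ E] [IsManifold 𝓘(ℝ, E) ∞ M]
    [T2Space M] [CompactSpace M] [FiniteDimensional ℝ F] [ContMDiffVectorBundle ∞ F A 𝓘(ℝ, E)] :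
    ∃ n : ℕ, Nonempty (Generators E F A (Fin n)) := by
  obtain ⟨ι, f, hf⟩ := SmoothBumpCovering.exists_isSubordinate 𝓘(ℝ, E) (isClosed_univ (X := M))
    (U := fun x => (trivializationAt F A x).baseSet)
    (fun x _ => (trivializationAt F A x).open_baseSet.mem_nhds (mem_baseSet_trivializationAt F A x))
  have : Fintype ι := f.fintype
  set b := Module.finBasis ℝ F
  set e : ι → Trivialization F (TotalSpace.proj : TotalSpace F A → M) :=
    fun i => trivializationAt F A (f.c i) with he
  have hsub : ∀ i, tsupport (f i) ⊆ (e i).baseSet := hf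
  set D : M → ℝ := fun x => ∑ i, f i x ^ 2 with hD
  have hDpos : ∀ x, 0 < D x := by
    intro x
    obtain ⟨i, hi⟩ := f.eventuallyEq_one' x (mem_univ x)
    have h1 : f i x = 1 := hi.eq_of_nhds
    refine Finset.sum_pos' (fun i _ => sq_nonneg _) ⟨i, Finset.mem_univ _, ?_⟩
    rw [h1]; norm_num
  have hDs : ContMDiff 𝓘(ℝ, E) 𝓘(ℝ, ℝ) ∞ D :=
    contMDiff_finsetSum fun i _ => ((f i).contMDiff).pow 2
  let eq : Fin (Fintype.card (ι × Fin (Module.finrank ℝ F))) ≃ ι × Fin (Module.finrank ℝ F) :=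
    (Fintype.equivFin _).symm
  let S : ι × Fin (Module.finrank ℝ F) → Sections 𝓘(ℝ, E) F A := fun k =>
    ⟨(f k.1 : M → ℝ) • (e k.1).localFrame b k.2,
      ContMDiffOn.smul_section_of_tsupport ((f k.1).contMDiff.contMDiffOn)
        (e k.1).open_baseSet (hsub k.1) ((e k.1).contMDiffOn_localFrame_baseSet ∞ b k.2)⟩
  let σ : ι × Fin (Module.finrank ℝ F) → ∀ x, A x →ₗ[ℝ] ℝ := fun k x =>
    (f k.1 x / D x) • (b.coord k.2 ∘ₗ (e k.1).linearMapAt ℝ x)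
  refine ⟨_, ⟨⟨fun n => S (eq n), fun x => LinearMap.pi fun n => σ (eq n) x, ?_, ?_⟩⟩⟩
  · rw [contMDiff_pi_space]
    intro n p
    set k := eq n
    change ContMDiffAt _ _ ∞ (fun p : TotalSpace F A => σ k p.1 p.2) p
    have hproj : ContMDiff (𝓘(ℝ, E).prod 𝓘(ℝ, F)) 𝓘(ℝ, E) ∞
      (fun p : TotalSpace F A => p.proj) := contMDiff_proj A
    by_cases hp : p.1 ∈ tsupport (f k.1)
    · have hb : p.1 ∈ (e k.1).baseSet := hsub k.1 hp
      have h1 : ContMDiffAt (𝓘(ℝ, E).prod 𝓘(ℝ, F)) 𝓘(ℝ, ℝ) ∞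
          (fun p : TotalSpace F A => (f k.1 p.1 / D p.1) * b.coord k.2 (e k.1 p).2) p := by
        refine ContMDiffAt.mul ?_ ?_
        · exact (((f k.1).contMDiff.comp hproj).div₀ (hDs.comp hproj)
            fun q => (hDpos q.1).ne').contMDiffAt
        · have h2 : ContMDiffAt (𝓘(ℝ, E).prod 𝓘(ℝ, F)) (𝓘(ℝ, E).prod 𝓘(ℝ, F)) ∞ (e k.1) p :=
            (e k.1).contMDiffOn.contMDiffAt
              ((e k.1).open_source.mem_nhds ((e k.1).mem_source.2 hb))
          exact ContMDiffAt.comp p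
            ((LinearMap.toContinuousLinearMap (b.coord k.2)).contMDiff.contMDiffAt) h2.snd
      refine h1.congr_of_eventuallyEq ?_
      filter_upwards [(e k.1).open_source.mem_nhds ((e k.1).mem_source.2 hb)] with q hq
      simp only [σ, LinearMap.smul_apply, LinearMap.comp_apply, smul_eq_mul]
      rw [Trivialization.coe_linearMapAt_of_mem _ ((e k.1).mem_source.1 hq)]
    · refine (contMDiffAt_const (c := (0 : ℝ))).congr_of_eventuallyEq ?_
      have : (tsupport (f k.1))ᶜ ∈ 𝓝 p.1 := (isClosed_tsupport _).isOpen_compl.mem_nhds hp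
      filter_upwards [hproj.continuous.continuousAt.preimage_mem_nhds this] with q hq
      simp [σ, image_eq_zero_of_notMem_tsupport hq]
  · intro x v
    change ∑ n, σ (eq n) x v • S (eq n) x = v
    rw [Equiv.sum_comp eq (fun k => σ k x v • S k x), Fintype.sum_prod_type]
    have : ∀ i, ∑ m, σ (i, m) x v • S (i, m) x = (f i x ^ 2 / D x) • v := by
      intro i
      by_cases hx : x ∈ (e i).baseSet
      · have h1 : ∀ m, σ (i, m) x v • S (i, m) x =
            (f i x ^ 2 / D x) • ((e i).basisAt b hx).repr v m • (e i).basisAt b hx m := by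
          intro m
          change ((f i x / D x) * b.coord m ((e i).linearMapAt ℝ x v)) •
            (f i x • (e i).localFrame b m x) = _
          rw [(e i).localFrame_apply_of_mem_baseSet b hx,
            Trivialization.coe_linearMapAt_of_mem _ hx, smul_smul, smul_smul]
          congr 1
          simp only [Trivialization.basisAt, Module.Basis.map_repr, LinearEquiv.symm_symm,
            Module.Basis.coord_apply, LinearEquiv.trans_apply,
            Trivialization.linearEquivAt_apply]
          ring
        rw [Finset.sum_congr rfl fun m _ => h1 m, ← Finset.smul_sum, Module.Basis.sum_repr]
      · have : f i x = 0 := image_eq_zero_of_notMem_tsupport fun h => hx (hsub i h)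
        simp [σ, this]
    rw [Finset.sum_congr rfl fun i _ => this i, ← Finset.sum_smul, ← Finset.sum_div,
      div_self (hDpos x).ne', one_smul]

namespace Generators

variable {κ : Type*} [Fintype κ] (G : Generators E F A κ)

/-- The vector with given coefficients. -/
def comb (x : M) : (κ → ℝ) →ₗ[ℝ] A x := ∑ k, (LinearMap.proj k).smulRight (G.sec k x)

theorem comb_apply (x : M) (w : κ → ℝ) : G.comb x w = ∑ k, w k • G.sec k x := by
  simp [comb]

@[simp] theorem comb_coord (x : M) (v : A x) : G.comb x (G.coord x v) = v := by
  rw [comb_apply, G.sum_coord_smul]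

theorem coord_injective (x : M) : Function.Injective (G.coord x) :=
  Function.LeftInverse.injective (G.comb_coord x)

/-- The projection of `κ → ℝ` onto the coefficients of vectors in `A x`. -/
def proj (x : M) : (κ → ℝ) →L[ℝ] (κ → ℝ) :=
  LinearMap.toContinuousLinearMap (G.coord x ∘ₗ G.comb x)

theorem proj_apply (x : M) (w : κ → ℝ) : G.proj x w = G.coord x (G.comb x w) := rfl

@[simp] theorem proj_coord (x : M) (v : A x) : G.proj x (G.coord x v) = G.coord x v := by
  rw [proj_apply, comb_coord]

theorem proj_mul_proj (x : M) : G.proj x * G.proj x = G.proj x :=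
  ContinuousLinearMap.ext fun w => G.proj_coord x (G.comb x w)

section Smoothness

variable {E' : Type*} [NormedAddCommGroup E'] [NormedSpace ℝ E']
  {H' : Type*} [TopologicalSpace H'] {J : ModelWithCorners ℝ E' H'}
  {N : Type*} [TopologicalSpace N] [ChartedSpace H' N]

theorem contMDiff_coord_comp {g : N → M} {V : ∀ n, A (g n)}
    (hV : ContMDiff J (𝓘(ℝ, E).prod 𝓘(ℝ, F)) ∞ (fun n => (⟨g n, V n⟩ : TotalSpace F A))) :
    ContMDiff J 𝓘(ℝ, κ → ℝ) ∞ fun n => G.coord (g n) (V n) :=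
  G.contMDiff_coord.comp hV

/-- A map into the total space is smooth if its base and its coefficients are. -/
theorem contMDiff_comb [IsManifold 𝓘(ℝ, E) ∞ M] [ContMDiffVectorBundle ∞ F A 𝓘(ℝ, E)]
    {g : N → M} (hg : ContMDiff J 𝓘(ℝ, E) ∞ g) {c : N → κ → ℝ}
    (hc : ContMDiff J 𝓘(ℝ, κ → ℝ) ∞ c) :
    ContMDiff J (𝓘(ℝ, E).prod 𝓘(ℝ, F)) ∞
      (fun n => (⟨g n, G.comb (g n) (c n)⟩ : TotalSpace F A)) := by
  intro n
  rw [contMDiffAt_totalSpace]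
  refine ⟨hg n, ?_⟩
  set e := trivializationAt F A (g n) with he
  have hb : g n ∈ e.baseSet := mem_baseSet_trivializationAt F A (g n)
  have h1 : ContMDiffAt J 𝓘(ℝ, F) ∞
      (fun m => ∑ k, c m k • (e ⟨g m, G.sec k (g m)⟩).2) n := by
    refine contMDiffAt_finsetSum fun k _ => ?_
    have h2 : ContMDiffAt J (𝓘(ℝ, E).prod 𝓘(ℝ, F)) ∞
        (fun m => (⟨g m, G.sec k (g m)⟩ : TotalSpace F A)) n :=
      ((G.sec k).contMDiff.comp hg).contMDiffAt
    have h3 : ContMDiffAt J 𝓘(ℝ, ℝ) ∞ (fun m => c m k) n :=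
      (contMDiff_pi_space.1 hc k).contMDiffAt
    have h4 : ContMDiffAt J 𝓘(ℝ, F) ∞ (fun m => (e ⟨g m, G.sec k (g m)⟩).2) n :=
      (contMDiffAt_totalSpace.1 h2).2
    exact h3.smul h4
  refine h1.congr_of_eventuallyEq ?_
  filter_upwards [hg.continuous.continuousAt.preimage_mem_nhds (e.open_baseSet.mem_nhds hb)]
    with m hm
  have h3 : ∀ v : A (g m), (e ⟨g m, v⟩).2 = e.linearMapAt ℝ (g m) v := fun v => by
    rw [Trivialization.coe_linearMapAt_of_mem _ hm]
  change (e ⟨g m, G.comb (g m) (c m)⟩).2 = _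
  simp only [h3, G.comb_apply, map_sum, map_smul]

theorem contMDiff_iff_coord [IsManifold 𝓘(ℝ, E) ∞ M] [ContMDiffVectorBundle ∞ F A 𝓘(ℝ, E)]
    {g : N → M} (hg : ContMDiff J 𝓘(ℝ, E) ∞ g) {V : ∀ n, A (g n)} :
    ContMDiff J (𝓘(ℝ, E).prod 𝓘(ℝ, F)) ∞ (fun n => (⟨g n, V n⟩ : TotalSpace F A)) ↔
      ContMDiff J 𝓘(ℝ, κ → ℝ) ∞ fun n => G.coord (g n) (V n) := by
  refine ⟨G.contMDiff_coord_comp, fun h => (G.contMDiff_comb hg h).congr fun n => ?_⟩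
  rw [comb_coord]

/-- An operator on `κ → ℝ` is the sum of rank-one operators built from its values on the standard
basis. -/
theorem contMDiff_clm_of_apply {W : Type*} [NormedAddCommGroup W] [NormedSpace ℝ W]
    {T : N → (κ → ℝ) →L[ℝ] W}
    (hT : ∀ w, ContMDiff J 𝓘(ℝ, W) ∞ fun n => T n w) :
    ContMDiff J 𝓘(ℝ, (κ → ℝ) →L[ℝ] W) ∞ T := by
  classical
  have h : ContMDiff J 𝓘(ℝ, (κ → ℝ) →L[ℝ] W) ∞ fun n =>
      ∑ k, ContinuousLinearMap.smulRightL ℝ (κ → ℝ) W (ContinuousLinearMap.proj k)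
        (T n fun l => if k = l then 1 else 0) :=
    contMDiff_finsetSum fun k _ =>
      (ContinuousLinearMap.contMDiff _).comp (hT fun l => if k = l then 1 else 0)
  refine h.congr fun n => ContinuousLinearMap.ext fun w => ?_
  refine ((T n).toLinearMap.pi_apply_eq_sum_univ w).trans ?_
  simp

theorem contMDiff_proj [IsManifold 𝓘(ℝ, E) ∞ M] [ContMDiffVectorBundle ∞ F A 𝓘(ℝ, E)] :
    ContMDiff 𝓘(ℝ, E) 𝓘(ℝ, (κ → ℝ) →L[ℝ] (κ → ℝ)) ∞ G.proj :=
  contMDiff_clm_of_apply fun w =>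
    G.contMDiff_coord_comp (G.contMDiff_comb contMDiff_id (contMDiff_const (c := w)))

end Smoothness

variable [IsManifold 𝓘(ℝ, E) ∞ M] [ContMDiffVectorBundle ∞ F A 𝓘(ℝ, E)]

/-- The section with given coefficients. -/
def combSection (c : M → κ → ℝ) (hc : ContMDiff 𝓘(ℝ, E) 𝓘(ℝ, κ → ℝ) ∞ c) :
    Sections 𝓘(ℝ, E) F A :=
  ⟨fun x => G.comb x (c x), G.contMDiff_comb contMDiff_id hc⟩

theorem combSection_apply (c : M → κ → ℝ) (hc : ContMDiff 𝓘(ℝ, E) 𝓘(ℝ, κ → ℝ) ∞ c) (x : M) :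
    G.combSection c hc x = G.comb x (c x) := rfl

theorem contMDiff_coord_section (b : Sections 𝓘(ℝ, E) F A) :
    ContMDiff 𝓘(ℝ, E) 𝓘(ℝ, κ → ℝ) ∞ fun x => G.coord x (b x) :=
  G.contMDiff_coord_comp b.contMDiff

variable (L : LieAlgebroid 𝓘(ℝ, E) F A)

/-- The connection matrix of `[a, ·]` with respect to the generators. -/
def christoffel (a : Sections 𝓘(ℝ, E) F A) (x : M) : (κ → ℝ) →L[ℝ] (κ → ℝ) :=
  LinearMap.toContinuousLinearMap
    (∑ k, (LinearMap.proj k).smulRight (G.coord x (L.bracket a (G.sec k) x)))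

theorem christoffel_apply (a : Sections 𝓘(ℝ, E) F A) (x : M) (w : κ → ℝ) :
    G.christoffel L a x w = ∑ k, w k • G.coord x (L.bracket a (G.sec k) x) := by
  simp [christoffel]

/-- The bracket in terms of coefficients. -/
theorem coord_bracket (a b : Sections 𝓘(ℝ, E) F A) (x : M) :
    G.coord x (L.bracket a b x) = G.christoffel L a x (G.coord x (b x)) +
      G.proj x (dirDer (fun y => G.coord y (b y)) x (L.anchor.toFun x (a x))) := by
  have hs := G.contMDiff_coord_section b
  set c : κ → C^∞⟮𝓘(ℝ, E), M; ℝ⟯ := fun k =>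
    ⟨fun y => G.coord y (b y) k, contMDiff_pi_space.1 hs k⟩ with hc
  have hb : b = ∑ k, smulSection (c k) (G.sec k) := by
    ext y
    rw [sections_sum_apply]
    exact (G.sum_coord_smul y (b y)).symm
  have h1 : L.bracket a b x = ∑ k, (c k x • L.bracket a (G.sec k) x +
      dirDeriv (c k) x (L.anchor.toFun x (a x)) • G.sec k x) := by
    conv_lhs => rw [hb, map_sum, sections_sum_apply]
    exact Finset.sum_congr rfl fun k _ => L.leibniz a (G.sec k) (c k) x
  have h2 : ∀ k, dirDeriv (c k) x (L.anchor.toFun x (a x)) =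
      dirDer (fun y => G.coord y (b y)) x (L.anchor.toFun x (a x)) k := fun k =>
    dirDer_clm_comp (ContinuousLinearMap.proj (R := ℝ) (φ := fun _ : κ => ℝ) k)
      (hs.mdifferentiableAt (x := x) (by simp)) _
  rw [h1, Finset.sum_add_distrib, map_add, proj_apply, comb_apply, christoffel_apply, map_sum]
  simp only [map_smul, h2]
  rfl

/-- The derivative of coefficients of a section in terms of the bracket. -/
theorem proj_dirDer_coord (b : Sections 𝓘(ℝ, E) F A) (x : M) (v : TangentSpace 𝓘(ℝ, E) x) :
    dirDer (fun y => G.coord y (b y)) x v =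
      G.proj x (dirDer (fun y => G.coord y (b y)) x v) + dirDer G.proj x v (G.coord x (b x)) := by
  -- Differentiate the identity `P c = c` satisfied by the coefficients `c` of a section.
  have h := dirDer_clm_apply (f := G.proj) (g := fun y => G.coord y (b y)) (x := x)
    (G.contMDiff_proj.mdifferentiableAt (by simp))
    ((G.contMDiff_coord_section b).mdifferentiableAt (by simp)) v
  simpa only [proj_coord] using h

theorem proj_mul_christoffel (a : Sections 𝓘(ℝ, E) F A) (x : M) :
    G.proj x * G.christoffel L a x = G.christoffel L a x := by
  refine ContinuousLinearMap.ext fun w => ?_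
  change G.proj x (G.christoffel L a x w) = _
  simp only [christoffel_apply, map_sum, map_smul, proj_coord]

/-- Differentiating `P² = P` gives `D = P D + D P`; multiplying by `P` on both sides gives `P D P =
2 P D P`. -/
theorem proj_mul_dirDer_mul_proj (x : M) (v : TangentSpace 𝓘(ℝ, E) x) :
    G.proj x * dirDer G.proj x v * G.proj x = 0 := by
  have hP := G.contMDiff_proj.mdifferentiableAt (x := x) (by simp)
  have h := dirDer_bilinear (ContinuousLinearMap.mul ℝ ((κ → ℝ) →L[ℝ] (κ → ℝ))) hP hP v
  have e : (fun y => ContinuousLinearMap.mul ℝ ((κ → ℝ) →L[ℝ] (κ → ℝ)) (G.proj y) (G.proj y)) =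
      G.proj := funext fun y => G.proj_mul_proj y
  rw [e] at h
  simp only [ContinuousLinearMap.mul_apply'] at h
  set P := G.proj x
  set D : (κ → ℝ) →L[ℝ] (κ → ℝ) := dirDer G.proj x v
  have hP2 : P * P = P := G.proj_mul_proj x
  have h3 : P * D * P = P * D * P + P * D * P := by
    calc P * D * P = P * (P * D + D * P) * P := by rw [← h]
      _ = (P * P) * D * P + P * D * (P * P) := by noncomm_ring
      _ = _ := by rw [hP2]
  simpa using h3

end Generators

end SmoothFlow

/-! ### Smooth families of sections and their product rules -/

namespace SmoothFlow

open Topology Filter NNReal Algebroid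

variable {E : Type*} [NormedAddCommGroup E] [NormedSpace ℝ E]
  {M : Type*} [TopologicalSpace M] [ChartedSpace E M]
  {F : Type*} [NormedAddCommGroup F] [NormedSpace ℝ F]
  {A : M → Type*} [∀ x, AddCommGroup (A x)] [∀ x, Module ℝ (A x)]
  [TopologicalSpace (TotalSpace F A)] [∀ x, TopologicalSpace (A x)] [FiberBundle F A]
  [VectorBundle ℝ F A]

/-- A family of sections that is jointly smooth in time and space. -/
def IsSmoothFamily (e : ℝ → Sections 𝓘(ℝ, E) F A) : Prop :=
  ContMDiff (𝓘(ℝ, ℝ).prod 𝓘(ℝ, E)) (𝓘(ℝ, E).prod 𝓘(ℝ, F)) ∞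
    (fun p : ℝ × M => (⟨p.2, e p.1 p.2⟩ : TotalSpace F A))

/-- A family of bundle endomorphisms that is jointly smooth. -/
def IsSmoothEndFamily (j : ℝ → BundleMap 𝓘(ℝ, E) F A F A) : Prop :=
  ContMDiff (𝓘(ℝ, ℝ).prod (𝓘(ℝ, E).prod 𝓘(ℝ, F))) (𝓘(ℝ, E).prod 𝓘(ℝ, F)) ∞
    (fun p : ℝ × TotalSpace F A => (⟨p.2.1, (j p.1).toFun p.2.1 p.2.2⟩ : TotalSpace F A))

theorem isSmoothFamily_const (b : Sections 𝓘(ℝ, E) F A) : IsSmoothFamily fun _ => b :=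
  b.contMDiff.comp contMDiff_snd

theorem IsSmoothEndFamily.onSections {j : ℝ → BundleMap 𝓘(ℝ, E) F A F A}
    (hj : IsSmoothEndFamily j) {e : ℝ → Sections 𝓘(ℝ, E) F A} (he : IsSmoothFamily e) :
    IsSmoothFamily fun t => (j t).onSections (e t) :=
  hj.comp (contMDiff_fst.prodMk he)

theorem lieBracket_neg_swap [IsManifold 𝓘(ℝ, E) ∞ M] (L : LieAlgebroid 𝓘(ℝ, E) F A)
    (a b : Sections 𝓘(ℝ, E) F A) : L.bracket a b = -L.bracket b a := by
  have h := L.bracket_self (a + b)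
  simp only [map_add, LinearMap.add_apply, L.bracket_self, zero_add, add_zero] at h
  rw [eq_neg_iff_add_eq_zero, add_comm, h]

namespace Generators

variable {κ : Type*} [Fintype κ] (G : Generators E F A κ)

/-- The derivative in time of a family of sections, pointwise. -/
def IsDeriv (e e' : ℝ → Sections 𝓘(ℝ, E) F A) : Prop :=
  ∀ t x, HasDerivAt (fun t => G.coord x (e t x)) (G.coord x (e' t x)) t

theorem contMDiff_coord_family {e : ℝ → Sections 𝓘(ℝ, E) F A} (he : IsSmoothFamily e) :
    ContMDiff (𝓘(ℝ, ℝ).prod 𝓘(ℝ, E)) 𝓘(ℝ, κ → ℝ) ∞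
      fun p : ℝ × M => G.coord p.2 (e p.1 p.2) :=
  G.contMDiff_coord_comp he

theorem IsDeriv.timeDer_eq {G : Generators E F A κ} {e e' : ℝ → Sections 𝓘(ℝ, E) F A}
    (h : G.IsDeriv e e') :
    timeDer (fun p : ℝ × M => G.coord p.2 (e p.1 p.2)) =
      fun p : ℝ × M => G.coord p.2 (e' p.1 p.2) :=
  funext fun p => (h p.1 p.2).deriv

variable [IsManifold 𝓘(ℝ, E) ∞ M] [ContMDiffVectorBundle ∞ F A 𝓘(ℝ, E)]

theorem isSmoothFamily_iff {e : ℝ → Sections 𝓘(ℝ, E) F A} :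
    IsSmoothFamily e ↔ ContMDiff (𝓘(ℝ, ℝ).prod 𝓘(ℝ, E)) 𝓘(ℝ, κ → ℝ) ∞
      fun p : ℝ × M => G.coord p.2 (e p.1 p.2) :=
  G.contMDiff_iff_coord contMDiff_snd

/-- The projection `G.proj x` does not depend on time, so it fixes the time derivative of the
coefficients, which are therefore the coefficients of a section. -/
theorem exists_isDeriv {e : ℝ → Sections 𝓘(ℝ, E) F A} (he : IsSmoothFamily e) :
    ∃ e' : ℝ → Sections 𝓘(ℝ, E) F A, IsSmoothFamily e' ∧ G.IsDeriv e e' := by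
  set c := fun p : ℝ × M => G.coord p.2 (e p.1 p.2) with hc
  have hcs := G.contMDiff_coord_family he
  have hct := contMDiff_timeDer hcs
  have hP : ∀ p : ℝ × M, G.proj p.2 (timeDer c p) = timeDer c p := by
    rintro ⟨t, x⟩
    have h1 := hasDerivAt_timeDer hcs t x
    have h2 : HasDerivAt (fun t => G.proj x (c (t, x))) (G.proj x (timeDer c (t, x))) t :=
      (G.proj x).hasFDerivAt.comp_hasDerivAt t h1
    simp only [hc, proj_coord] at h2
    exact h2.unique h1
  refine ⟨fun t => G.combSection (fun x => timeDer c (t, x))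
    (hct.comp (contMDiff_const.prodMk contMDiff_id)), ?_, fun t x => ?_⟩
  · exact G.contMDiff_comb contMDiff_snd hct
  · have := hasDerivAt_timeDer hcs t x
    rw [combSection_apply, ← proj_apply, hP (t, x)]
    exact this

theorem hasDerivAt_dirDer_coord {e e' : ℝ → Sections 𝓘(ℝ, E) F A} (he : IsSmoothFamily e)
    (h : G.IsDeriv e e') (t : ℝ) (x : M) (v : TangentSpace 𝓘(ℝ, E) x) :
    HasDerivAt (fun t => dirDer (fun y => G.coord y (e t y)) x v)
      (dirDer (fun y => G.coord y (e' t y)) x v) t := by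
  have := hasDerivAt_spaceDer (G.contMDiff_coord_family he) t x v
  rwa [h.timeDer_eq] at this

variable (L : LieAlgebroid 𝓘(ℝ, E) F A)

theorem contMDiff_anchor (a : Sections 𝓘(ℝ, E) F A) :
    ContMDiff 𝓘(ℝ, E) 𝓘(ℝ, E).tangent ∞
      (fun x => (⟨x, L.anchor.toFun x (a x)⟩ : TangentBundle 𝓘(ℝ, E) M)) :=
  L.anchor.smooth.comp a.contMDiff

theorem contMDiff_christoffel (a : Sections 𝓘(ℝ, E) F A) :
    ContMDiff 𝓘(ℝ, E) 𝓘(ℝ, (κ → ℝ) →L[ℝ] (κ → ℝ)) ∞ (G.christoffel L a) := by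
  refine contMDiff_clm_of_apply fun w => ?_
  simp only [christoffel_apply]
  refine contMDiff_finsetSum fun k _ => ?_
  have h : ContMDiff 𝓘(ℝ, E) 𝓘(ℝ, ℝ) ∞ fun _ : M => w k := contMDiff_const
  exact h.smul (G.contMDiff_coord_section (L.bracket a (G.sec k)))

theorem isSmoothFamily_bracket_const {κ : Type*} [Fintype κ] (G : Generators E F A κ)
    (L : LieAlgebroid 𝓘(ℝ, E) F A) (a : Sections 𝓘(ℝ, E) F A)
    {e : ℝ → Sections 𝓘(ℝ, E) F A} (he : IsSmoothFamily e) :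
    IsSmoothFamily fun t => L.bracket a (e t) := by
  rw [G.isSmoothFamily_iff]
  simp only [G.coord_bracket]
  have h1 := G.contMDiff_coord_family he
  have h2 := contMDiff_spaceDer h1 (contMDiff_anchor L a)
  have h3 : ContMDiff (𝓘(ℝ, ℝ).prod 𝓘(ℝ, E)) 𝓘(ℝ, (κ → ℝ) →L[ℝ] (κ → ℝ)) ∞
      fun p : ℝ × M => G.christoffel L a p.2 := (G.contMDiff_christoffel L a).comp contMDiff_snd
  have h4 : ContMDiff (𝓘(ℝ, ℝ).prod 𝓘(ℝ, E)) 𝓘(ℝ, (κ → ℝ) →L[ℝ] (κ → ℝ)) ∞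
      fun p : ℝ × M => G.proj p.2 := G.contMDiff_proj.comp contMDiff_snd
  exact (h3.clm_apply h1).add (h4.clm_apply h2)

theorem isDeriv_bracket_const (a : Sections 𝓘(ℝ, E) F A)
    {e e' : ℝ → Sections 𝓘(ℝ, E) F A} (he : IsSmoothFamily e) (h : G.IsDeriv e e') :
    G.IsDeriv (fun t => L.bracket a (e t)) fun t => L.bracket a (e' t) := by
  intro t x
  simp only [G.coord_bracket]
  exact ((G.christoffel L a x).hasFDerivAt.comp_hasDerivAt t (h t x)).add
    ((G.proj x).hasFDerivAt.comp_hasDerivAt t (G.hasDerivAt_dirDer_coord he h t x _))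

/-- In `coord_bracket` the first argument enters through its brackets with the generators. Here only
brackets of `c` with the fixed sections `G.sec k` and derivatives along the fixed fields `ρ (G.sec
k)` occur, which reduces families with both arguments varying to the case of a constant first
argument. -/
theorem coord_bracket_expand (b c : Sections 𝓘(ℝ, E) F A) (x : M) :
    G.coord x (L.bracket b c x) = ∑ k, G.coord x (b x) k • G.coord x (L.bracket (G.sec k) c x) -
      ∑ k, G.coord x (c x) k •
        G.proj x (dirDer (fun y => G.coord y (b y)) x (L.anchor.toFun x (G.sec k x))) := by
  have h1 : L.bracket b c x = -L.bracket c b x := by rw [lieBracket_neg_swap]; rfl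
  have h2 : ∀ k, L.bracket c (G.sec k) x = -L.bracket (G.sec k) c x := fun k => by
    rw [lieBracket_neg_swap]; rfl
  have h3 : ∑ k, G.coord x (c x) k • dirDer (fun y => G.coord y (b y)) x
      (L.anchor.toFun x (G.sec k x)) =
      dirDer (fun y => G.coord y (b y)) x (L.anchor.toFun x (c x)) := by
    conv_rhs => rw [← G.sum_coord_smul x (c x)]
    simp only [map_sum, map_smul, dirDer_sum_smul]
  rw [h1, map_neg, coord_bracket, christoffel_apply, ← h3, map_sum]
  simp only [h2, map_neg, map_smul, smul_neg, Finset.sum_neg_distrib]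
  abel

theorem isSmoothFamily_bracket {κ : Type*} [Fintype κ] (G : Generators E F A κ)
    (L : LieAlgebroid 𝓘(ℝ, E) F A) {b c : ℝ → Sections 𝓘(ℝ, E) F A} (hb : IsSmoothFamily b)
    (hc : IsSmoothFamily c) : IsSmoothFamily fun t => L.bracket (b t) (c t) := by
  have key : ∀ t x, _ := fun t x => G.coord_bracket_expand L (b t) (c t) x
  rw [G.isSmoothFamily_iff]
  simp only [key]
  have hb1 := G.contMDiff_coord_family hb
  have hc1 := G.contMDiff_coord_family hc
  have h4 : ContMDiff (𝓘(ℝ, ℝ).prod 𝓘(ℝ, E)) 𝓘(ℝ, (κ → ℝ) →L[ℝ] (κ → ℝ)) ∞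
      fun p : ℝ × M => G.proj p.2 := G.contMDiff_proj.comp contMDiff_snd
  refine (contMDiff_finsetSum fun k _ => ?_).sub (contMDiff_finsetSum fun k _ => ?_)
  · exact (contMDiff_pi_space.1 hb1 k).smul
      (G.contMDiff_coord_family (G.isSmoothFamily_bracket_const L (G.sec k) hc))
  · exact (contMDiff_pi_space.1 hc1 k).smul
      (h4.clm_apply (contMDiff_spaceDer hb1 (contMDiff_anchor L (G.sec k))))

/-- The bracket satisfies the product rule for derivatives of families of sections. -/
theorem isDeriv_bracket {b b' c c' : ℝ → Sections 𝓘(ℝ, E) F A} (hb : IsSmoothFamily b)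
    (hc : IsSmoothFamily c) (hb' : G.IsDeriv b b') (hc' : G.IsDeriv c c') :
    G.IsDeriv (fun t => L.bracket (b t) (c t))
      fun t => L.bracket (b' t) (c t) + L.bracket (b t) (c' t) := by
  intro t x
  change HasDerivAt _ (G.coord x (L.bracket (b' t) (c t) x + L.bracket (b t) (c' t) x)) t
  have key : ∀ t, _ := fun t => G.coord_bracket_expand L (b t) (c t) x
  rw [map_add, G.coord_bracket_expand L (b' t) (c t), G.coord_bracket_expand L (b t) (c' t)]
  simp only [key]
  have hbk : ∀ k, HasDerivAt (fun t => G.coord x (b t x) k) (G.coord x (b' t x) k) t :=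
    fun k => hasDerivAt_pi.1 (hb' t x) k
  have hck : ∀ k, HasDerivAt (fun t => G.coord x (c t x) k) (G.coord x (c' t x) k) t :=
    fun k => hasDerivAt_pi.1 (hc' t x) k
  have h1 := HasDerivAt.fun_sum (u := Finset.univ) fun k _ =>
    (hbk k).fun_smul (G.isDeriv_bracket_const L (G.sec k) hc hc' t x)
  have h2 := HasDerivAt.fun_sum (u := Finset.univ) fun k _ =>
    (hck k).fun_smul ((G.proj x).hasFDerivAt.comp_hasDerivAt t
      (G.hasDerivAt_dirDer_coord hb hb' t x (L.anchor.toFun x (G.sec k x))))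
  refine (h1.sub h2).congr_deriv ?_
  simp only [Finset.sum_add_distrib, Function.comp_apply]
  abel

/-- The matrix of a bundle endomorphism with respect to the generators. -/
def endMatrix (j : BundleMap 𝓘(ℝ, E) F A F A) (x : M) : (κ → ℝ) →L[ℝ] (κ → ℝ) :=
  LinearMap.toContinuousLinearMap (G.coord x ∘ₗ (j.toFun x).toLinearMap ∘ₗ G.comb x)

theorem endMatrix_apply (j : BundleMap 𝓘(ℝ, E) F A F A) (x : M) (w : κ → ℝ) :
    G.endMatrix j x w = G.coord x (j.toFun x (G.comb x w)) := rfl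

/-- Product rule for a family of endomorphisms applied to a family of sections. -/
theorem isDeriv_onSections {j : ℝ → BundleMap 𝓘(ℝ, E) F A F A} (hj : IsSmoothEndFamily j)
    {e e' : ℝ → Sections 𝓘(ℝ, E) F A} (h : G.IsDeriv e e')
    {D : ℝ → Sections 𝓘(ℝ, E) F A → Sections 𝓘(ℝ, E) F A}
    (hD : ∀ b, G.IsDeriv (fun t => (j t).onSections b) fun t => D t b) :
    G.IsDeriv (fun t => (j t).onSections (e t))
      fun t => (j t).onSections (e' t) + D t (e t) := by
  have hm : ContMDiff (𝓘(ℝ, ℝ).prod 𝓘(ℝ, E)) 𝓘(ℝ, (κ → ℝ) →L[ℝ] (κ → ℝ)) ∞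
      fun p : ℝ × M => G.endMatrix (j p.1) p.2 := by
    refine contMDiff_clm_of_apply fun w => ?_
    have h1 : ContMDiff (𝓘(ℝ, ℝ).prod 𝓘(ℝ, E)) (𝓘(ℝ, E).prod 𝓘(ℝ, F)) ∞
        fun p : ℝ × M => (⟨p.2, G.comb p.2 w⟩ : TotalSpace F A) :=
      G.contMDiff_comb contMDiff_snd contMDiff_const
    exact G.contMDiff_coord.comp (hj.comp (contMDiff_fst.prodMk h1))
  have hap : ∀ t x (v : A x), G.endMatrix (j t) x (G.coord x v) = G.coord x ((j t).toFun x v) :=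
    fun t x v => by rw [endMatrix_apply, comb_coord]
  intro t x
  have h1 := hasDerivAt_timeDer hm t x
  -- Freezing the section at time `t` identifies the derivative of the matrix of `j` with the
  -- prescribed derivative `D t` at that section.
  have h2 : timeDer (fun p : ℝ × M => G.endMatrix (j p.1) p.2) (t, x) (G.coord x (e t x)) =
      G.coord x (D t (e t) x) := by
    have h3 := h1.clm_apply (hasDerivAt_const t (G.coord x (e t x)))
    simp only [hap, map_zero, add_zero] at h3
    exact h3.unique (hD (e t) t x)
  have h3 := h1.clm_apply (h t x)
  simp only [hap, h2] at h3
  refine h3.congr_deriv ?_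
  change _ = G.coord x ((j t).toFun x (e' t x) + D t (e t) x)
  rw [map_add, add_comm]

end Generators

end SmoothFlow

/-! ### Parallel transport along the flow of a time-dependent section -/

namespace SmoothFlow

open Topology Filter NNReal Algebroid

variable {E : Type*} [NormedAddCommGroup E] [NormedSpace ℝ E]
  {M : Type*} [TopologicalSpace M] [ChartedSpace E M]
  {F : Type*} [NormedAddCommGroup F] [NormedSpace ℝ F]
  {A : M → Type*} [∀ x, AddCommGroup (A x)] [∀ x, Module ℝ (A x)]
  [TopologicalSpace (TotalSpace F A)] [∀ x, TopologicalSpace (A x)] [FiberBundle F A]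
  [VectorBundle ℝ F A]
  [IsManifold 𝓘(ℝ, E) ∞ M] [ContMDiffVectorBundle ∞ F A 𝓘(ℝ, E)]
  {κ : Type*} [Fintype κ]

/-- The flow of a time-dependent section `a` on `A`, in terms of generators: `base t` is the flow
of `-ρ(a)` on `M`, with inverse `baseInv t`, and `mat (t, x)` is the matrix of the transport
`A (base t x) → A x`, with inverse `matInv (t, x)`. -/
structure Transport (G : Generators E F A κ) (L : LieAlgebroid 𝓘(ℝ, E) F A)
    (a : ℝ → Sections 𝓘(ℝ, E) F A) where
  base : ℝ → M → M
  baseInv : ℝ → M → M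
  mat : ℝ × M → (κ → ℝ) →L[ℝ] (κ → ℝ)
  matInv : ℝ × M → (κ → ℝ) →L[ℝ] (κ → ℝ)
  contMDiff_base : ContMDiff (𝓘(ℝ, ℝ).prod 𝓘(ℝ, E)) 𝓘(ℝ, E) ∞ fun p : ℝ × M => base p.1 p.2
  contMDiff_baseInv : ContMDiff (𝓘(ℝ, ℝ).prod 𝓘(ℝ, E)) 𝓘(ℝ, E) ∞
    fun p : ℝ × M => baseInv p.1 p.2
  contMDiff_mat : ContMDiff (𝓘(ℝ, ℝ).prod 𝓘(ℝ, E)) 𝓘(ℝ, (κ → ℝ) →L[ℝ] (κ → ℝ)) ∞ mat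
  contMDiff_matInv : ContMDiff (𝓘(ℝ, ℝ).prod 𝓘(ℝ, E)) 𝓘(ℝ, (κ → ℝ) →L[ℝ] (κ → ℝ)) ∞ matInv
  base_baseInv : ∀ t y, base t (baseInv t y) = y
  baseInv_base : ∀ t x, baseInv t (base t x) = x
  base_zero : ∀ x, base 0 x = x
  mat_zero : ∀ x, mat (0, x) = 1
  mat_mul_matInv : ∀ p, mat p * matInv p = 1
  matInv_mul_mat : ∀ p, matInv p * mat p = 1
  mat_mul_proj : ∀ t x, mat (t, x) * G.proj (base t x) = G.proj x * mat (t, x)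
  hasDerivAt : ∀ {e e' : ℝ → Sections 𝓘(ℝ, E) F A}, IsSmoothFamily e → G.IsDeriv e e' →
    ∀ t x, HasDerivAt (fun t => mat (t, x) (G.coord (base t x) (e t (base t x))))
      (mat (t, x) (G.coord (base t x) ((e' t - L.bracket (a t) (e t)) (base t x)))) t

namespace Transport

variable {G : Generators E F A κ} {L : LieAlgebroid 𝓘(ℝ, E) F A}
  {a : ℝ → Sections 𝓘(ℝ, E) F A}

theorem dirDer_proj_anchor (G : Generators E F A κ) (L : LieAlgebroid 𝓘(ℝ, E) F A) (x : M)
    (v : A x) : dirDer G.proj x (L.anchor.toFun x v) =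
      ∑ k, G.coord x v k • dirDer G.proj x (L.anchor.toFun x (G.sec k x)) := by
  conv_lhs => rw [← G.sum_coord_smul x v]
  simp only [map_sum, map_smul, dirDer_sum_smul]

/-- The generator of the transport matrices. -/
def generator (G : Generators E F A κ) (L : LieAlgebroid 𝓘(ℝ, E) F A)
    (a : Sections 𝓘(ℝ, E) F A) (x : M) : (κ → ℝ) →L[ℝ] (κ → ℝ) :=
  let D : (κ → ℝ) →L[ℝ] (κ → ℝ) := dirDer G.proj x (L.anchor.toFun x (a x))
  D * G.proj x - G.proj x * D - G.christoffel L a x * G.proj x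

theorem contMDiff_generator (G : Generators E F A κ) (L : LieAlgebroid 𝓘(ℝ, E) F A)
    (ha : IsSmoothFamily a) :
    ContMDiff (𝓘(ℝ, ℝ).prod 𝓘(ℝ, E)) 𝓘(ℝ, (κ → ℝ) →L[ℝ] (κ → ℝ)) ∞
      fun p : ℝ × M => generator G L (a p.1) p.2 := by
  have hP : ContMDiff (𝓘(ℝ, ℝ).prod 𝓘(ℝ, E)) 𝓘(ℝ, (κ → ℝ) →L[ℝ] (κ → ℝ)) ∞
      fun p : ℝ × M => G.proj p.2 := G.contMDiff_proj.comp contMDiff_snd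
  have hD : ContMDiff (𝓘(ℝ, ℝ).prod 𝓘(ℝ, E)) 𝓘(ℝ, (κ → ℝ) →L[ℝ] (κ → ℝ)) ∞
      fun p : ℝ × M => dirDer G.proj p.2 (L.anchor.toFun p.2 (a p.1 p.2)) := by
    have key : ∀ p : ℝ × M, _ := fun p => dirDer_proj_anchor G L p.2 (a p.1 p.2)
    simp only [key]
    refine contMDiff_finsetSum fun k _ => ?_
    exact (contMDiff_pi_space.1 (G.contMDiff_coord_family ha) k).smul
      (contMDiff_spaceDer hP (Generators.contMDiff_anchor L (G.sec k)))
  have hΓ : ContMDiff (𝓘(ℝ, ℝ).prod 𝓘(ℝ, E)) 𝓘(ℝ, (κ → ℝ) →L[ℝ] (κ → ℝ)) ∞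
      fun p : ℝ × M => G.christoffel L (a p.1) p.2 := by
    refine Generators.contMDiff_clm_of_apply fun w => ?_
    simp only [Generators.christoffel_apply]
    refine contMDiff_finsetSum fun k _ => ?_
    have h : ContMDiff (𝓘(ℝ, ℝ).prod 𝓘(ℝ, E)) 𝓘(ℝ, ℝ) ∞ fun _ : ℝ × M => w k := contMDiff_const
    exact h.smul (G.contMDiff_coord_family
      (G.isSmoothFamily_bracket L ha (isSmoothFamily_const (G.sec k))))
  exact ((hD.clm_comp hP).sub (hP.clm_comp hD)).sub (hΓ.clm_comp hP)

theorem generator_zero (G : Generators E F A κ) (L : LieAlgebroid 𝓘(ℝ, E) F A) (x : M) :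
    generator G L 0 x = 0 := by
  have h1 : dirDer G.proj x (L.anchor.toFun x ((0 : Sections 𝓘(ℝ, E) F A) x)) = 0 :=
    (congr_arg (dirDer G.proj x) (map_zero (L.anchor.toFun x))).trans (dirDer_zero _ _)
  have h2 : G.christoffel L 0 x = 0 := by
    refine ContinuousLinearMap.ext fun w => ?_
    rw [Generators.christoffel_apply]
    refine Finset.sum_eq_zero fun k _ => ?_
    rw [map_zero]
    exact (congr_arg (w k • ·) (map_zero (G.coord x))).trans (smul_zero _)
  simp only [generator, h1, h2, zero_mul, mul_zero, sub_zero]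

/-- The term `P D P` vanishes, so on coefficients of actual vectors the generator acts as `D - Γ`,
the matrix that appears when a section is differentiated along the base flow. -/
theorem generator_mul_proj (G : Generators E F A κ) (L : LieAlgebroid 𝓘(ℝ, E) F A)
    (a : Sections 𝓘(ℝ, E) F A) (x : M) :
    generator G L a x * G.proj x =
      (dirDer G.proj x (L.anchor.toFun x (a x)) - G.christoffel L a x) * G.proj x := by
  have h1 := G.proj_mul_dirDer_mul_proj x (L.anchor.toFun x (a x))
  have h2 := G.proj_mul_proj x
  simp only [generator]
  set D : (κ → ℝ) →L[ℝ] (κ → ℝ) := dirDer G.proj x (L.anchor.toFun x (a x))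
  rw [sub_mul, sub_mul, mul_assoc D, mul_assoc (G.christoffel L a x), h2, h1, sub_zero, sub_mul]

/-- The part `D P - P D` of the generator is there for this identity: it lets the transport matrices
follow the moving projection, using `P D P = 0`, `D = P D + D P` and `P Γ = Γ`. -/
theorem generator_commutator (G : Generators E F A κ) (L : LieAlgebroid 𝓘(ℝ, E) F A)
    (a : Sections 𝓘(ℝ, E) F A) (x : M) :
    generator G L a x * G.proj x - G.proj x * generator G L a x =
      dirDer G.proj x (L.anchor.toFun x (a x)) := by
  have h1 := G.proj_mul_dirDer_mul_proj x (L.anchor.toFun x (a x))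
  have h2 := G.proj_mul_proj x
  have h3 := G.proj_mul_christoffel L a x
  have h4 : dirDer G.proj x (L.anchor.toFun x (a x)) =
      G.proj x * dirDer G.proj x (L.anchor.toFun x (a x)) +
        dirDer G.proj x (L.anchor.toFun x (a x)) * G.proj x := by
    have hP := G.contMDiff_proj.mdifferentiableAt (x := x) (by simp)
    have h := dirDer_bilinear (ContinuousLinearMap.mul ℝ ((κ → ℝ) →L[ℝ] (κ → ℝ))) hP hP
      (L.anchor.toFun x (a x))
    have e : (fun y => ContinuousLinearMap.mul ℝ ((κ → ℝ) →L[ℝ] (κ → ℝ)) (G.proj y)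
        (G.proj y)) = G.proj := funext fun y => G.proj_mul_proj y
    rwa [e] at h
  rw [generator_mul_proj]
  simp only [generator]
  set D : (κ → ℝ) →L[ℝ] (κ → ℝ) := dirDer G.proj x (L.anchor.toFun x (a x))
  rw [mul_sub, mul_sub, ← mul_assoc, ← mul_assoc, ← mul_assoc, h1, h2, h3, sub_mul]
  conv_rhs => rw [h4]
  abel

theorem _root_.SmoothFlow.IsSmoothFamily.neg (G : Generators E F A κ)
    (ha : IsSmoothFamily a) : IsSmoothFamily fun t => -a t := by
  rw [G.isSmoothFamily_iff]
  refine (G.contMDiff_coord_family ha).neg.congr fun p => ?_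
  exact map_neg (G.coord p.2) (a p.1 p.2)

theorem anchor_neg (L : LieAlgebroid 𝓘(ℝ, E) F A) (a : Sections 𝓘(ℝ, E) F A) (x : M) :
    L.anchor.toFun x ((-a) x) = -L.anchor.toFun x (a x) := map_neg (L.anchor.toFun x) (a x)

attribute [irreducible] generator

section AlongCurve

variable (G L) {β : ℝ → M} {t : ℝ}

theorem hasDerivAt_proj_along
    (hβ : HasMFDerivAt 𝓘(ℝ, ℝ) (𝓘(ℝ, ℝ).prod 𝓘(ℝ, E)) (fun t => (t, β t)) t
      ((1 : ℝ →L[ℝ] ℝ).smulRight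
        (suspension (fun t x => L.anchor.toFun x ((-a t) x)) (t, β t)))) :
    HasDerivAt (fun t => G.proj (β t))
      (-dirDer G.proj (β t) (L.anchor.toFun _ (a t (β t)))) t := by
  have hPs : ContMDiff (𝓘(ℝ, ℝ).prod 𝓘(ℝ, E)) 𝓘(ℝ, (κ → ℝ) →L[ℝ] (κ → ℝ)) ∞
      fun p : ℝ × M => G.proj p.2 := G.contMDiff_proj.comp contMDiff_snd
  refine (hasDerivAt_along_curve hPs hβ).congr_deriv ?_
  have h1 : timeDer (fun p : ℝ × M => G.proj p.2) (t, β t) = 0 :=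
    deriv_const t (G.proj (β t))
  rw [h1, zero_add, anchor_neg, dirDer_neg]

/-- The base curve follows `-ρ(a)`. The derivative of the coefficients along `ρ(a)` splits into a
`P`-part, which together with `Γ` gives the bracket, and a `D`-part; the left-over `D - Γ` is the
generator. The equation `U' = U * generator` will cancel this term. -/
theorem hasDerivAt_coord_along {e e' : ℝ → Sections 𝓘(ℝ, E) F A} (he : IsSmoothFamily e)
    (hd : G.IsDeriv e e')
    (hβ : HasMFDerivAt 𝓘(ℝ, ℝ) (𝓘(ℝ, ℝ).prod 𝓘(ℝ, E)) (fun t => (t, β t)) t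
      ((1 : ℝ →L[ℝ] ℝ).smulRight
        (suspension (fun t x => L.anchor.toFun x ((-a t) x)) (t, β t)))) :
    HasDerivAt (fun t => G.coord (β t) (e t (β t)))
      (G.coord (β t) ((e' t - L.bracket (a t) (e t)) (β t)) -
        generator G L (a t) (β t) (G.coord (β t) (e t (β t)))) t := by
  have h1 := hasDerivAt_along_curve (G.contMDiff_coord_family he) hβ
  rw [hd.timeDer_eq] at h1
  refine h1.congr_deriv ?_
  let D : (κ → ℝ) →L[ℝ] (κ → ℝ) := dirDer G.proj (β t) (L.anchor.toFun _ (a t (β t)))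
  have h3 : generator G L (a t) (β t) (G.coord (β t) (e t (β t))) =
      D (G.coord (β t) (e t (β t))) -
        G.christoffel L (a t) (β t) (G.coord (β t) (e t (β t))) := by
    have h := DFunLike.congr_fun (generator_mul_proj G L (a t) (β t))
      (G.coord (β t) (e t (β t)))
    change generator G L (a t) (β t) (G.proj _ _) =
      D (G.proj _ _) - G.christoffel L (a t) (β t) (G.proj _ _) at h
    rwa [G.proj_coord] at h
  have h4 : (e' t - L.bracket (a t) (e t)) (β t) =
    e' t (β t) - L.bracket (a t) (e t) (β t) := rfl
  dsimp only
  rw [h3, h4, anchor_neg, dirDer_neg, G.proj_dirDer_coord, map_sub, G.coord_bracket]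
  change _ + -(_ + D _) = _
  abel

end AlongCurve

theorem hasMFDerivAt_start_zero {X : ℝ → (x : M) → TangentSpace 𝓘(ℝ, E) x}
    {ψ : ℝ → ℝ → M → M}
    (hψ : ∀ t s x, HasMFDerivAt 𝓘(ℝ, ℝ) (𝓘(ℝ, ℝ).prod 𝓘(ℝ, E)) (fun t => (s + t, ψ t s x)) t
      ((1 : ℝ →L[ℝ] ℝ).smulRight (suspension X (s + t, ψ t s x)))) (t : ℝ) (x : M) :
    HasMFDerivAt 𝓘(ℝ, ℝ) (𝓘(ℝ, ℝ).prod 𝓘(ℝ, E)) (fun t => (t, ψ t 0 x)) t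
      ((1 : ℝ →L[ℝ] ℝ).smulRight (suspension X (t, ψ t 0 x))) := by
  have h1 : (fun t => (t, ψ t 0 x)) =ᶠ[𝓝 t] fun t => (0 + t, ψ t 0 x) :=
    Eventually.of_forall fun t => by simp only [zero_add]
  refine ((hψ t 0 x).congr_of_eventuallyEq h1).congr_mfderiv ?_
  have h2 : ∀ (r : ℝ) (y : M), r = t →
      (suspension X (r, y) : ℝ × E) = suspension X (t, y) := by
    rintro r y rfl; rfl
  exact congr_arg (fun w : ℝ × E => (1 : ℝ →L[ℝ] ℝ).smulRight w) (h2 _ _ (zero_add t))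

theorem nonempty_transport [FiniteDimensional ℝ E] [T2Space M] [CompactSpace M]
    (G : Generators E F A κ) (L : LieAlgebroid 𝓘(ℝ, E) F A)
    (ha : IsSmoothFamily a) (ha0 : ∀ t ∉ Icc (0 : ℝ) 1, a t = 0) :
    Nonempty (Transport G L a) := by
  have hX : IsSmoothField fun t x => L.anchor.toFun x ((-a t) x) :=
    L.anchor.smooth.comp (ha.neg G)
  have hX0 : ∀ t ∉ Icc (0 : ℝ) 1, ∀ x, L.anchor.toFun x ((-a t) x) = 0 := by
    intro t ht x
    rw [ha0 t ht, neg_zero]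
    exact map_zero (L.anchor.toFun x)
  obtain ⟨ψ, hψs, hψ0, hψadd, hψd⟩ := exists_timeDependentFlow hX hX0
  have hβs : ContMDiff (𝓘(ℝ, ℝ).prod 𝓘(ℝ, E)) 𝓘(ℝ, E) ∞
      fun p : ℝ × M => ψ p.1 0 p.2 :=
    hψs.comp (contMDiff_fst.prodMk (contMDiff_const.prodMk contMDiff_snd))
  -- The inverse of the time-`t` map starts at time `t` and flows for time `-t`, back to time `0`.
  have hγs : ContMDiff (𝓘(ℝ, ℝ).prod 𝓘(ℝ, E)) 𝓘(ℝ, E) ∞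
      fun p : ℝ × M => ψ (-p.1) p.1 p.2 :=
    hψs.comp (contMDiff_fst.neg.prodMk (contMDiff_fst.prodMk contMDiff_snd))
  have hβ := hasMFDerivAt_start_zero hψd
  have hgs : ContMDiff (𝓘(ℝ, ℝ).prod 𝓘(ℝ, E)) 𝓘(ℝ, (κ → ℝ) →L[ℝ] (κ → ℝ)) ∞
      fun p : ℝ × M => generator G L (a p.1) (ψ p.1 0 p.2) :=
    (contMDiff_generator G L ha).comp (contMDiff_fst.prodMk hβs)
  have hg0 : ∀ t ∉ Icc (0 : ℝ) 1, ∀ x, generator G L (a t) (ψ t 0 x) = 0 :=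
    fun t ht x => by rw [ha0 t ht, generator_zero]
  obtain ⟨U, R, hUs, hRs, hU0, hU, hR, hUR, hRU⟩ := exists_matrixFlow hgs hg0
  -- With `g` the generator, the derivative is `U (g P - P g - D) R`, which vanishes by
  -- `generator_commutator`. Hence transport intertwines the projections at `base t x` and `x`.
  have hUPR : ∀ t x, U (t, x) * G.proj (ψ t 0 x) * R (t, x) = G.proj x := by
    intro t x
    have hd : ∀ t, HasDerivAt (fun t => U (t, x) * G.proj (ψ t 0 x) * R (t, x)) 0 t := by
      intro t
      refine (((hU t x).fun_mul (hasDerivAt_proj_along G L (hβ t x))).fun_mul (hR t x)).congr_deriv ?_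
      rw [← generator_commutator]
      noncomm_ring
    have h1 := is_const_of_deriv_eq_zero (fun t => (hd t).differentiableAt)
      (fun t => (hd t).deriv) t 0
    have h2 : R (0, x) = 1 := by have := hUR (0, x); rwa [hU0, one_mul] at this
    simpa only [hU0, h2, hψ0, one_mul, mul_one] using h1
  refine ⟨⟨fun t x => ψ t 0 x, fun t x => ψ (-t) t x, U, R, hβs, hγs, hUs, hRs, ?_, ?_,
    fun x => hψ0 0 x, hU0, hUR, hRU, ?_, ?_⟩⟩
  · intro t y
    have := hψadd t (-t) t y
    rwa [add_neg_cancel, hψ0] at this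
  · intro t x
    have := hψadd (-t) t 0 x
    rwa [zero_add, neg_add_cancel, hψ0] at this
  · intro t x
    rw [← hUPR t x, mul_assoc, hRU, mul_one]
  · intro e e' he hd t x
    refine ((hU t x).clm_apply (hasDerivAt_coord_along G L he hd (hβ t x))).congr_deriv ?_
    rw [map_sub]
    exact add_sub_cancel _ _

variable (T : Transport G L a)

/-- A family with `e' = [a, e]` has zero derivative after transport, so it keeps its initial value.
-/
theorem mat_coord_eq {e : ℝ → Sections 𝓘(ℝ, E) F A} (he : IsSmoothFamily e)
    (hd : G.IsDeriv e fun t => L.bracket (a t) (e t)) (t : ℝ) (x : M) :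
    T.mat (t, x) (G.coord (T.base t x) (e t (T.base t x))) = G.coord x (e 0 x) := by
  have h1 : ∀ t, HasDerivAt
      (fun t => T.mat (t, x) (G.coord (T.base t x) (e t (T.base t x)))) 0 t := by
    intro t
    refine (T.hasDerivAt he hd t x).congr_deriv ?_
    rw [sub_self]
    exact (congr_arg _ (map_zero (G.coord _))).trans (map_zero _)
  have h2 := is_const_of_deriv_eq_zero (fun t => (h1 t).differentiableAt)
    (fun t => (h1 t).deriv) t 0
  rw [T.mat_zero] at h2
  exact h2.trans (congr_arg (fun z => G.coord z (e 0 z)) (T.base_zero x))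

theorem matInv_zero (x : M) : T.matInv (0, x) = 1 := by
  have := T.mat_mul_matInv (0, x)
  rwa [T.mat_zero, one_mul] at this

theorem mat_matInv (p : ℝ × M) (w : κ → ℝ) : T.mat p (T.matInv p w) = w :=
  DFunLike.congr_fun (T.mat_mul_matInv p) w

theorem matInv_mat (p : ℝ × M) (w : κ → ℝ) : T.matInv p (T.mat p w) = w :=
  DFunLike.congr_fun (T.matInv_mul_mat p) w

theorem mat_proj (t : ℝ) (x : M) (w : κ → ℝ) :
    T.mat (t, x) (G.proj (T.base t x) w) = G.proj x (T.mat (t, x) w) :=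
  DFunLike.congr_fun (T.mat_mul_proj t x) w

theorem matInv_proj (t : ℝ) (x : M) (w : κ → ℝ) :
    T.matInv (t, x) (G.proj x w) = G.proj (T.base t x) (T.matInv (t, x) w) := by
  rw [← T.matInv_mat (t, x) (G.proj (T.base t x) _), T.mat_proj, T.mat_matInv]

/-- Every section is the initial value of a family that is constant along the flow. -/
theorem exists_solution (T : Transport G L a) (b : Sections 𝓘(ℝ, E) F A) :
    ∃ e : ℝ → Sections 𝓘(ℝ, E) F A, IsSmoothFamily e ∧ e 0 = b ∧
      G.IsDeriv e fun t => L.bracket (a t) (e t) := by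
  -- The solution is forced: its value at `y` and time `t` is `b` at `baseInv t y`, moved to `y` by
  -- the inverse transport.
  have hc : ContMDiff (𝓘(ℝ, ℝ).prod 𝓘(ℝ, E)) 𝓘(ℝ, κ → ℝ) ∞ fun p : ℝ × M =>
      T.matInv (p.1, T.baseInv p.1 p.2)
        (G.coord (T.baseInv p.1 p.2) (b (T.baseInv p.1 p.2))) :=
    (T.contMDiff_matInv.comp (contMDiff_fst.prodMk T.contMDiff_baseInv)).clm_apply
      ((G.contMDiff_coord_section b).comp T.contMDiff_baseInv)
  let e : ℝ → Sections 𝓘(ℝ, E) F A := fun t => G.combSection _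
    (hc.comp ((contMDiff_const (c := t)).prodMk contMDiff_id))
  have he : IsSmoothFamily e := G.contMDiff_comb contMDiff_snd hc
  have hval : ∀ t x, G.coord (T.base t x) (e t (T.base t x)) =
      T.matInv (t, x) (G.coord x (b x)) := by
    intro t x
    change G.proj (T.base t x) (T.matInv (t, T.baseInv t (T.base t x))
        (G.coord (T.baseInv t (T.base t x)) (b (T.baseInv t (T.base t x))))) = _
    rw [T.baseInv_base, ← T.matInv_proj, G.proj_coord]
  refine ⟨e, he, ?_, ?_⟩
  · ext x
    refine G.coord_injective x ?_
    have := hval 0 x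
    rwa [T.base_zero, T.matInv_zero] at this
  -- The transported coefficients are constant by construction, so the transport of `e' - [a, e]` is
  -- zero; transport is invertible.
  · obtain ⟨e', -, hd⟩ := G.exists_isDeriv he
    have key : ∀ t, e' t = L.bracket (a t) (e t) := by
      intro t
      ext y
      have h1 := T.hasDerivAt he hd t (T.baseInv t y)
      simp only [hval, T.mat_matInv] at h1
      have h2 := (h1.unique (hasDerivAt_const t _))
      have h3 := congr_arg (T.matInv (t, T.baseInv t y)) h2
      rw [T.matInv_mat, map_zero, T.base_baseInv] at h3
      refine sub_eq_zero.1 (G.coord_injective y ?_)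
      exact h3.trans (map_zero _).symm
    intro t x
    have := hd t x
    rwa [key t] at this

end Transport

end SmoothFlow

/-! ### The time-one flow as a Lie algebroid automorphism -/

namespace SmoothFlow

open Topology Filter NNReal Algebroid

section Separation

variable {E : Type*} [NormedAddCommGroup E] [NormedSpace ℝ E]
  {M : Type*} [TopologicalSpace M] [ChartedSpace E M] [IsManifold 𝓘(ℝ, E) ∞ M]

/-- Tangent vectors are determined by their action on smooth functions. -/
theorem tangent_ext [FiniteDimensional ℝ E] [T2Space M] {x : M} {v w : TangentSpace 𝓘(ℝ, E) x}
    (h : ∀ g : C^∞⟮𝓘(ℝ, E), M; ℝ⟯, dirDer g x v = dirDer g x w) : v = w := by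
  obtain ⟨f⟩ : Nonempty (SmoothBumpFunction 𝓘(ℝ, E) x) := inferInstance
  set φ := extChartAt 𝓘(ℝ, E) x with hφ
  have hs : ContMDiff 𝓘(ℝ, E) 𝓘(ℝ, E) ∞ fun y => f y • φ y :=
    f.contMDiff_smul (contMDiffOn_extChartAt (n := ∞) (I := 𝓘(ℝ, E)) (x := x))
  -- The chart multiplied by a bump function is a global smooth map whose derivative at `x` is the
  -- identity in the model space, so linear functionals of it separate tangent vectors.
  have hd : ∀ u : TangentSpace 𝓘(ℝ, E) x, dirDer (fun y => f y • φ y) x u = (u : E) := by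
    intro u
    rw [dirDer_eq_fderiv (hs.mdifferentiableAt (by simp))]
    have h1 : (fun u => f (φ.symm u) • φ (φ.symm u)) =ᶠ[𝓝 (φ x)] id := by
      have hc : Tendsto φ.symm (𝓝 (φ x)) (𝓝 x) := by
        have := continuousAt_extChartAt_symm (I := 𝓘(ℝ, E)) x
        rwa [ContinuousAt, extChartAt_to_inv] at this
      filter_upwards [hc.eventually f.eventuallyEq_one, extChartAt_target_mem_nhds x]
        with u hu hu'
      have hu1 : f (φ.symm u) = 1 := hu
      rw [hu1, one_smul, φ.right_inv hu', id]
    rw [h1.fderiv_eq, fderiv_id]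
    rfl
  have key : ∀ ℓ : E →L[ℝ] ℝ, ℓ (v : E) = ℓ (w : E) := by
    intro ℓ
    have h1 := h ⟨fun y => ℓ (f y • φ y), ℓ.contMDiff.comp hs⟩
    change dirDer (fun y => ℓ (f y • φ y)) x v = dirDer (fun y => ℓ (f y • φ y)) x w at h1
    rwa [dirDer_clm_comp ℓ (hs.mdifferentiableAt (by simp)),
      dirDer_clm_comp ℓ (hs.mdifferentiableAt (by simp)), hd, hd] at h1
  exact (SeparatingDual.eq_iff_forall_dual_eq (R := ℝ) (V := E)).2 key

end Separation

variable {E : Type*} [NormedAddCommGroup E] [NormedSpace ℝ E]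
  {M : Type*} [TopologicalSpace M] [ChartedSpace E M]
  {F : Type*} [NormedAddCommGroup F] [NormedSpace ℝ F]
  {A : M → Type*} [∀ x, AddCommGroup (A x)] [∀ x, Module ℝ (A x)]
  [TopologicalSpace (TotalSpace F A)] [∀ x, TopologicalSpace (A x)] [FiberBundle F A]
  [VectorBundle ℝ F A]

-- The fibres carry only a topology; continuity is checked after passing to the finite-dimensional
-- model fibre through trivialisations.
variable (F) in
theorem continuous_linearMap_fiber [FiniteDimensional ℝ F] {x y : M} (ℓ : A x →ₗ[ℝ] A y) :
    Continuous ℓ := by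
  let ex := (trivializationAt F A x).continuousLinearEquivAt ℝ x
    (mem_baseSet_trivializationAt F A x)
  let ey := (trivializationAt F A y).continuousLinearEquivAt ℝ y
    (mem_baseSet_trivializationAt F A y)
  have h : Continuous (ey.toLinearEquiv.toLinearMap ∘ₗ ℓ ∘ₗ ex.symm.toLinearEquiv.toLinearMap) :=
    LinearMap.continuous_of_finiteDimensional _
  have h2 : ⇑ℓ = ey.symm ∘ (ey.toLinearEquiv.toLinearMap ∘ₗ ℓ ∘ₗ
      ex.symm.toLinearEquiv.toLinearMap) ∘ ex := by
    funext v
    simp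
  rw [h2]
  exact ey.symm.continuous.comp (h.comp ex.continuous)

namespace Transport

variable [IsManifold 𝓘(ℝ, E) ∞ M] [ContMDiffVectorBundle ∞ F A 𝓘(ℝ, E)]
  {κ : Type*} [Fintype κ] {G : Generators E F A κ} {L : LieAlgebroid 𝓘(ℝ, E) F A}
  {a : ℝ → Sections 𝓘(ℝ, E) F A} (T : Transport G L a)

/-- The inverse of the time-one flow on the base. -/
def diffeo : M ≃ₘ^∞⟮𝓘(ℝ, E), 𝓘(ℝ, E)⟯ M where
  toFun := T.baseInv 1
  invFun := T.base 1
  left_inv := T.base_baseInv 1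
  right_inv := T.baseInv_base 1
  contMDiff_toFun := T.contMDiff_baseInv.comp (contMDiff_const.prodMk contMDiff_id)
  contMDiff_invFun := T.contMDiff_base.comp (contMDiff_const.prodMk contMDiff_id)

/-- The inverse of the time-one flow on fibres. -/
def fiberMap (y : M) : A y →ₗ[ℝ] A (T.baseInv 1 y) :=
  G.comb _ ∘ₗ (T.mat (1, T.baseInv 1 y)).toLinearMap ∘ₗ G.coord y

theorem fiberMap_apply (y : M) (v : A y) :
    T.fiberMap y v = G.comb _ (T.mat (1, T.baseInv 1 y) (G.coord y v)) := rfl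

/-- The time-one flow on fibres. -/
def fiberInv (x : M) : A x →ₗ[ℝ] A (T.base 1 x) :=
  G.comb _ ∘ₗ (T.matInv (1, x)).toLinearMap ∘ₗ G.coord x

theorem fiberInv_apply (x : M) (v : A x) :
    T.fiberInv x v = G.comb _ (T.matInv (1, x) (G.coord x v)) := rfl

theorem coord_fiberMap (y : M) (v : A y) :
    G.coord _ (T.fiberMap y v) = T.mat (1, T.baseInv 1 y) (G.coord y v) := by
  rw [fiberMap_apply, ← Generators.proj_apply, ← T.mat_proj, T.base_baseInv, G.proj_coord]

theorem coord_fiberInv (x : M) (v : A x) :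
    G.coord _ (T.fiberInv x v) = T.matInv (1, x) (G.coord x v) := by
  rw [fiberInv_apply, ← Generators.proj_apply, ← T.matInv_proj, G.proj_coord]

theorem fiberMap_injective (y : M) : Function.Injective (T.fiberMap y) := by
  intro v w h
  have h1 := congr_arg (G.coord _) h
  rw [coord_fiberMap, coord_fiberMap] at h1
  have h2 := congr_arg (T.matInv (1, T.baseInv 1 y)) h1
  rw [T.matInv_mat, T.matInv_mat] at h2
  exact G.coord_injective y h2

/-- The inverse of the time-one flow on the total space. -/
def totalDiffeo : TotalSpace F A ≃ₘ^∞⟮𝓘(ℝ, E).prod 𝓘(ℝ, F), 𝓘(ℝ, E).prod 𝓘(ℝ, F)⟯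
    TotalSpace F A where
  toFun p := ⟨T.baseInv 1 p.1, T.fiberMap p.1 p.2⟩
  invFun p := ⟨T.base 1 p.1, T.fiberInv p.1 p.2⟩
  left_inv := by
    rintro ⟨y, v⟩
    dsimp only
    rw [fiberInv_apply, coord_fiberMap, T.matInv_mat, T.base_baseInv, G.comb_coord]
  right_inv := by
    rintro ⟨x, v⟩
    dsimp only
    rw [fiberMap_apply, coord_fiberInv, T.baseInv_base, T.mat_matInv, G.comb_coord]
  contMDiff_toFun := by
    have h0 : ContMDiff (𝓘(ℝ, E).prod 𝓘(ℝ, F)) 𝓘(ℝ, E) ∞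
        fun p : TotalSpace F A => T.baseInv 1 p.1 :=
      T.contMDiff_baseInv.comp (contMDiff_const.prodMk (contMDiff_proj A))
    refine G.contMDiff_comb h0 ?_
    exact (T.contMDiff_mat.comp (contMDiff_const.prodMk h0)).clm_apply G.contMDiff_coord
  contMDiff_invFun := by
    have h0 : ContMDiff (𝓘(ℝ, E).prod 𝓘(ℝ, F)) 𝓘(ℝ, E) ∞
        fun p : TotalSpace F A => T.base 1 p.1 :=
      T.contMDiff_base.comp (contMDiff_const.prodMk (contMDiff_proj A))
    refine G.contMDiff_comb h0 ?_
    exact (T.contMDiff_matInv.comp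
      (contMDiff_const.prodMk (contMDiff_proj A))).clm_apply G.contMDiff_coord

/-- Solutions are transported by the flow. -/
theorem fiberMap_solution {e : ℝ → Sections 𝓘(ℝ, E) F A} (he : IsSmoothFamily e)
    (hd : G.IsDeriv e fun t => L.bracket (a t) (e t)) (y : M) :
    T.fiberMap y (e 1 y) = e 0 (T.baseInv 1 y) := by
  refine G.coord_injective _ ?_
  rw [coord_fiberMap, ← T.mat_coord_eq he hd 1 (T.baseInv 1 y)]
  congr 1
  exact congr_arg (fun z => G.coord z (e 1 z)) (T.base_baseInv 1 y).symm

theorem jacobi_left (L : LieAlgebroid 𝓘(ℝ, E) F A) (a b c : Sections 𝓘(ℝ, E) F A) :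
    L.bracket a (L.bracket b c) =
      L.bracket (L.bracket a b) c + L.bracket b (L.bracket a c) := by
  have h := L.jacobi a b c
  rw [lieBracket_neg_swap L (L.bracket b c) a, lieBracket_neg_swap L c a,
    map_neg, LinearMap.neg_apply, lieBracket_neg_swap L (L.bracket a c) b, neg_neg] at h
  have h2 : L.bracket (L.bracket a b) c + L.bracket b (L.bracket a c) -
      L.bracket a (L.bracket b c) = 0 := by rw [← h]; abel
  exact (sub_eq_zero.1 h2).symm

/-- By the Jacobi identity `[a_t, ·]` is a derivation of the bracket, as is the time derivative. -/
theorem solution_bracket (G : Generators E F A κ) {b c : ℝ → Sections 𝓘(ℝ, E) F A}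
    (hb : IsSmoothFamily b) (hc : IsSmoothFamily c)
    (hb' : G.IsDeriv b fun t => L.bracket (a t) (b t))
    (hc' : G.IsDeriv c fun t => L.bracket (a t) (c t)) :
    G.IsDeriv (fun t => L.bracket (b t) (c t))
      fun t => L.bracket (a t) (L.bracket (b t) (c t)) := by
  simp only [jacobi_left L (a _) (b _) (c _)]
  exact G.isDeriv_bracket L hb hc hb' hc'

/-- Extend `b'` and `c'` to families that are constant along the flow. Injectivity on fibres
identifies their time-one values with `b` and `c`, and the bracket of the two families is again
constant along the flow. -/
theorem fiberMap_bracket {b b' c c' : Sections 𝓘(ℝ, E) F A}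
    (hb : ∀ y, b' (T.baseInv 1 y) = T.fiberMap y (b y))
    (hc : ∀ y, c' (T.baseInv 1 y) = T.fiberMap y (c y)) (y : M) :
    L.bracket b' c' (T.baseInv 1 y) = T.fiberMap y (L.bracket b c y) := by
  obtain ⟨β, hβ, rfl, hβd⟩ := T.exists_solution b'
  obtain ⟨γ, hγ, rfl, hγd⟩ := T.exists_solution c'
  have h1 : β 1 = b := by
    ext y
    exact T.fiberMap_injective y ((T.fiberMap_solution hβ hβd y).trans (hb y))
  have h2 : γ 1 = c := by
    ext y
    exact T.fiberMap_injective y ((T.fiberMap_solution hγ hγd y).trans (hc y))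
  have h3 := T.fiberMap_solution (G.isSmoothFamily_bracket L hβ hγ)
    (solution_bracket G hβ hγ hβd hγd) y
  rw [h1, h2] at h3
  exact h3.symm

/-- Every vector is the value of a section whose push-forward is a section. -/
theorem exists_section_pair (y : M) (v : A y) : ∃ b b' : Sections 𝓘(ℝ, E) F A,
    (∀ z, b' (T.baseInv 1 z) = T.fiberMap z (b z)) ∧ b y = v := by
  obtain ⟨e, he, h0, hd⟩ := T.exists_solution
    (G.combSection (fun _ => G.coord _ (T.fiberMap y v)) contMDiff_const)
  refine ⟨e 1, e 0, fun z => (T.fiberMap_solution he hd z).symm, T.fiberMap_injective y ?_⟩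
  rw [T.fiberMap_solution he hd, h0]
  exact G.comb_coord _ _

/-- The anchor is determined by the bracket: comparing the Leibniz rules for `[b', g b']` and for
`[b, (g ∘ base) b]` isolates the derivatives of `g` along the two vectors, and functions separate
tangent vectors. -/
theorem fiberMap_anchor [FiniteDimensional ℝ E] [T2Space M] (y : M) (v : A y) :
    L.anchor.toFun (T.baseInv 1 y) (T.fiberMap y v) =
      mfderiv 𝓘(ℝ, E) 𝓘(ℝ, E) (T.baseInv 1) y (L.anchor.toFun y v) := by
  by_cases hv : v = 0
  · subst hv
    rw [map_zero, map_zero, map_zero, map_zero]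
  obtain ⟨b, b', hb, rfl⟩ := T.exists_section_pair y v
  refine tangent_ext fun g => ?_
  have hγ : ContMDiff 𝓘(ℝ, E) 𝓘(ℝ, E) ∞ (T.baseInv 1) := T.diffeo.contMDiff_toFun
  have hg : ContMDiff 𝓘(ℝ, E) 𝓘(ℝ, ℝ) ∞ g := g.contMDiff
  set g' : C^∞⟮𝓘(ℝ, E), M; ℝ⟯ := ⟨fun z => g (T.baseInv 1 z), hg.comp hγ⟩ with hg'
  have hgb : ∀ z, smulSection g b' (T.baseInv 1 z) = T.fiberMap z (smulSection g' b z) := by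
    intro z
    rw [smulSection_apply, smulSection_apply, map_smul, hb]
    rfl
  have h1 := T.fiberMap_bracket hb hgb y
  rw [L.leibniz, L.leibniz, map_add, map_smul, map_smul, T.fiberMap_bracket hb hb y, ← hb y] at h1
  have h2 := add_left_cancel h1
  -- Both derivatives occur as coefficients of this vector, which can be cancelled only if it is
  -- nonzero; hence the separate treatment of `v = 0`.
  have hne : b' (T.baseInv 1 y) ≠ 0 := by
    rw [hb y]
    exact fun h => hv (T.fiberMap_injective y (h.trans (map_zero _).symm))
  have h3 := smul_left_injective ℝ hne h2
  rw [← hb y]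
  refine h3.trans ?_
  change mfderiv 𝓘(ℝ, E) 𝓘(ℝ, ℝ) (g ∘ T.baseInv 1) y _ = _
  rw [mfderiv_comp y (hg.mdifferentiableAt (by simp)) (hγ.mdifferentiableAt (by simp))]
  rfl

/-- The inverse of the time-one flow as an automorphism of the Lie algebroid. -/
def automorphism [FiniteDimensional ℝ E] [T2Space M] [FiniteDimensional ℝ F] :
    L.Automorphism where
  base := T.diffeo
  fiber y := ⟨T.fiberMap y, continuous_linearMap_fiber F _⟩
  total := T.totalDiffeo
  total_apply _ _ := rfl
  map_anchor := T.fiberMap_anchor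
  map_bracket _ _ _ _ ha hb := T.fiberMap_bracket ha hb

/-- The flow intertwines a family of endomorphisms whose derivative is its Lie derivative. -/
theorem fiberMap_endomorphism {j : ℝ → BundleMap 𝓘(ℝ, E) F A F A} (hj : IsSmoothEndFamily j)
    (hd : ∀ b, G.IsDeriv (fun t => (j t).onSections b) fun t =>
      L.bracket (a t) ((j t).onSections b) - (j t).onSections (L.bracket (a t) b))
    (y : M) (v : A y) :
    T.fiberMap y ((j 1).toFun y v) = (j 0).toFun (T.baseInv 1 y) (T.fiberMap y v) := by
  obtain ⟨e, he, h0, hed⟩ := T.exists_solution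
    (G.combSection (fun _ => G.coord _ (T.fiberMap y v)) contMDiff_const)
  have h1 : e 1 y = v := by
    refine T.fiberMap_injective y ?_
    rw [T.fiberMap_solution he hed, h0]
    exact G.comb_coord _ _
  -- The product rule gives `j [a, e] + ([a, j e] - j [a, e])`, so `j e` is again constant along the
  -- flow.
  have h2 : G.IsDeriv (fun t => (j t).onSections (e t))
      fun t => L.bracket (a t) ((j t).onSections (e t)) := by
    have h := G.isDeriv_onSections hj hed hd
    simpa only [add_sub_cancel] using h
  have h3 := T.fiberMap_solution (hj.onSections he) h2 y
  change T.fiberMap y ((j 1).toFun y (e 1 y)) = (j 0).toFun _ (e 0 _) at h3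
  rwa [← T.fiberMap_solution he hed, h1] at h3

end Transport

end SmoothFlow

/-! ### The real form of the `∂̄`-equation and time derivatives of `j` -/

namespace SmoothFlow

open Topology Filter NNReal Algebroid

section Complexification

variable {V V' : Type*} [AddCommGroup V] [Module ℝ V] [AddCommGroup V'] [Module ℝ V']

variable (V) in
/-- The real part of a vector in the complexification. -/
def realPart : ℂ ⊗[ℝ] V →ₗ[ℝ] V :=
  (TensorProduct.lid ℝ V).toLinearMap ∘ₗ LinearMap.rTensor V Complex.reLm

@[simp] theorem realPart_tmul (c : ℂ) (v : V) : realPart V (c ⊗ₜ[ℝ] v) = c.re • v := by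
  simp [realPart]

theorem realPart_baseChange (f : V →ₗ[ℝ] V') (z : ℂ ⊗[ℝ] V) :
    realPart V' (f.baseChange ℂ z) = f (realPart V z) := by
  induction z using TensorProduct.induction_on with
  | zero => simp
  | tmul c v => simp
  | add y z hy hz => simp only [map_add, hy, hz]

end Complexification

variable {E : Type*} [NormedAddCommGroup E] [NormedSpace ℝ E]
  {M : Type*} [TopologicalSpace M] [ChartedSpace E M]
  {F : Type*} [NormedAddCommGroup F] [NormedSpace ℝ F]
  {A : M → Type*} [∀ x, AddCommGroup (A x)] [∀ x, Module ℝ (A x)]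
  [TopologicalSpace (TotalSpace F A)] [∀ x, TopologicalSpace (A x)] [FiberBundle F A]
  [VectorBundle ℝ F A]

theorem onComplexSections_tmul (j : BundleMap 𝓘(ℝ, E) F A F A) (c : ℂ)
    (b : Sections 𝓘(ℝ, E) F A) :
    j.onComplexSections (c ⊗ₜ[ℝ] b) = c ⊗ₜ[ℝ] j.onSections b := by
  simp [BundleMap.onComplexSections]

/-- The imaginary part of a section of type `(0,1)` is `j` applied to its real part. -/
theorem onSections_of_mem_sections01 {j : BundleMap 𝓘(ℝ, E) F A F A}
    {u v : Sections 𝓘(ℝ, E) F A}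
    (h : (1 : ℂ) ⊗ₜ[ℝ] u + Complex.I ⊗ₜ[ℝ] v ∈ sections01 j) : j.onSections u = v := by
  rw [sections01, Module.End.mem_eigenspace_iff] at h
  have h1 := congr_arg (realPart _) h
  simpa [onComplexSections_tmul, TensorProduct.smul_tmul'] using h1

variable [IsManifold 𝓘(ℝ, E) ∞ M] {L : LieAlgebroid 𝓘(ℝ, E) F A}

theorem mem_sections01 {j : BundleMap 𝓘(ℝ, E) F A F A} (hj : L.IsIntegrableComplexStructure j)
    (b : Sections 𝓘(ℝ, E) F A) :
    (1 : ℂ) ⊗ₜ[ℝ] b + Complex.I ⊗ₜ[ℝ] j.onSections b ∈ sections01 j := by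
  have h : j.onSections (j.onSections b) = -b := by
    ext x
    exact hj.sq x (b x)
  rw [sections01, Module.End.mem_eigenspace_iff]
  simp only [map_add, onComplexSections_tmul, h, smul_add, TensorProduct.smul_tmul',
    smul_eq_mul, TensorProduct.tmul_neg, mul_one, neg_mul, Complex.I_mul_I, neg_neg,
    TensorProduct.neg_tmul]
  abel

/-- The real part of the equation `∂̄ z̄ = -2 T` is an equation for a Lie derivative of `j`. -/
theorem lieDerivative_of_dbar {j : BundleMap 𝓘(ℝ, E) F A F A}
    (hj : L.IsIntegrableComplexStructure j) {u v : Sections 𝓘(ℝ, E) F A}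
    (hz : (1 : ℂ) ⊗ₜ[ℝ] u + Complex.I ⊗ₜ[ℝ] v ∈ sections01 j)
    {T : ∀ x, A x →L[ℝ] A x}
    (h : ∀ X ∈ sections01 j, ∀ x, (evalAt x).baseChange ℂ
        (L.dbar j (conj ((1 : ℂ) ⊗ₜ[ℝ] u + Complex.I ⊗ₜ[ℝ] v)) X) =
      (-2 : ℂ) • (T x).toLinearMap.baseChange ℂ ((evalAt x).baseChange ℂ X))
    (b : Sections 𝓘(ℝ, E) F A) (x : M) :
    (L.bracket v (j.onSections b) - j.onSections (L.bracket v b)) x = (2 : ℝ) • T x (b x) := by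
  have hu := onSections_of_mem_sections01 hz
  have hN := hj.nijenhuis b u
  rw [hu] at hN
  have h1 := congr_arg (realPart (A x)) (h _ (mem_sections01 hj b) x)
  have e2 : (-2 : ℂ) = ((-2 : ℝ) : ℂ) := by norm_num
  rw [realPart_baseChange, e2, Complex.coe_smul, map_smul, realPart_baseChange,
    realPart_baseChange] at h1
  -- Real part of `(1 - i j) / 2` applied to `[b + i j b, u - i v]`.
  have hdb : realPart _ (L.dbar j (conj ((1 : ℂ) ⊗ₜ[ℝ] u + Complex.I ⊗ₜ[ℝ] v))
      ((1 : ℂ) ⊗ₜ[ℝ] b + Complex.I ⊗ₜ[ℝ] j.onSections b)) =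
      (1 / 2 : ℝ) • (L.bracket b u + L.bracket (j.onSections b) v +
        j.onSections (L.bracket (j.onSections b) u - L.bracket b v)) := by
    have e3 : (1 / 2 : ℂ) = ((1 / 2 : ℝ) : ℂ) := by norm_num
    have hc : conj ((1 : ℂ) ⊗ₜ[ℝ] u + Complex.I ⊗ₜ[ℝ] v) =
        (1 : ℂ) ⊗ₜ[ℝ] u - Complex.I ⊗ₜ[ℝ] v := by
      simp [conj, TensorProduct.neg_tmul, sub_eq_add_neg]
    rw [hc, LieAlgebroid.dbar, pr10, LinearMap.smul_apply, e3, Complex.coe_smul, map_smul]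
    congr 1
    simp only [LieAlgebroid.complexBracket, map_add, map_sub, LinearMap.add_apply,
      LinearMap.sub_apply, LinearMap.id_apply, LinearMap.smul_apply,
      LinearMap.BilinMap.baseChange_tmul, onComplexSections_tmul,
      TensorProduct.smul_tmul', realPart_tmul]
    simp
    abel
  rw [hdb] at h1
  have h4 : realPart _ ((1 : ℂ) ⊗ₜ[ℝ] b + Complex.I ⊗ₜ[ℝ] j.onSections b) = b := by simp
  rw [h4] at h1
  -- Integrability for `(b, u)`, with `j u = v`, expresses `j [j b, u]` through the other three
  -- terms; the `[b, u]` terms then cancel and the rest doubles.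
  have h5 : L.bracket b u + L.bracket (j.onSections b) v +
      j.onSections (L.bracket (j.onSections b) u - L.bracket b v) =
      (-2 : ℝ) • (L.bracket v (j.onSections b) - j.onSections (L.bracket v b)) := by
    rw [lieBracket_neg_swap L v, lieBracket_neg_swap L v b]
    simp only [map_add, map_sub, map_neg] at hN ⊢
    have h6 : j.onSections (L.bracket (j.onSections b) u) =
        L.bracket (j.onSections b) v - L.bracket b u - j.onSections (L.bracket b v) := by
      rw [← sub_eq_zero, ← neg_eq_zero, ← hN]
      abel
    rw [h6]
    module
  rw [h5, smul_smul] at h1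
  have h7 : ((1 / 2 : ℝ) * -2) = -1 := by norm_num
  rw [h7, neg_one_smul] at h1
  change -((L.bracket v (j.onSections b) - j.onSections (L.bracket v b)) x) =
    (-2 : ℝ) • T x (b x) at h1
  rw [← neg_inj, h1, neg_smul]

section TimeDerivative

variable [ContMDiffVectorBundle ∞ F A 𝓘(ℝ, E)] [FiniteDimensional ℝ F]
  {κ : Type*} [Fintype κ] (G : Generators E F A κ) {j : ℝ → BundleMap 𝓘(ℝ, E) F A F A}

/-- The path conjugated by the trivialisation is smooth because its values on each vector are, as
the coefficients show; hence `derivWithin` in `timeDeriv` is a genuine derivative, and applying the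
inverse trivialisation undoes the conjugation. -/
theorem hasDerivWithinAt_timeDeriv (hj : IsSmoothEndPath j) {t : ℝ} (ht : t ∈ Icc (0 : ℝ) 1)
    (x : M) (w : A x) :
    HasDerivWithinAt (fun s => G.coord x ((j s).toFun x w)) (G.coord x (timeDeriv j t x w))
      (Icc 0 1) t := by
  set e := trivializationAt F A x with he
  have hb : x ∈ e.baseSet := mem_baseSet_trivializationAt F A x
  have hsm : ∀ w : A x, ContDiffOn ℝ ∞ (fun s => G.coord x ((j s).toFun x w)) (Icc 0 1) := by
    intro w
    have h1 : ContMDiff 𝓘(ℝ, ℝ) (𝓘(ℝ, ℝ).prod (𝓘(ℝ, E).prod 𝓘(ℝ, F))) ∞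
        fun s : ℝ => (s, (⟨x, w⟩ : TotalSpace F A)) := contMDiff_id.prodMk contMDiff_const
    exact (G.contMDiff_coord.comp_contMDiffOn
      (hj.comp h1.contMDiffOn fun s hs => ⟨hs, mem_univ _⟩)).contDiffOn
  set N : ℝ → F →L[ℝ] F := fun s => e.continuousLinearMapAt ℝ x ∘L (j s).toFun x ∘L
    e.symmL ℝ x with hN
  have hNs : ContDiffOn ℝ ∞ N (Icc 0 1) := by
    rw [contDiffOn_clm_apply]
    intro f
    let Λ : (κ → ℝ) →L[ℝ] F := LinearMap.toContinuousLinearMap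
      ((e.continuousLinearMapAt ℝ x).toLinearMap ∘ₗ G.comb x)
    refine (Λ.contDiff.comp_contDiffOn (hsm (e.symmL ℝ x f))).congr fun s _ => ?_
    change _ = e.continuousLinearMapAt ℝ x (G.comb x (G.coord x _))
    rw [G.comb_coord]
    rfl
  have hNd : HasDerivWithinAt N (derivWithin N (Icc 0 1) t) (Icc 0 1) t :=
    ((hNs t ht).differentiableWithinAt (by simp)).hasDerivWithinAt
  let Θ : F →L[ℝ] (κ → ℝ) := LinearMap.toContinuousLinearMap
    (G.coord x ∘ₗ (e.symmL ℝ x).toLinearMap)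
  have h1 := Θ.hasFDerivAt.comp_hasDerivWithinAt t
    (hNd.clm_apply (hasDerivWithinAt_const t (Icc (0 : ℝ) 1) (e.continuousLinearMapAt ℝ x w)))
  rw [map_zero, add_zero] at h1
  refine h1.congr_of_mem (fun s _ => ?_) ht
  change _ = G.coord x (e.symmL ℝ x (e.continuousLinearMapAt ℝ x ((j s).toFun x
    (e.symmL ℝ x (e.continuousLinearMapAt ℝ x w)))))
  rw [e.symmL_continuousLinearMapAt hb, e.symmL_continuousLinearMapAt hb]

end TimeDerivative

theorem deriv_smoothTransition_eq_zero {t : ℝ} (ht : t ∉ Icc (0 : ℝ) 1) :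
    deriv Real.smoothTransition t = 0 := by
  rcases lt_or_ge t 0 with h | h
  · have : Real.smoothTransition =ᶠ[𝓝 t] fun _ => 0 := by
      filter_upwards [Iio_mem_nhds h] with s hs
      exact Real.smoothTransition.zero_of_nonpos (le_of_lt hs)
    rw [this.deriv_eq, deriv_const]
  · have h1 : 1 < t := not_le.1 fun h1 => ht ⟨h, h1⟩
    have : Real.smoothTransition =ᶠ[𝓝 t] fun _ => 1 := by
      filter_upwards [Ioi_mem_nhds h1] with s hs
      exact Real.smoothTransition.one_of_one_le (le_of_lt hs)
    rw [this.deriv_eq, deriv_const]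

end SmoothFlow

end

/-! ### The main theorem -/

open SmoothFlow
theorem mainTheorem6
    {E : Type*} [NormedAddCommGroup E] [NormedSpace ℝ E] [FiniteDimensional ℝ E]
    {M : Type*} [TopologicalSpace M] [ChartedSpace E M] [IsManifold 𝓘(ℝ, E) ∞ M]
    [T2Space M] [CompactSpace M]
    {F : Type*} [NormedAddCommGroup F] [NormedSpace ℝ F] [FiniteDimensional ℝ F]
    {A : M → Type*} [∀ x, AddCommGroup (A x)] [∀ x, Module ℝ (A x)]
    [TopologicalSpace (TotalSpace F A)] [∀ x, TopologicalSpace (A x)] [FiberBundle F A]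
    [VectorBundle ℝ F A] [ContMDiffVectorBundle ∞ F A 𝓘(ℝ, E)]
    (L : LieAlgebroid 𝓘(ℝ, E) F A)
    (j : ℝ → BundleMap 𝓘(ℝ, E) F A F A)
    (hj : ∀ t ∈ Icc (0 : ℝ) 1, L.IsIntegrableComplexStructure (j t))
    (hj_smooth : IsSmoothEndPath j)
    (z : ℝ → ComplexSections 𝓘(ℝ, E) F A)
    (hz : ∀ t ∈ Icc (0 : ℝ) 1, z t ∈ sections01 (j t))
    (hz_smooth : IsSmoothComplexPath z)
    (hdbar : ∀ t ∈ Icc (0 : ℝ) 1, ∀ X ∈ sections01 (j t), ∀ x : M,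
      (evalAt x).baseChange ℂ (L.dbar (j t) (conj (z t)) X) =
        (-2 : ℂ) • (timeDeriv j t x).toLinearMap.baseChange ℂ ((evalAt x).baseChange ℂ X)) :
    ∃ φ : L.Automorphism, ∀ (x : M) (v : A x),
      φ.fiber x ((j 1).toFun x v) = (j 0).toFun (φ.base x) (φ.fiber x v) := by
  obtain ⟨n, ⟨G⟩⟩ := Generators.exists_fin (E := E) (F := F) (A := A)
  obtain ⟨u, v, -, hv, huv⟩ := hz_smooth
  -- The step function maps the line into `[0,1]` with `τ 0 = 0` and `τ 1 = 1`, so composing with it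
  -- extends families on `[0,1]` smoothly to all times and keeps the endpoints.
  set τ := Real.smoothTransition with hτ
  have hτm : ∀ t, τ t ∈ Icc (0 : ℝ) 1 := fun t =>
    ⟨Real.smoothTransition.nonneg t, Real.smoothTransition.le_one t⟩
  have hτs : ContDiff ℝ ∞ τ := Real.smoothTransition.contDiff
  have hτd : ContDiff ℝ ∞ (deriv τ) := (contDiff_infty_iff_deriv.1 hτs).2
  have hT : ∀ t b x, (L.bracket (v (τ t)) ((j (τ t)).onSections b) -
      (j (τ t)).onSections (L.bracket (v (τ t)) b)) x =
      (2 : ℝ) • timeDeriv j (τ t) x (b x) := by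
    intro t
    have h1 := hz (τ t) (hτm t)
    have h2 := hdbar (τ t) (hτm t)
    rw [huv (τ t) (hτm t)] at h1 h2
    exact lieDerivative_of_dbar (hj (τ t) (hτm t)) h1 h2
  -- The factor `1 / 2` comes from `L_v j = 2 j̇`, and `τ'` from the chain rule for `j (τ t)`; it
  -- also makes `a` vanish outside `[0,1]`.
  set a : ℝ → Sections 𝓘(ℝ, E) F A := fun t => (deriv τ t / 2) • v (τ t) with ha
  have has : IsSmoothFamily a := by
    rw [G.isSmoothFamily_iff]
    have h1 : ContMDiff (𝓘(ℝ, ℝ).prod 𝓘(ℝ, E)) (𝓘(ℝ, ℝ).prod 𝓘(ℝ, E)) ∞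
        fun p : ℝ × M => (τ p.1, p.2) :=
      (hτs.contMDiff.comp contMDiff_fst).prodMk contMDiff_snd
    have h2 : ContMDiff (𝓘(ℝ, ℝ).prod 𝓘(ℝ, E)) 𝓘(ℝ, Fin n → ℝ) ∞
        fun p : ℝ × M => G.coord p.2 (v (τ p.1) p.2) :=
      G.contMDiff_coord_comp (hv.comp_contMDiff h1 fun p => ⟨hτm p.1, mem_univ _⟩)
    have h3 : ContMDiff (𝓘(ℝ, ℝ).prod 𝓘(ℝ, E)) 𝓘(ℝ, ℝ) ∞
        fun p : ℝ × M => deriv τ p.1 / 2 :=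
      (hτd.div_const 2).contMDiff.comp contMDiff_fst
    exact (h3.smul h2).congr fun p => map_smul (G.coord p.2) _ _
  have ha0 : ∀ t ∉ Icc (0 : ℝ) 1, a t = 0 := fun t ht => by
    rw [ha]
    dsimp only
    rw [deriv_smoothTransition_eq_zero ht, zero_div, zero_smul]
  have hjs : IsSmoothEndFamily fun t => j (τ t) := by
    have h1 : ContMDiff (𝓘(ℝ, ℝ).prod (𝓘(ℝ, E).prod 𝓘(ℝ, F)))
        (𝓘(ℝ, ℝ).prod (𝓘(ℝ, E).prod 𝓘(ℝ, F))) ∞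
        fun p : ℝ × TotalSpace F A => (τ p.1, p.2) :=
      (hτs.contMDiff.comp contMDiff_fst).prodMk contMDiff_snd
    exact hj_smooth.comp_contMDiff h1 fun p => ⟨hτm p.1, mem_univ _⟩
  obtain ⟨T⟩ := Transport.nonempty_transport G L has ha0
  refine ⟨T.automorphism, fun x w => ?_⟩
  have h := T.fiberMap_endomorphism hjs (fun b t x => ?_) x w
  · simp only [hτ, Real.smoothTransition.one, Real.smoothTransition.zero] at h
    exact h
  -- A derivative within `[0,1]` suffices for the chain rule, because `τ` takes all its values
  -- there.
  · have h1 := (hasDerivWithinAt_timeDeriv G hj_smooth (hτm t) x (b x)).scomp_hasDerivAt t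
      ((hτs.differentiable (by simp) t).hasDerivAt) hτm
    refine h1.congr_deriv ?_
    have h2 : L.bracket (a t) ((j (τ t)).onSections b) - (j (τ t)).onSections (L.bracket (a t) b)
        = (deriv τ t / 2) • (L.bracket (v (τ t)) ((j (τ t)).onSections b) -
      (j (τ t)).onSections (L.bracket (v (τ t)) b)) := by
      simp only [ha, map_smul, LinearMap.smul_apply, smul_sub]
    dsimp only
    rw [h2, ← map_smul]
    congr 1
    refine Eq.trans ?_ (congr_arg ((deriv τ t / 2) • ·) (hT t b x)).symm
    rw [smul_smul, div_mul_cancel₀ _ (two_ne_zero)]
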